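/- **Theorem (Robin–Robin, two general subdomains).** Let $\Omega\subset\mathbb R^2$ be a bounded polygonal Lipschitz domain, decomposed into two disjoint polygonal Lipschitz subdomains $\Omega_1,\Omega_2\subset\Omega$ with $\Omega\subset\overline{\Omega}_1\cup\overline{\Omega}_2$, let $\Gamma=\partial\Omega_1\cap\partial\Omega_2$, and suppose that $\partial\Omega_i\setminus\Gamma\neq\emptyset$ for $i=1,2$. Let $\mathcal T_h$ be a regular and quasi-uniform triangulation of $\Omega$ (with regularity parameter $\sigma$) of mesh size $h$ such that $\Gamma$ does not cut through any element, let $W\subset H^1_0(\Omega)$ be the P1 conforming finite element space on $\mathcal T_h$, let $W_i=W|_{\Omega_i}$, $W_i^0=W_i\cap H^1_0(\Omega_i)$, $V_\Gamma=W|_\Gamma$, and put, for $\nu_1,\nu_2>0$, $$a_i(u,v)=\int_{\Omega_i}\nu_i\nabla u\cdot\nabla v,\qquad (f,v)_i=\int_{\Omega_i}fv,\qquad \langle u,v\rangle=\int_\Gamma uv .$$ For $u\in V_\Gamma$ let $\mathcal H_iu\in W_i$ be the discrete harmonic extension: $\mathcal H_iu=u$ on $\Gamma$, $\mathcal H_iu=0$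 on $\partial\Omega_i\setminus\Gamma$, $a_i(\mathcal H_iu,v)=0$ for all $v\in W_i^0$. Let $S_i:V_\Gamma\to V_\Gamma$ be the Schur complement operator, $\langle S_iu,v\rangle=a_i(\mathcal H_iu,z)$ for all $v\in V_\Gamma$ and any $z\in W_i$ with $z|_\Gamma=v$. For Robin parameters $\gamma_1,\gamma_2>0$ let $$P_4^{-1}=(\gamma_1I-S_2)(\gamma_2I+S_2)^{-1},\qquad G=(\gamma_2I+S_2)(\gamma_1I-S_2)^{-1}-(\gamma_2I-S_1)(\gamma_1I+S_1)^{-1},\qquad R_4=I-\theta P_4^{-1}G .$$ The Robin–Robin algorithm for a source $f\in L^2(\Omega)$ and a relaxation parameter $\theta$ computes $g_1^{n+1}\in V_\Gamma$ from $g_1^n\in V_\Gamma$ as follows: find $u_1^n\in W_1$ with $a_1(u_1^n,v)+\gamma_1\langle u_1^n,v\rangle=(f,v)_1+\langle g_1^n,v\rangle$ for all $v\in W_1$; set $g_2^n=(\gamma_1+\gamma_2)u_1^n-g_1^n$ on $\Gamma$; find $u_2^n\in W_2$ with $a_2(u_2^n,v)+\gamma_2\langle u_2^n,v\rangle=(f,v)_2+\langle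 g_2^n,v\rangle$ for all $v\in W_2$; set $\tilde g_1^n=(\gamma_1+\gamma_2)u_2^n-g_2^n$ on $\Gamma$ and $g_1^{n+1}=\theta\tilde g_1^n+(1-\theta)g_1^n$. There are constants $C_0,c_0,C>0$, depending only on $\Omega,\Omega_1,\Omega_2$ and $\sigma$ (not on $h$, $\nu_1$, $\nu_2$, $\gamma_1$, $\gamma_2$, $f$), such that for all such triangulations and all $\nu_1,\nu_2>0$ the operators $S_1,S_2$ are well defined and unique, and if $\gamma_1\ge C_0\nu_2h^{-1}$ and $0<\gamma_2\le c_0\nu_1$, then $\gamma_2I+S_2$, $\gamma_1I-S_2$ and $\gamma_1I+S_1$ are invertible, all (complex) eigenvalues of $P_4^{-1}G$ are real, and $$\lambda(P_4^{-1}G)\subset\Big[1,\;1+C\frac{\nu_1}{\nu_2}\Big].$$ Moreover, with $\theta=\dfrac{2}{2+C\nu_1/\nu_2}$, the convergence rate of the Robin–Robin algorithm, i.e. the spectral radius of its error operator $R_4$, satisfies $$\rho(R_4)<1\qquad\text{and}\qquad\rho(R_4)\le C\,\frac{\nu_1}{\nu_2},$$ so that the rate is $O(\nu_1/\nu_2)$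 when $\nu_1\ll\nu_2$. Here $R_4$ is the error operator in the following sense: for each $f\in L^2(\Omega)$ there are a solution $u\in W$ of $a_1(u,v)+a_2(u,v)=(f,v)_1+(f,v)_2$ for all $v\in W$, and a $g_1^*\in V_\Gamma$ with $a_1(u,v)+\gamma_1\langle u,v\rangle=(f,v)_1+\langle g_1^*,v\rangle$ for all $v\in W_1$, such that each sweep of the algorithm is well defined, and it takes $g_1^n$ to $g_1^{n+1}$ exactly when $g_1^{n+1}-g_1^*=R_4(g_1^n-g_1^*)$. -/

import Mathlib

open MeasureTheory Set
open scoped NNReal ENNReal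

noncomputable section

namespace RobinRobin

/-- The Euclidean plane. -/
abbrev Plane : Type := EuclideanSpace ℝ (Fin 2)

/-! ### Geometry -/

/-- A bounded polygonal domain with Lipschitz boundary: near each boundary point, in suitable
orthonormal coordinates, the set is the strict epigraph of a Lipschitz function, and the boundary
lies in a finite union of segments. -/
structure IsPolygonalDomain (Ω : Set Plane) : Prop where
  isOpen : IsOpen Ω
  isConnected : IsConnected Ω
  isBounded : Bornology.IsBounded Ω
  lipschitz : ∀ x ∈ frontier Ω, ∃ (e : OrthonormalBasis (Fin 2) ℝ Plane) (r : ℝ) (L : ℝ≥0)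
    (φ : ℝ → ℝ), 0 < r ∧ LipschitzWith L φ ∧
      ∀ y ∈ Metric.ball x r, y ∈ Ω ↔ φ (inner ℝ (e 0) y) < inner ℝ (e 1) y
  polygonal : ∃ F : Finset (Plane × Plane), frontier Ω ⊆ ⋃ p ∈ F, segment ℝ p.1 p.2

/-- The interface `Γ = ∂Ω₁ ∩ ∂Ω₂`. -/
def interface (Ω₁ Ω₂ : Set Plane) : Set Plane := frontier Ω₁ ∩ frontier Ω₂

/-- A nonoverlapping decomposition of the polygonal domain `Ω` into two polygonal subdomains, each
of which has a part of its boundary off the interface (that part lies in `∂Ω`, where the homogeneous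
Dirichlet condition is imposed). -/
structure IsDecomposition (Ω Ω₁ Ω₂ : Set Plane) : Prop where
  domain : IsPolygonalDomain Ω
  domain₁ : IsPolygonalDomain Ω₁
  domain₂ : IsPolygonalDomain Ω₂
  subset₁ : Ω₁ ⊆ Ω
  subset₂ : Ω₂ ⊆ Ω
  disjoint : Disjoint Ω₁ Ω₂
  cover : Ω ⊆ closure Ω₁ ∪ closure Ω₂
  dirichlet₁ : (frontier Ω₁ \ interface Ω₁ Ω₂).Nonempty
  dirichlet₂ : (frontier Ω₂ \ interface Ω₁ Ω₂).Nonempty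

/-! ### Triangulations -/

/-- The triangles (given by their vertex sets) of a simplicial complex in the plane. -/
def triangles (K : Geometry.SimplicialComplex ℝ Plane) : Set (Finset Plane) :=
  {t | t ∈ K.faces ∧ t.card = 3}

/-- `K` is a (conforming) triangulation of the polygonal domain `Ω`. -/
structure IsTriangulation (K : Geometry.SimplicialComplex ℝ Plane) (Ω : Set Plane) : Prop where
  finite : K.faces.Finite
  pure : ∀ s ∈ K.faces, ∃ t ∈ triangles K, s ⊆ t
  space_eq : K.space = closure Ω

/-- The mesh size `h`: the largest diameter of a triangle. -/
def meshSize (K : Geometry.SimplicialComplex ℝ Plane) : ℝ :=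
  sSup ((fun t : Finset Plane => Metric.diam (convexHull ℝ (t : Set Plane))) '' triangles K)

/-- Regularity and quasi-uniformity with parameter `σ`: each triangle contains a disc whose
diameter is at least the diameter of the triangle divided by `σ`, and the mesh size is at most `σ`
times the diameter of any triangle. -/
structure IsRegularQuasiUniform (K : Geometry.SimplicialComplex ℝ Plane) (σ : ℝ) : Prop where
  regular : ∀ t ∈ triangles K, ∃ (c : Plane) (r : ℝ), 0 < r ∧
    Metric.closedBall c r ⊆ convexHull ℝ (t : Set Plane) ∧
    Metric.diam (convexHull ℝ (t : Set Plane)) ≤ σ * (2 * r)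
  quasiUniform : ∀ t ∈ triangles K, meshSize K ≤ σ * Metric.diam (convexHull ℝ (t : Set Plane))

/-- The set `Γ` does not cut through any triangle. -/
def DoesNotCut (Γ : Set Plane) (K : Geometry.SimplicialComplex ℝ Plane) : Prop :=
  ∀ t ∈ triangles K, Disjoint (interior (convexHull ℝ (t : Set Plane))) Γ

/-! ### Finite element spaces

Functions on a subset of the plane are represented by functions on the plane that vanish off that
subset. -/

/-- Restriction to the set `s`. -/
def restrictTo (s : Set Plane) : (Plane → ℝ) →ₗ[ℝ] (Plane → ℝ) where
  toFun v := s.indicator v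
  map_add' u v := Set.indicator_add s u v
  map_smul' c v := Set.indicator_const_smul s c v

/-- The functions vanishing on `s`. -/
def vanishingOn (s : Set Plane) : Submodule ℝ (Plane → ℝ) where
  carrier := {v | ∀ x ∈ s, v x = 0}
  add_mem' := by
    intro u v hu hv x hx
    simp [hu x hx, hv x hx]
  zero_mem' := fun _ _ => rfl
  smul_mem' := by
    intro c v hv x hx
    simp [hv x hx]

/-- The continuous functions on the plane that are affine on each triangle of `K`. -/
def piecewiseAffine (K : Geometry.SimplicialComplex ℝ Plane) : Submodule ℝ (Plane → ℝ) where
  carrier := {v | Continuous v ∧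
    ∀ t ∈ triangles K, ∃ ℓ : Plane →ᵃ[ℝ] ℝ, EqOn v ℓ (convexHull ℝ (t : Set Plane))}
  add_mem' := by
    rintro u v ⟨hu, hu'⟩ ⟨hv, hv'⟩
    refine ⟨hu.add hv, fun t ht => ?_⟩
    obtain ⟨k, hk⟩ := hu' t ht
    obtain ⟨l, hl⟩ := hv' t ht
    exact ⟨k + l, fun x hx => by simp [hk hx, hl hx]⟩
  zero_mem' := ⟨continuous_const, fun _ _ => ⟨0, fun _ _ => rfl⟩⟩
  smul_mem' := by
    rintro c v ⟨hv, hv'⟩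
    refine ⟨hv.const_smul c, fun t ht => ?_⟩
    obtain ⟨l, hl⟩ := hv' t ht
    exact ⟨c • l, fun x hx => by simp [hl hx]⟩

/-- The conforming P1 finite element space `W ⊂ H¹₀(Ω)`. -/
def spaceW (K : Geometry.SimplicialComplex ℝ Plane) (Ω : Set Plane) : Submodule ℝ (Plane → ℝ) :=
  piecewiseAffine K ⊓ vanishingOn Ωᶜ

/-- The space `Wᵢ` of the restrictions of the functions of `W` to the closure of `Ωᵢ`. -/
def subW (K : Geometry.SimplicialComplex ℝ Plane) (Ω Ωi : Set Plane) :
    Submodule ℝ (Plane → ℝ) :=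
  (spaceW K Ω).map (restrictTo (closure Ωi))

/-- The space `Wᵢ⁰` of the functions of `Wᵢ` that vanish on `∂Ωᵢ`. -/
def subW₀ (K : Geometry.SimplicialComplex ℝ Plane) (Ω Ωi : Set Plane) :
    Submodule ℝ (Plane → ℝ) :=
  subW K Ω Ωi ⊓ vanishingOn (frontier Ωi)

/-- The interface space `V_Γ = W|_Γ`. -/
def spaceV (K : Geometry.SimplicialComplex ℝ Plane) (Ω Γ : Set Plane) :
    Submodule ℝ (Plane → ℝ) :=
  (spaceW K Ω).map (restrictTo Γ)

/-! ### Bilinear forms -/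

/-- `aᵢ(u, v) = ∫_{Ωᵢ} νᵢ ∇u · ∇v`. -/
def energy (ν : ℝ) (Ωi : Set Plane) (u v : Plane → ℝ) : ℝ :=
  ∫ x in Ωi, ν * inner ℝ (gradient u x) (gradient v x)

/-- `(f, v)ᵢ = ∫_{Ωᵢ} f v`. -/
def load (f : Plane → ℝ) (Ωi : Set Plane) (v : Plane → ℝ) : ℝ :=
  ∫ x in Ωi, f x * v x

/-- `⟨u, v⟩ = ∫_Γ u v`, with respect to arc length. -/
def pairing (Γ : Set Plane) (u v : Plane → ℝ) : ℝ :=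
  ∫ x in Γ, u x * v x ∂(Measure.hausdorffMeasure 1 : Measure Plane)

/-! ### Discrete harmonic extension and Schur complement operators -/

/-- `w = Hᵢ u` is the discrete harmonic extension of the interface function `u` to `Ωᵢ`. -/
structure IsHarmonicExtension (K : Geometry.SimplicialComplex ℝ Plane) (Ω Ωi Γ : Set Plane) (ν : ℝ)
    (u w : Plane → ℝ) : Prop where
  mem : w ∈ subW K Ω Ωi
  harmonic : ∀ v ∈ subW₀ K Ω Ωi, energy ν Ωi w v = 0
  dirichlet : ∀ x ∈ frontier Ωi \ Γ, w x = 0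
  trace : EqOn w u Γ

/-- `S = Sᵢ : V_Γ → V_Γ`, that is `⟨S u, v⟩ = aᵢ(Hᵢ u, z)` for all `u, v` in `V_Γ` and every
extension `z` in `Wᵢ` of `v`. -/
def IsSchur (K : Geometry.SimplicialComplex ℝ Plane) (Ω Ωi Γ : Set Plane) (ν : ℝ)
    (S : Module.End ℝ (spaceV K Ω Γ)) : Prop :=
  ∀ u : spaceV K Ω Γ, ∃ w : Plane → ℝ, IsHarmonicExtension K Ω Ωi Γ ν u w ∧
    ∀ v : spaceV K Ω Γ, ∀ z ∈ subW K Ω Ωi, EqOn z v Γ →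
      pairing Γ (S u) v = energy ν Ωi w z

/-! ### The Robin–Robin operators -/

/-- `P₄⁻¹ = (γ₁ I - S₂)(γ₂ I + S₂)⁻¹`. -/
def P4inv {V : Type*} [AddCommGroup V] [Module ℝ V] (γ₁ γ₂ : ℝ) (S₂ : Module.End ℝ V) :
    Module.End ℝ V :=
  (γ₁ • 1 - S₂) * Ring.inverse (γ₂ • 1 + S₂)

/-- `G = (γ₂ I + S₂)(γ₁ I - S₂)⁻¹ - (γ₂ I - S₁)(γ₁ I + S₁)⁻¹`. -/
def opG {V : Type*} [AddCommGroup V] [Module ℝ V] (γ₁ γ₂ : ℝ) (S₁ S₂ : Module.End ℝ V) :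
    Module.End ℝ V :=
  (γ₂ • 1 + S₂) * Ring.inverse (γ₁ • 1 - S₂) - (γ₂ • 1 - S₁) * Ring.inverse (γ₁ • 1 + S₁)

/-- `R₄ = I - θ P₄⁻¹ G`. -/
def R4 {V : Type*} [AddCommGroup V] [Module ℝ V] (θ γ₁ γ₂ : ℝ) (S₁ S₂ : Module.End ℝ V) :
    Module.End ℝ V :=
  1 - θ • (P4inv γ₁ γ₂ S₂ * opG γ₁ γ₂ S₁ S₂)

/-! ### The Robin–Robin algorithm -/

/-- `u` in `W` solves the finite element problem `a(u, v) = (f, v)` for all `v` in `W`. -/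
def IsGalerkinSolution (K : Geometry.SimplicialComplex ℝ Plane) (Ω Ω₁ Ω₂ : Set Plane) (ν₁ ν₂ : ℝ)
    (f u : Plane → ℝ) : Prop :=
  u ∈ spaceW K Ω ∧ ∀ v ∈ spaceW K Ω,
    energy ν₁ Ω₁ u v + energy ν₂ Ω₂ u v = load f Ω₁ v + load f Ω₂ v

/-- `u` satisfies the discrete Robin problem in `Ωᵢ` with parameter `γ` and Robin data `g`:
`aᵢ(u, v) + γ ⟨u, v⟩ = (f, v)ᵢ + ⟨g, v⟩` for all `v` in `Wᵢ`. -/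
def SatisfiesRobin (K : Geometry.SimplicialComplex ℝ Plane) (Ω Ωi Γ : Set Plane) (ν γ : ℝ)
    (f g u : Plane → ℝ) : Prop :=
  ∀ v ∈ subW K Ω Ωi, energy ν Ωi u v + γ * pairing Γ u v = load f Ωi v + pairing Γ g v

/-- One sweep of the Robin–Robin algorithm with source `f`, Robin parameters `γ₁, γ₂` and relaxation
parameter `θ` takes the interface datum `g` to `g'`. -/
def IsSweep (K : Geometry.SimplicialComplex ℝ Plane) (Ω Ω₁ Ω₂ : Set Plane)
    (ν₁ ν₂ γ₁ γ₂ θ : ℝ) (f : Plane → ℝ) (g g' : spaceV K Ω (interface Ω₁ Ω₂)) : Prop :=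
  ∃ u₁ ∈ subW K Ω Ω₁, ∃ u₂ ∈ subW K Ω Ω₂, ∃ g₂ gt : spaceV K Ω (interface Ω₁ Ω₂),
    SatisfiesRobin K Ω Ω₁ (interface Ω₁ Ω₂) ν₁ γ₁ f g u₁ ∧
    (∀ x ∈ interface Ω₁ Ω₂, g₂.1 x = (γ₁ + γ₂) * u₁ x - g.1 x) ∧
    SatisfiesRobin K Ω Ω₂ (interface Ω₁ Ω₂) ν₂ γ₂ f g₂ u₂ ∧
    (∀ x ∈ interface Ω₁ Ω₂, gt.1 x = (γ₁ + γ₂) * u₂ x - g₂.1 x) ∧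
    g' = θ • gt + (1 - θ) • g

end RobinRobin

end

namespace RobinRobin

/-! ### Geometry of Lipschitz domains and decompositions -/

/-! Everything is decided on the interface space with its L² product `B`, for which `S₁` and `S₂`
are symmetric. Put X = (γ₂ + S₂)(γ₁ - S₂)⁻¹ and Y = (γ₂ - S₁)(γ₁ + S₁)⁻¹. Then `P4inv` is X⁻¹ and
`opG` is X - Y, so the preconditioned operator is I - X⁻¹Y. It is self-adjoint for the product
B(X·,·), with Rayleigh quotients 1 - B(Yx,x)/B(Xx,x); hence its eigenvalues are real.
`robin_spectrum` locates them from form inequalities: γ₂ ≤ S₁ gives Y ≤ 0 and the lower bound 1; 0 ≤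
S₂ < γ₁ makes X positive definite; the chain -γ₁Y ≤ S₁ ≤ κS₂ ≤ κγ₁X gives the upper bound 1 + κ,
with κ = Cν₁/ν₂. The choice θ = 2/(2 + κ) centres the spectrum of `R4` in [-κ/(2+κ), κ/(2+κ)].

The inequalities are finite element estimates whose constants do not see the mesh. γ₂ ≤ S₁ is the
trace and Poincaré inequality in Ω₁ (`exists_pairing_le`). S₂ < γ₁ is an inverse inequality:
extending interface values by zero at all other vertices costs h⁻¹ times the L² norm
(`exists_inverse_inequality`). S₁ ≤ κS₂ combines the discrete extension theorem (`exists_extension`)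
with the energy minimality of harmonic extensions (`le_energy`).

The Poincaré and trace inequalities are proved for every continuous function that has an upper
gradient and vanishes off Ω: a ball on which the function vanishes is moved by translations through
Ω₁ and up to its boundary. The constant is fixed before the function, hence before the mesh. The
extension theorem reflects the vertices of Ω₁ across its boundary in Lipschitz charts, averages with
a partition of unity and interpolates. This needs a mesh that is fine compared with the charts; on
coarser meshes h is bounded below and the zero extension is good enough.

That `R4` is the error operator is algebra: after subtraction of the Galerkin solution a Robin
problem becomes (γ + S)e = d for the trace e (`robin_trace`), and a sweep becomes the identity
`R4_apply`. -/

theorem inner_basis_add_smul (e : OrthonormalBasis (Fin 2) ℝ Plane) (x : Plane) (t : ℝ) :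
    inner ℝ (e 0) (x + t • e 1) = inner ℝ (e 0) x ∧
      inner ℝ (e 1) (x + t • e 1) = inner ℝ (e 1) x + t := by
  have h := orthonormal_iff_ite.1 e.orthonormal
  have h01 := h 0 1
  have h11 := h 1 1
  simp only [inner_add_right, inner_smul_right, h01, h11]
  simp

/-- On the boundary of an epigraph, the last coordinate is the value of the function. -/
theorem IsPolygonalDomain.frontier_eq_graph {Ω : Set Plane} {x : Plane} {r : ℝ}
    {e : OrthonormalBasis (Fin 2) ℝ Plane} {φ : ℝ → ℝ} (hφ : Continuous φ)
    (h : ∀ y ∈ Metric.ball x r, y ∈ Ω ↔ φ (inner ℝ (e 0) y) < inner ℝ (e 1) y)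
    {y : Plane} (hy : y ∈ Metric.ball x r) :
    y ∈ frontier Ω ↔ inner ℝ (e 1) y = φ (inner ℝ (e 0) y) := by
  have c0 : Continuous fun y : Plane => inner ℝ (e 0) y := by fun_prop
  have c1 : Continuous fun y : Plane => inner ℝ (e 1) y := by fun_prop
  have hφc : Continuous fun y : Plane => φ (inner ℝ (e 0) y) := hφ.comp c0
  have hB : Metric.ball x r ∈ nhds y := Metric.isOpen_ball.mem_nhds hy
  constructor
  · intro hf
    rcases lt_trichotomy (φ (inner ℝ (e 0) y)) (inner ℝ (e 1) y) with hlt | heq | hgt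
    · exfalso
      have : Ω ∈ nhds y := by
        filter_upwards [hB, (isOpen_lt hφc c1).mem_nhds hlt] with z hz hz'
        exact (h z hz).2 hz'
      exact hf.2 (mem_interior_iff_mem_nhds.2 this)
    · exact heq.symm
    · exfalso
      have : Ωᶜ ∈ nhds y := by
        filter_upwards [hB, (isOpen_lt c1 hφc).mem_nhds hgt] with z hz hz'
        exact fun hzΩ => lt_asymm hz' ((h z hz).1 hzΩ)
      have h2 : y ∈ interior Ωᶜ := mem_interior_iff_mem_nhds.2 this
      rw [interior_compl] at h2
      exact h2 hf.1
  · intro heq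
    have hyΩ : y ∉ Ω := fun hyΩ => by have := (h y hy).1 hyΩ; linarith
    refine ⟨?_, fun hi => hyΩ (interior_subset hi)⟩
    have hc : Filter.Tendsto (fun t : ℝ => y + t • e 1) (nhdsWithin 0 (Ioi 0)) (nhds y) := by
      have : Continuous fun t : ℝ => y + t • e 1 := by fun_prop
      have := this.tendsto 0
      simp only [zero_smul, add_zero] at this
      exact this.mono_left nhdsWithin_le_nhds
    refine mem_closure_of_tendsto hc ?_
    filter_upwards [hc hB, self_mem_nhdsWithin] with t ht htp
    refine (h _ ht).2 ?_
    rw [(inner_basis_add_smul e y t).1, (inner_basis_add_smul e y t).2, heq]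
    have : (0 : ℝ) < t := htp
    linarith

/-- Below the boundary, close to it, there are exterior points. -/
theorem IsPolygonalDomain.interior_closure {Ω : Set Plane} (hΩ : IsPolygonalDomain Ω) :
    interior (closure Ω) = Ω := by
  refine Subset.antisymm (fun x hx => ?_) (interior_maximal subset_closure hΩ.isOpen)
  by_contra hxΩ
  have hxf : x ∈ frontier Ω := ⟨interior_subset hx, fun h => hxΩ (interior_subset h)⟩
  obtain ⟨e, r, L, φ, hr, hφ, h⟩ := hΩ.lipschitz x hxf
  have heq := (frontier_eq_graph hφ.continuous h (Metric.mem_ball_self hr)).1 hxf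
  -- Points just below the graph would lie in the closure, hence in Ω or on its frontier; the graph
  -- description excludes both.
  have hc : Filter.Tendsto (fun t : ℝ => x + t • e 1) (nhdsWithin 0 (Iio 0)) (nhds x) := by
    have : Continuous fun t : ℝ => x + t • e 1 := by fun_prop
    have := this.tendsto 0
    simp only [zero_smul, add_zero] at this
    exact this.mono_left nhdsWithin_le_nhds
  have h1 : ∀ᶠ t in nhdsWithin (0 : ℝ) (Iio 0), x + t • e 1 ∈ Metric.ball x r :=
    hc (Metric.isOpen_ball.mem_nhds (Metric.mem_ball_self hr))
  have h2 : ∀ᶠ t in nhdsWithin (0 : ℝ) (Iio 0), x + t • e 1 ∈ interior (closure Ω) :=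
    hc (isOpen_interior.mem_nhds hx)
  obtain ⟨t, ⟨ht1, ht2⟩, ht3⟩ := ((h1.and h2).and self_mem_nhdsWithin).exists
  have ht3 : t < 0 := ht3
  have hlt : inner ℝ (e 1) (x + t • e 1) < φ (inner ℝ (e 0) (x + t • e 1)) := by
    rw [(inner_basis_add_smul e x t).1, (inner_basis_add_smul e x t).2, heq]
    linarith
  have hcl : x + t • e 1 ∈ closure Ω := interior_subset ht2
  by_cases hm : x + t • e 1 ∈ Ω
  · exact lt_asymm hlt ((h _ ht1).1 hm)
  · have := (frontier_eq_graph hφ.continuous h ht1).1 ⟨hcl, fun hh => hm (interior_subset hh)⟩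
    linarith

theorem interface_comm (Ω₁ Ω₂ : Set Plane) : interface Ω₂ Ω₁ = interface Ω₁ Ω₂ :=
  Set.inter_comm _ _

namespace IsDecomposition

variable {Ω Ω₁ Ω₂ : Set Plane} (h : IsDecomposition Ω Ω₁ Ω₂)
include h

theorem symm : IsDecomposition Ω Ω₂ Ω₁ where
  domain := h.domain
  domain₁ := h.domain₂
  domain₂ := h.domain₁
  subset₁ := h.subset₂
  subset₂ := h.subset₁
  disjoint := h.disjoint.symm
  cover := by rw [Set.union_comm]; exact h.cover
  dirichlet₁ := by rw [interface_comm]; exact h.dirichlet₂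
  dirichlet₂ := by rw [interface_comm]; exact h.dirichlet₁

theorem notMem_of_mem_closure {x : Plane} (hx : x ∈ closure Ω₁) : x ∉ Ω₂ := fun hx2 => by
  obtain ⟨y, hy2, hy1⟩ := mem_closure_iff.1 hx Ω₂ h.domain₂.isOpen hx2
  exact h.disjoint.le_bot ⟨hy1, hy2⟩

theorem closure_inter_closure : closure Ω₁ ∩ closure Ω₂ = interface Ω₁ Ω₂ := by
  ext x
  constructor
  · rintro ⟨h1, h2⟩
    refine ⟨⟨h1, fun hi => ?_⟩, ⟨h2, fun hi => ?_⟩⟩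
    · exact h.symm.notMem_of_mem_closure h2 (interior_subset hi)
    · exact h.notMem_of_mem_closure h1 (interior_subset hi)
  · rintro ⟨h1, h2⟩
    exact ⟨h1.1, h2.1⟩

set_option linter.unusedSectionVars false in
theorem interface_subset_closure₁ : interface Ω₁ Ω₂ ⊆ closure Ω₁ :=
  fun _ hx => hx.1.1

set_option linter.unusedSectionVars false in
theorem interface_subset_closure₂ : interface Ω₁ Ω₂ ⊆ closure Ω₂ :=
  fun _ hx => hx.2.1

set_option linter.unusedSectionVars false in
theorem isClosed_interface : IsClosed (interface Ω₁ Ω₂) :=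
  isClosed_frontier.inter isClosed_frontier

/-- Inside `Ω`, the boundary of a subdomain is contained in the interface. -/
theorem frontier_diff_subset : frontier Ω₁ \ interface Ω₁ Ω₂ ⊆ Ωᶜ := by
  rintro x ⟨hx, hxΓ⟩ hxΩ
  have hx2 : x ∉ closure Ω₂ := fun hx2 => hxΓ (h.closure_inter_closure ▸ ⟨hx.1, hx2⟩)
  -- Away from the closure of Ω₂ the covering leaves only the closure of Ω₁, and a Lipschitz domain
  -- is the interior of its closure. So x would be an interior point of Ω₁.
  have : x ∈ interior (closure Ω₁) := by
    refine mem_interior.2 ⟨Ω ∩ (closure Ω₂)ᶜ, ?_,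
      h.domain.isOpen.inter isClosed_closure.isOpen_compl, hxΩ, hx2⟩
    rintro y ⟨hy, hy2⟩
    exact (h.cover hy).resolve_right hy2
  rw [h.domain₁.interior_closure] at this
  exact hx.2 (mem_interior_iff_mem_nhds.2 (h.domain₁.isOpen.mem_nhds this))

theorem mem_closure₂_of_notMem {x : Plane} (hx : x ∈ Ω) (hx1 : x ∉ Ω₁) : x ∈ closure Ω₂ := by
  rcases h.cover hx with h1 | h2
  · have hf : x ∈ frontier Ω₁ := ⟨h1, fun hi => hx1 (interior_subset hi)⟩
    by_contra h2
    exact h.frontier_diff_subset ⟨hf, fun hΓ => h2 (h.interface_subset_closure₂ hΓ)⟩ hx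
  · exact h2

theorem closure₂_subset_compl : closure Ω₂ ⊆ Ω₁ᶜ :=
  fun _ hx hx1 => h.symm.notMem_of_mem_closure hx hx1

/-- A function vanishing off `Ω` vanishes on the boundary of a subdomain as soon as it vanishes on
the interface. -/
theorem mem_of_frontier {x : Plane} (hx : x ∈ frontier Ω₁) (hxΩ : x ∈ Ω) :
    x ∈ interface Ω₁ Ω₂ := by
  by_contra hΓ
  exact h.frontier_diff_subset ⟨hx, hΓ⟩ hxΩ

end IsDecomposition

theorem IsPolygonalDomain.isCompact_closure {Ω : Set Plane} (hΩ : IsPolygonalDomain Ω) :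
    IsCompact (closure Ω) := hΩ.isBounded.isCompact_closure

/-- The boundary of a polygonal domain has finite length. -/
theorem IsPolygonalDomain.hausdorffMeasure_frontier_lt_top {Ω : Set Plane}
    (hΩ : IsPolygonalDomain Ω) : (Measure.hausdorffMeasure 1 : Measure Plane) (frontier Ω) < ∞ := by
  obtain ⟨F, hF⟩ := hΩ.polygonal
  refine (measure_mono hF).trans_lt ?_
  refine (measure_biUnion_lt_top F.finite_toSet fun p _ => ?_)
  rw [hausdorffMeasure_segment]
  exact edist_lt_top _ _

end RobinRobin

namespace RobinRobin

/-! ### Poincaré and trace inequalities for functions with an upper gradient -/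

theorem enorm_sq_le_add (x y : ℝ) : ‖x‖ₑ ^ 2 ≤ 2 * (‖y‖ₑ ^ 2 + ‖y - x‖ₑ ^ 2) := by
  have h := ENNReal.rpow_add_le_mul_rpow_add_rpow ‖y‖ₑ ‖y - x‖ₑ (p := 2) (by norm_num)
  have h2 : (2 : ℝ) - 1 = 1 := by norm_num
  rw [h2, ENNReal.rpow_one] at h
  simp only [ENNReal.rpow_two] at h
  refine le_trans ?_ h
  gcongr
  calc ‖x‖ₑ = ‖y - (y - x)‖ₑ := by simp
    _ ≤ ‖y‖ₑ + ‖y - x‖ₑ := enorm_sub_le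

theorem sq_setLIntegral_le {s : Set ℝ} {g : ℝ → ℝ≥0∞}
    (hg : Measurable g) : (∫⁻ t in s, g t) ^ 2 ≤ volume s * ∫⁻ t in s, g t ^ 2 := by
  have hH : Real.HolderConjugate 2 2 := Real.HolderConjugate.two_two
  have h := ENNReal.lintegral_mul_le_Lp_mul_Lq (volume.restrict s) hH
    (f := fun _ => 1) (g := g) aemeasurable_const hg.aemeasurable
  simp only [Pi.mul_apply, one_mul, ENNReal.rpow_two, one_pow, lintegral_const,
    Measure.restrict_apply_univ] at h
  calc (∫⁻ t in s, g t) ^ 2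
      ≤ ((volume s) ^ (1 / 2 : ℝ) * (∫⁻ t in s, g t ^ 2) ^ (1 / 2 : ℝ)) ^ 2 := by gcongr
    _ = _ := by
      rw [mul_pow, ← ENNReal.rpow_two, ← ENNReal.rpow_two, ← ENNReal.rpow_mul, ← ENNReal.rpow_mul]
      norm_num

/-- `G` is an upper gradient, along line segments avoiding `N`, of the continuous function `w`
vanishing off `Ω`. -/
structure IsUpperGradient (Ω N : Set Plane) (w : Plane → ℝ) (G : Plane → ℝ≥0∞) : Prop where
  continuous : Continuous w
  measurable : Measurable G
  eq_zero : ∀ x ∉ Ω, w x = 0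
  bound : ∀ (a u : Plane) (s : ℝ), 0 ≤ s → (∀ t ∈ Icc 0 s, a + t • u ∉ N) →
    ‖w (a + s • u) - w a‖ₑ ≤ ‖u‖ₑ * ∫⁻ t in Icc 0 s, G (a + t • u)

namespace IsUpperGradient

variable {Ω N : Set Plane} {w : Plane → ℝ} {G : Plane → ℝ≥0∞}

theorem enorm_sq_le (h : IsUpperGradient Ω N w G) (a u : Plane) {s : ℝ} (hs : 0 ≤ s)
    (ha : ∀ t ∈ Icc 0 s, a + t • u ∉ N) :
    ‖w a‖ₑ ^ 2 ≤ 2 * (‖w (a + s • u)‖ₑ ^ 2 +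
      ‖u‖ₑ ^ 2 * (ENNReal.ofReal s * ∫⁻ t in Icc 0 s, G (a + t • u) ^ 2)) := by
  refine (enorm_sq_le_add (w a) (w (a + s • u))).trans ?_
  gcongr
  calc ‖w (a + s • u) - w a‖ₑ ^ 2 ≤ (‖u‖ₑ * ∫⁻ t in Icc 0 s, G (a + t • u)) ^ 2 := by
        gcongr; exact h.bound a u s hs ha
    _ ≤ _ := by
        rw [mul_pow]
        gcongr
        refine (sq_setLIntegral_le ?_).trans_eq ?_
        · exact h.measurable.comp (by fun_prop)
        · rw [Real.volume_Icc, sub_zero]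

end IsUpperGradient

/-- The integral of `w²` over `A` is controlled by the energy. -/
def HasPoincare (Ω N A : Set Plane) : Prop :=
  ∃ C : ℝ≥0, ∀ w G, IsUpperGradient Ω N w G →
    ∫⁻ x in A, ‖w x‖ₑ ^ 2 ≤ C * ∫⁻ x, G x ^ 2

namespace HasPoincare

variable {Ω N A A' : Set Plane}

theorem mono (h : HasPoincare Ω N A) (hA : A' ⊆ A) : HasPoincare Ω N A' := by
  obtain ⟨C, hC⟩ := h
  exact ⟨C, fun w G hw => (lintegral_mono_set hA).trans (hC w G hw)⟩

theorem union (h : HasPoincare Ω N A) (h' : HasPoincare Ω N A') : HasPoincare Ω N (A ∪ A') := by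
  obtain ⟨C, hC⟩ := h
  obtain ⟨C', hC'⟩ := h'
  refine ⟨C + C', fun w G hw => (lintegral_union_le _ _ _).trans ?_⟩
  rw [ENNReal.coe_add, add_mul]
  exact add_le_add (hC w G hw) (hC' w G hw)

theorem empty : HasPoincare Ω N ∅ := ⟨0, fun w G hw => by simp⟩

theorem biUnion {ι : Type*} (s : Finset ι) (A : ι → Set Plane)
    (h : ∀ i ∈ s, HasPoincare Ω N (A i)) : HasPoincare Ω N (⋃ i ∈ s, A i) := by
  classical
  induction s using Finset.induction_on with
  | empty => simpa using empty
  | insert i s hi ih =>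
    rw [Finset.set_biUnion_insert]
    exact (h i (by simp)).union (ih fun j hj => h j (by simp [hj]))

theorem of_disjoint (hA : Disjoint A Ω) (hm : MeasurableSet A) : HasPoincare Ω N A := by
  refine ⟨0, fun w G hw => ?_⟩
  rw [setLIntegral_congr_fun hm (g := fun _ => 0)]
  · simp
  · intro x hx
    simp [hw.eq_zero x (fun hΩ => hA.le_bot ⟨hx, hΩ⟩)]

/-- Poincaré inequalities propagate along translations. -/
theorem translate (h : HasPoincare Ω N A) (u : Plane)
    (hA : ∀ x ∈ A', x + u ∈ A) (hN : ∀ x ∈ A', ∀ t ∈ Icc (0 : ℝ) 1, x + t • u ∉ N)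
    (hm : MeasurableSet A') : HasPoincare Ω N A' := by
  obtain ⟨C, hC⟩ := h
  refine ⟨2 * (C + ‖u‖₊ ^ 2), fun w G hw => ?_⟩
  have hmeas : Measurable fun p : Plane × ℝ => G (p.1 + p.2 • u) ^ 2 :=
    (hw.measurable.comp (by fun_prop)).pow_const 2
  calc ∫⁻ x in A', ‖w x‖ₑ ^ 2
      ≤ ∫⁻ x in A', 2 * (‖w (x + u)‖ₑ ^ 2 +
          ‖u‖ₑ ^ 2 * ∫⁻ t in Icc (0 : ℝ) 1, G (x + t • u) ^ 2) := by
        refine setLIntegral_mono' hm fun x hx => ?_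
        have := hw.enorm_sq_le x u zero_le_one (hN x hx)
        simpa using this
    _ = 2 * ((∫⁻ x in A', ‖w (x + u)‖ₑ ^ 2) +
          ‖u‖ₑ ^ 2 * ∫⁻ x in A', ∫⁻ t in Icc (0 : ℝ) 1, G (x + t • u) ^ 2) := by
        have hm1 : Measurable fun x => ‖w (x + u)‖ₑ ^ 2 :=
          ((hw.continuous.measurable.comp (measurable_add_const u)).enorm).pow_const 2
        have hm2 : Measurable fun x => ∫⁻ t in Icc (0 : ℝ) 1, G (x + t • u) ^ 2 :=
          hmeas.lintegral_prod_right'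
        rw [lintegral_const_mul, lintegral_add_left hm1, lintegral_const_mul _ hm2]
        exact hm1.add (hm2.const_mul _)
    _ ≤ 2 * ((∫⁻ x in A, ‖w x‖ₑ ^ 2) + ‖u‖ₑ ^ 2 * ∫⁻ x, G x ^ 2) := by
        refine mul_le_mul_right (add_le_add ?_ (mul_le_mul_right ?_ _)) _
        · calc ∫⁻ x in A', ‖w (x + u)‖ₑ ^ 2
              ≤ ∫⁻ x in (fun x => x + u) ⁻¹' A, ‖w (x + u)‖ₑ ^ 2 :=
                lintegral_mono_set fun x hx => hA x hx
            _ = _ := (measurePreserving_add_right volume u).setLIntegral_comp_preimage_emb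
                (measurableEmbedding_addRight u) (fun x => ‖w x‖ₑ ^ 2) A
        -- By Tonelli and translation invariance, each fixed t contributes at most the integral of
        -- G² over the plane.
        · calc ∫⁻ x in A', ∫⁻ t in Icc (0 : ℝ) 1, G (x + t • u) ^ 2
              ≤ ∫⁻ x, ∫⁻ t in Icc (0 : ℝ) 1, G (x + t • u) ^ 2 := setLIntegral_le_lintegral _ _
            _ = ∫⁻ t in Icc (0 : ℝ) 1, ∫⁻ x, G (x + t • u) ^ 2 :=
                lintegral_lintegral_swap hmeas.aemeasurable
            _ = ∫⁻ t in Icc (0 : ℝ) 1, ∫⁻ x, G x ^ 2 := by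
                refine lintegral_congr fun t => ?_
                exact lintegral_add_right_eq_self (fun x => G x ^ 2) (t • u)
            _ = ∫⁻ x, G x ^ 2 := by simp
    _ ≤ 2 * ((C * ∫⁻ x, G x ^ 2) + ‖u‖ₑ ^ 2 * ∫⁻ x, G x ^ 2) := by
        gcongr
        exact hC w G hw
    _ = _ := by
        push_cast
        rw [mul_assoc, add_mul, enorm_eq_nnnorm]

end HasPoincare

/-! ### Propagation of the Poincaré inequality through a subdomain. -/

section Poincare

variable {Ω Ω₁ Ω₂ : Set Plane} (h : IsDecomposition Ω Ω₁ Ω₂)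
include h

/-- At a boundary point off the interface, exterior points of Ω₁ lie arbitrarily near, and a small
ball around one of them misses Ω, so w = 0 there. Shifting a ball at the boundary point into it
keeps all segments inside a ball disjoint from the closure of Ω₂. -/
theorem IsDecomposition.exists_boundary_ball :
    ∃ x ∈ frontier Ω₁, ∃ ρ > 0, HasPoincare Ω Ω₂ (Metric.ball x ρ) := by
  obtain ⟨x, hxf, hxΓ⟩ := h.dirichlet₁
  have hx2 : x ∉ closure Ω₂ := fun hx2 => hxΓ (h.closure_inter_closure ▸ ⟨hxf.1, hx2⟩)
  obtain ⟨r₁, hr₁, hball⟩ := Metric.isOpen_iff.1 isClosed_closure.isOpen_compl x hx2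
  have hxi : x ∉ interior (closure Ω₁) := by
    rw [h.domain₁.interior_closure]
    exact fun hx => hxf.2 (mem_interior_iff_mem_nhds.2 (h.domain₁.isOpen.mem_nhds hx))
  have hxc : x ∈ closure (closure Ω₁)ᶜ := by
    rw [closure_compl]; exact hxi
  obtain ⟨z, hz1, hz⟩ := mem_closure_iff.1 hxc _ Metric.isOpen_ball (Metric.mem_ball_self hr₁)
  have hopen : IsOpen (Metric.ball x r₁ ∩ (closure Ω₁)ᶜ) :=
    Metric.isOpen_ball.inter isClosed_closure.isOpen_compl
  obtain ⟨ρ, hρ, hρz⟩ := Metric.isOpen_iff.1 hopen z ⟨hz1, hz⟩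
  have hG : HasPoincare Ω Ω₂ (Metric.ball z ρ) := by
    refine HasPoincare.of_disjoint ?_ Metric.isOpen_ball.measurableSet
    refine Set.disjoint_left.2 fun y hy hyΩ => ?_
    rcases h.cover hyΩ with h1 | h2
    · exact (hρz hy).2 h1
    · exact hball (hρz hy).1 h2
  refine ⟨x, hxf, min ρ r₁, lt_min hρ hr₁, ?_⟩
  refine hG.translate (z - x) (fun y hy => ?_) (fun y hy t ht => ?_)
    Metric.isOpen_ball.measurableSet
  · have : dist y x < ρ := (Metric.mem_ball.1 hy).trans_le (min_le_left _ _)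
    rw [Metric.mem_ball, dist_eq_norm] at *
    rwa [show y + (z - x) - z = y - x by abel]
  · have hy1 : y ∈ Metric.ball x r₁ := Metric.ball_subset_ball (min_le_right _ _) hy
    have hy2 : y + (z - x) ∈ Metric.ball z ρ := by
      have : dist y x < ρ := (Metric.mem_ball.1 hy).trans_le (min_le_left _ _)
      rw [Metric.mem_ball, dist_eq_norm] at *
      rwa [show y + (z - x) - z = y - x by abel]
    have := (convex_ball x r₁).add_smul_mem hy1 (hρz hy2).1 ht
    exact fun h2 => hball this (subset_closure h2)

/-- A connectedness argument. The set of centres of good balls is open, is met by Ω₁ near a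
Dirichlet point, and is relatively closed in Ω₁: inside a ball contained in Ω₁, which is convex, a
small ball at the centre can be translated into a good one. -/
theorem IsDecomposition.hasPoincare_ball {x : Plane} (hx : x ∈ Ω₁) :
    ∃ ρ > 0, HasPoincare Ω Ω₂ (Metric.ball x ρ) := by
  let g : Set Plane := {x | ∃ ρ > 0, HasPoincare Ω Ω₂ (Metric.ball x ρ)}
  have hgo : IsOpen g := by
    rw [Metric.isOpen_iff]
    rintro y ⟨ρ, hρ, hy⟩
    refine ⟨ρ, hρ, fun z hz => ?_⟩
    obtain ⟨ε, hε, hsub⟩ := Metric.isOpen_iff.1 Metric.isOpen_ball z hz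
    exact ⟨ε, hε, hy.mono hsub⟩
  have key : ∀ z ∈ Ω₁, ∀ r > 0, Metric.ball z r ⊆ Ω₁ → ∀ y ∈ Metric.ball z r, y ∈ g → z ∈ g := by
    intro z hz r hr hsub y hyz ⟨ρ, hρ, hy⟩
    have hd : dist y z < r := hyz
    refine ⟨min ρ (r - dist y z), lt_min hρ (by linarith), ?_⟩
    refine hy.translate (y - z) (fun p hp => ?_) (fun p hp t ht => ?_)
      Metric.isOpen_ball.measurableSet
    · have : dist p z < ρ := (Metric.mem_ball.1 hp).trans_le (min_le_left _ _)
      rw [Metric.mem_ball, dist_eq_norm] at *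
      rwa [show p + (y - z) - y = p - z by abel]
    · have h1 : dist p z < r - dist y z := (Metric.mem_ball.1 hp).trans_le (min_le_right _ _)
      have hp1 : p ∈ Metric.ball z r := by
        rw [Metric.mem_ball]; linarith [dist_nonneg (x := y) (y := z)]
      have hp2 : p + (y - z) ∈ Metric.ball z r := by
        rw [Metric.mem_ball]
        calc dist (p + (y - z)) z ≤ dist (p + (y - z)) y + dist y z := dist_triangle _ _ _
          _ = dist p z + dist y z := by
            rw [dist_eq_norm, dist_eq_norm p z, show p + (y - z) - y = p - z by abel]
          _ < r := by linarith
      have := (convex_ball z r).add_smul_mem hp1 hp2 ht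
      exact fun h2 => h.disjoint.le_bot ⟨hsub this, h2⟩
  have hsub : Ω₁ ⊆ g := by
    refine h.domain₁.isConnected.isPreconnected.subset_of_closure_inter_subset hgo ?_ ?_
    · obtain ⟨x, hxf, ρ, hρ, hP⟩ := h.exists_boundary_ball
      obtain ⟨y, hy, hy1⟩ := mem_closure_iff.1 hxf.1 _ Metric.isOpen_ball (Metric.mem_ball_self hρ)
      obtain ⟨ε, hε, hsub⟩ := Metric.isOpen_iff.1 Metric.isOpen_ball y hy
      exact ⟨y, hy1, ε, hε, hP.mono hsub⟩
    · rintro z ⟨hz, hz1⟩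
      obtain ⟨r, hr, hsub⟩ := Metric.isOpen_iff.1 h.domain₁.isOpen z hz1
      obtain ⟨y, hy, hyg⟩ := mem_closure_iff.1 hz _ Metric.isOpen_ball (Metric.mem_ball_self hr)
      exact key z hz1 r hr hsub y hy hyg
  exact hsub hx

omit h in
/-- Above boundary points, vertical segments stay in the closure of the domain. -/
theorem IsPolygonalDomain.add_smul_mem_closure {x : Plane} {r : ℝ}
    {e : OrthonormalBasis (Fin 2) ℝ Plane} {φ : ℝ → ℝ} (hφ : Continuous φ)
    (hg : ∀ y ∈ Metric.ball x r, y ∈ Ω ↔ φ (inner ℝ (e 0) y) < inner ℝ (e 1) y)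
    {y : Plane} {t : ℝ} (ht : 0 ≤ t) (hyt : y + t • e 1 ∈ Metric.ball x r)
    (hy : y ∈ Metric.ball x r) (hyc : y ∈ closure Ω) :
    y + t • e 1 ∈ closure Ω := by
  have hle : φ (inner ℝ (e 0) y) ≤ inner ℝ (e 1) y := by
    by_cases hyΩ : y ∈ Ω
    · exact ((hg y hy).1 hyΩ).le
    · exact ((frontier_eq_graph hφ hg hy).1 ⟨hyc, fun hi => hyΩ (interior_subset hi)⟩).ge
  rcases ht.eq_or_lt with rfl | ht
  · simpa using hyc
  · refine subset_closure ((hg _ hyt).2 ?_)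
    rw [(inner_basis_add_smul e y t).1, (inner_basis_add_smul e y t).2]
    linarith

omit h in
theorem add_smul_mem_ball {x y u : Plane} {ρ δ r t : ℝ} (hu : ‖u‖ = 1) (hr : ρ + δ ≤ r)
    (hy : y ∈ Metric.ball x ρ) (ht : t ∈ Icc 0 δ) : y + t • u ∈ Metric.ball x r := by
  rw [Metric.mem_ball] at *
  calc dist (y + t • u) x ≤ dist (y + t • u) y + dist y x := dist_triangle _ _ _
    _ = t + dist y x := by
      rw [dist_eq_norm, add_sub_cancel_left, norm_smul, hu, mul_one, Real.norm_of_nonneg ht.1]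
    _ < r := by linarith [ht.2]

/-- The Poincaré inequality in a subdomain. -/
theorem IsDecomposition.hasPoincare_closure : HasPoincare Ω Ω₂ (closure Ω₁) := by
  have key : ∀ x ∈ closure Ω₁, ∃ ρ > 0, HasPoincare Ω Ω₂ (Metric.ball x ρ ∩ closure Ω₁) := by
    intro x hx
    by_cases hx1 : x ∈ Ω₁
    · obtain ⟨ρ, hρ, hP⟩ := h.hasPoincare_ball hx1
      exact ⟨ρ, hρ, hP.mono inter_subset_left⟩
    · have hxf : x ∈ frontier Ω₁ := ⟨hx, fun hi => hx1 (interior_subset hi)⟩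
      obtain ⟨e, r, L, φ, hr, hφ, hg⟩ := h.domain₁.lipschitz x hxf
      have heq := (IsPolygonalDomain.frontier_eq_graph hφ.continuous hg
        (Metric.mem_ball_self hr)).1 hxf
      have hn : ‖e 1‖ = 1 := e.orthonormal.1 1
      -- Near the boundary, points are pushed upwards in the chart towards an interior point; the
      -- segments stay in the closure of Ω₁, hence off Ω₂.
      have hz : x + (r / 2) • e 1 ∈ Ω₁ := by
        refine (hg _ (add_smul_mem_ball hn (ρ := r / 2) (δ := r / 2) (by linarith)
          (Metric.mem_ball_self (by linarith)) ⟨by linarith, le_rfl⟩)).2 ?_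
        rw [(inner_basis_add_smul e x _).1, (inner_basis_add_smul e x _).2, heq]
        linarith
      obtain ⟨ρ, hρ, hP⟩ := h.hasPoincare_ball hz
      refine ⟨min ρ (r / 2), lt_min hρ (by linarith), ?_⟩
      refine hP.translate ((r / 2) • e 1) (fun y hy => ?_) (fun y hy t ht => ?_)
        (Metric.isOpen_ball.measurableSet.inter isClosed_closure.measurableSet)
      · have : dist y x < ρ := (Metric.mem_ball.1 hy.1).trans_le (min_le_left _ _)
        rw [Metric.mem_ball, dist_eq_norm] at *
        rwa [add_sub_add_right_eq_sub]
      · have hy1 : y ∈ Metric.ball x (r / 2) := Metric.ball_subset_ball (min_le_right _ _) hy.1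
        rw [smul_smul]
        have hmem : t * (r / 2) ∈ Icc 0 (r / 2) :=
          ⟨mul_nonneg ht.1 (by linarith), by nlinarith [ht.2]⟩
        have := IsPolygonalDomain.add_smul_mem_closure hφ.continuous hg hmem.1
          (add_smul_mem_ball hn (by linarith) hy1 hmem)
          (Metric.ball_subset_ball (by linarith) hy1) hy.2
        exact h.notMem_of_mem_closure this
  choose! ρ hρ hP using key
  obtain ⟨T, hT, hcov⟩ := h.domain₁.isCompact_closure.elim_nhds_subcover
    (fun x => Metric.ball x (ρ x)) (fun x hx => Metric.ball_mem_nhds x (hρ x hx))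
  refine (HasPoincare.biUnion T (fun x => Metric.ball x (ρ x) ∩ closure Ω₁)
    fun x hx => hP x (hT x hx)).mono fun y hy => ?_
  obtain ⟨x, hx, hyx⟩ := mem_iUnion₂.1 (hcov hy)
  exact mem_iUnion₂.2 ⟨x, hx, hyx, hy⟩

end Poincare

/-! ### The trace inequality by integration over vertical segments. -/

section Trace

/-- Integration over a vertical neighbourhood of a Lipschitz graph. -/
theorem lintegral_graph_le (e : OrthonormalBasis (Fin 2) ℝ Plane) {L : ℝ≥0} {φ : ℝ → ℝ}
    (hφ : LipschitzWith L φ) {F : Plane → ℝ≥0∞} (hF : Measurable F) (δ : ℝ) :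
    ∫⁻ y in {y | inner ℝ (e 1) y = φ (inner ℝ (e 0) y)}, ∫⁻ t in Icc 0 δ, F (y + t • e 1)
      ∂(volume) ∂(Measure.hausdorffMeasure 1 : Measure Plane) ≤ (1 + L : ℝ≥0) * ∫⁻ y, F y := by
  set g : ℝ → Plane := fun s => s • e 0 + φ s • e 1 with hgdef
  have hn : ∀ i, ‖e i‖ = 1 := e.orthonormal.1
  have hg : LipschitzWith (1 + L) g := by
    refine LipschitzWith.add (LipschitzWith.of_dist_le_mul fun s t => ?_)
      (LipschitzWith.of_dist_le_mul fun s t => ?_)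
    · rw [dist_eq_norm, ← sub_smul, norm_smul, hn, mul_one, ← dist_eq_norm]; simp
    · rw [dist_eq_norm, ← sub_smul, norm_smul, hn, mul_one, ← dist_eq_norm]
      exact hφ.dist_le_mul s t
  have hgr : {y | inner ℝ (e 1) y = φ (inner ℝ (e 0) y)} = range g := by
    ext y
    constructor
    · intro hy
      refine ⟨inner ℝ (e 0) y, ?_⟩
      have := e.sum_repr' y
      rw [Fin.sum_univ_two] at this
      simp only [hgdef]
      rw [← show inner ℝ (e 1) y = φ (inner ℝ (e 0) y) from hy]
      exact this
    · rintro ⟨s, rfl⟩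
      have h := orthonormal_iff_ite.1 e.orthonormal
      simp [hgdef, inner_add_right, inner_smul_right, h, hn]
  have hgm : Measurable g := hg.continuous.measurable
  -- The parametrization is (1 + L)-Lipschitz, so arc length on the graph is at most 1 + L times the
  -- length of the parameter set. The rest is Fubini in the rotated coordinates.
  have hle : (Measure.hausdorffMeasure 1 : Measure Plane).restrict (range g) ≤
      ((1 + L : ℝ≥0) : ℝ≥0∞) • Measure.map g volume := by
    refine Measure.le_iff.2 fun A hA => ?_
    rw [Measure.restrict_apply hA, Measure.smul_apply, Measure.map_apply hgm hA, smul_eq_mul,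
      ← Set.image_preimage_eq_inter_range]
    have := hg.hausdorffMeasure_image_le (zero_le_one) (g ⁻¹' A)
    simpa [hausdorffMeasure_real] using this
  have hme : Measurable fun p : Plane × ℝ => F (p.1 + p.2 • e 1) := hF.comp (by fun_prop)
  have hmp : MeasurePreserving (fun p : ℝ × ℝ => p.1 • e 0 + p.2 • e 1) := by
    have h1 := (e.measurePreserving_repr_symm).comp
      ((EuclideanSpace.volume_preserving_symm_measurableEquiv_toLp (Fin 2)).symm.comp
      ((volume_preserving_finTwoArrow ℝ).symm))
    have h2 : (fun p : ℝ × ℝ => p.1 • e 0 + p.2 • e 1) = e.repr.symm ∘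
        (MeasurableEquiv.toLp 2 (Fin 2 → ℝ)).symm.symm ∘ MeasurableEquiv.finTwoArrow.symm := by
      ext1 p
      simp only [Function.comp_apply]
      rw [← e.sum_repr_symm, Fin.sum_univ_two]
      rfl
    rw [h2]
    exact h1
  rw [hgr]
  calc _ ≤ ∫⁻ y, ∫⁻ t in Icc 0 δ, F (y + t • e 1) ∂(volume)
          ∂(((1 + L : ℝ≥0) : ℝ≥0∞) • Measure.map g volume) := lintegral_mono' hle le_rfl
    _ = (1 + L : ℝ≥0) * ∫⁻ s, ∫⁻ t in Icc 0 δ, F (g s + t • e 1) := by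
        rw [lintegral_smul_measure, smul_eq_mul, lintegral_map hme.lintegral_prod_right' hgm]
    _ ≤ (1 + L : ℝ≥0) * ∫⁻ s, ∫⁻ t, F (s • e 0 + t • e 1) := by
        refine mul_le_mul_right (lintegral_mono fun s => ?_) _
        refine (setLIntegral_le_lintegral _ _).trans_eq ?_
        rw [← lintegral_add_left_eq_self (fun t => F (s • e 0 + t • e 1)) (φ s)]
        simp only [hgdef, add_smul, add_assoc]
    _ = (1 + L : ℝ≥0) * ∫⁻ y, F y := by
        congr 1
        rw [← hmp.lintegral_comp hF, Measure.volume_eq_prod, lintegral_prod]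
        exact (hF.comp hmp.measurable).aemeasurable

theorem setLIntegral_biUnion_le {α ι : Type*} [MeasurableSpace α] (μ : Measure α) (T : Finset ι)
    (s : ι → Set α) (f : α → ℝ≥0∞) :
    ∫⁻ x in ⋃ i ∈ T, s i, f x ∂μ ≤ ∑ i ∈ T, ∫⁻ x in s i, f x ∂μ := by
  classical
  induction T using Finset.induction_on with
  | empty => simp
  | insert i T hi ih =>
    rw [Finset.set_biUnion_insert, Finset.sum_insert hi]
    exact (lintegral_union_le _ _ _).trans (add_le_add le_rfl ih)

/-- The trace inequality. -/
theorem IsDecomposition.exists_trace {Ω Ω₁ Ω₂ : Set Plane} (h : IsDecomposition Ω Ω₁ Ω₂) :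
    ∃ C : ℝ≥0, ∀ w G, IsUpperGradient Ω Ω₂ w G →
      ∫⁻ x in frontier Ω₁, ‖w x‖ₑ ^ 2 ∂(Measure.hausdorffMeasure 1 : Measure Plane) ≤
        C * ∫⁻ x, G x ^ 2 := by
  obtain ⟨C, hC⟩ := h.hasPoincare_closure
  have key : ∀ x ∈ frontier Ω₁, ∃ U ∈ nhds x, ∃ C : ℝ≥0, ∀ w G, IsUpperGradient Ω Ω₂ w G →
      ∫⁻ x in U ∩ frontier Ω₁, ‖w x‖ₑ ^ 2 ∂(Measure.hausdorffMeasure 1 : Measure Plane) ≤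
        C * ∫⁻ x, G x ^ 2 := by
    intro x hxf
    obtain ⟨e, r, L, φ, hr, hφ, hg⟩ := h.domain₁.lipschitz x hxf
    have hn : ‖e 1‖ = 1 := e.orthonormal.1 1
    obtain ⟨δ, hδ, hδr⟩ : ∃ δ : ℝ≥0, 0 < δ ∧ (δ : ℝ) = r / 2 :=
      ⟨(r / 2).toNNReal, by simpa using hr, Real.coe_toNNReal _ (by linarith)⟩
    refine ⟨Metric.ball x δ, Metric.ball_mem_nhds x hδ,
      δ⁻¹ * (1 + L) * (2 * (C + δ ^ 2)), fun w G hw => ?_⟩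
    -- A boundary value is compared with the values on the segment of length δ above it. Averaging
    -- over that segment turns the squared value, times δ, into an integral of F, and F is
    -- integrable over the plane thanks to the Poincaré inequality.
    set F : Plane → ℝ≥0∞ := fun y => 2 * ((closure Ω₁).indicator (fun y => ‖w y‖ₑ ^ 2) y +
      (δ : ℝ≥0∞) ^ 2 * G y ^ 2) with hFdef
    have hwm : Measurable fun y => ‖w y‖ₑ ^ 2 := hw.continuous.measurable.enorm.pow_const 2
    have hFm : Measurable F :=
      ((hwm.indicator isClosed_closure.measurableSet).add
        ((hw.measurable.pow_const 2).const_mul _)).const_mul _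
    have hpt : ∀ y ∈ Metric.ball x δ ∩ frontier Ω₁,
        δ * ‖w y‖ₑ ^ 2 ≤ ∫⁻ t in Icc 0 (δ : ℝ), F (y + t • e 1) := by
      rintro y ⟨hyb, hyf⟩
      have hyr : y ∈ Metric.ball x r := Metric.ball_subset_ball (by linarith) hyb
      have hcl : ∀ t ∈ Icc 0 (δ : ℝ), y + t • e 1 ∈ closure Ω₁ := fun t ht =>
        IsPolygonalDomain.add_smul_mem_closure hφ.continuous hg ht.1
          (add_smul_mem_ball hn (by linarith) hyb ht) hyr hyf.1
      set J := ∫⁻ τ in Icc 0 (δ : ℝ), G (y + τ • e 1) ^ 2 with hJ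
      have hGm : Measurable fun τ : ℝ => G (y + τ • e 1) ^ 2 :=
        (hw.measurable.comp (by fun_prop)).pow_const 2
      have hGw : Measurable fun τ : ℝ => ‖w (y + τ • e 1)‖ₑ ^ 2 :=
        hwm.comp (by fun_prop)
      have h1 : ∀ t ∈ Icc 0 (δ : ℝ), ‖w y‖ₑ ^ 2 ≤ 2 * (‖w (y + t • e 1)‖ₑ ^ 2 + δ * J) := by
        intro t ht
        refine (hw.enorm_sq_le y (e 1) ht.1 fun τ hτ =>
          h.notMem_of_mem_closure (hcl τ ⟨hτ.1, hτ.2.trans ht.2⟩)).trans ?_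
        have : ‖e 1‖ₑ = 1 := by rw [enorm_eq_nnnorm, ← ENNReal.coe_one, ENNReal.coe_inj]
                                exact NNReal.eq hn
        rw [this, one_pow, one_mul]
        refine mul_le_mul_right (add_le_add le_rfl (mul_le_mul' ?_ ?_)) _
        · rw [← ENNReal.ofReal_coe_nnreal]
          exact ENNReal.ofReal_le_ofReal ht.2
        · exact lintegral_mono_set (Icc_subset_Icc_right ht.2)
      calc (δ : ℝ≥0∞) * ‖w y‖ₑ ^ 2 = ∫⁻ t in Icc 0 (δ : ℝ), ‖w y‖ₑ ^ 2 := by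
            rw [lintegral_const, Measure.restrict_apply_univ, Real.volume_Icc, sub_zero,
              ENNReal.ofReal_coe_nnreal, mul_comm]
        _ ≤ ∫⁻ t in Icc 0 (δ : ℝ), 2 * (‖w (y + t • e 1)‖ₑ ^ 2 + δ * J) :=
            setLIntegral_mono' measurableSet_Icc h1
        _ = 2 * ((∫⁻ t in Icc 0 (δ : ℝ), ‖w (y + t • e 1)‖ₑ ^ 2) + δ * J * δ) := by
            rw [lintegral_const_mul, lintegral_add_left hGw,
              lintegral_const, Measure.restrict_apply_univ, Real.volume_Icc, sub_zero,
              ENNReal.ofReal_coe_nnreal]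
            exact hGw.add measurable_const
        _ = 2 * ((∫⁻ t in Icc 0 (δ : ℝ), ‖w (y + t • e 1)‖ₑ ^ 2) +
              ∫⁻ t in Icc 0 (δ : ℝ), (δ : ℝ≥0∞) ^ 2 * G (y + t • e 1) ^ 2) := by
            rw [lintegral_const_mul _ hGm, ← hJ]
            ring
        _ = ∫⁻ t in Icc 0 (δ : ℝ), 2 * (‖w (y + t • e 1)‖ₑ ^ 2 +
              (δ : ℝ≥0∞) ^ 2 * G (y + t • e 1) ^ 2) := by
            have hm2 : Measurable fun t : ℝ => ‖w (y + t • e 1)‖ₑ ^ 2 +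
                (δ : ℝ≥0∞) ^ 2 * G (y + t • e 1) ^ 2 := hGw.add (hGm.const_mul _)
            rw [lintegral_const_mul _ hm2, lintegral_add_left hGw]
        _ = _ := by
            refine setLIntegral_congr_fun measurableSet_Icc fun t ht => ?_
            simp only [hFdef]
            rw [indicator_of_mem (hcl t ht)]
    have hsub : Metric.ball x δ ∩ frontier Ω₁ ⊆ {y | inner ℝ (e 1) y = φ (inner ℝ (e 0) y)} :=
      fun y hy => (IsPolygonalDomain.frontier_eq_graph hφ.continuous hg
        (Metric.ball_subset_ball (by linarith) hy.1)).1 hy.2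
    have hFint : ∫⁻ y, F y ≤ 2 * (C + δ ^ 2) * ∫⁻ x, G x ^ 2 := by
      have hm2 : Measurable fun y => (closure Ω₁).indicator (fun y => ‖w y‖ₑ ^ 2) y +
          (δ : ℝ≥0∞) ^ 2 * G y ^ 2 :=
        (hwm.indicator (isClosed_closure (s := Ω₁)).measurableSet).add
          ((hw.measurable.pow_const 2).const_mul ((δ : ℝ≥0∞) ^ 2))
      simp only [hFdef]
      rw [lintegral_const_mul _ hm2, lintegral_add_left (hwm.indicator isClosed_closure.measurableSet),
        lintegral_const_mul _ (hw.measurable.pow_const 2),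
        lintegral_indicator isClosed_closure.measurableSet, mul_assoc, add_mul]
      exact mul_le_mul_right (add_le_add (hC w G hw) le_rfl) _
    have hmain := (setLIntegral_mono' (μ := (Measure.hausdorffMeasure 1 : Measure Plane))
      (Metric.isOpen_ball.measurableSet.inter isClosed_frontier.measurableSet) hpt).trans
      ((lintegral_mono_set hsub).trans ((lintegral_graph_le e hφ hFm δ).trans
        (mul_le_mul_right hFint _)))
    rw [lintegral_const_mul _ hwm] at hmain
    have hδ0 : (δ : ℝ≥0∞) ≠ 0 := by simpa using hδ.ne'
    rw [mul_comm, ← ENNReal.le_div_iff_mul_le (Or.inl hδ0) (Or.inl ENNReal.coe_ne_top)] at hmain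
    refine hmain.trans_eq ?_
    rw [ENNReal.coe_mul, ENNReal.coe_mul, ENNReal.coe_inv hδ.ne', ENNReal.div_eq_inv_mul]
    push_cast
    ring
  choose! U hU D hD using key
  obtain ⟨T, hT, hcov⟩ := (h.domain₁.isCompact_closure.of_isClosed_subset isClosed_frontier
    frontier_subset_closure).elim_nhds_subcover U hU
  refine ⟨∑ x ∈ T, D x, fun w G hw => ?_⟩
  have hsub : frontier Ω₁ ⊆ ⋃ x ∈ T, (U x ∩ frontier Ω₁) := fun y hy => by
    obtain ⟨x, hx, hyx⟩ := mem_iUnion₂.1 (hcov hy)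
    exact mem_iUnion₂.2 ⟨x, hx, hyx, hy⟩
  refine (lintegral_mono_set hsub).trans ((setLIntegral_biUnion_le _ _ _ _).trans ?_)
  rw [ENNReal.ofNNReal_finsetSum, Finset.sum_mul]
  exact Finset.sum_le_sum fun x hx => hD x (hT x hx) w G hw

end Trace

end RobinRobin

namespace RobinRobin

/-! ### Triangles and barycentric coordinates -/

/-- The closed triangle with vertex set `t`. -/
abbrev cell (t : Finset Plane) : Set Plane := convexHull ℝ (t : Set Plane)

theorem isCompact_cell (t : Finset Plane) : IsCompact (cell t) :=
  Set.Finite.isCompact_convexHull (𝕜 := ℝ) t.finite_toSet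

theorem isClosed_cell (t : Finset Plane) : IsClosed (cell t) := (isCompact_cell t).isClosed

theorem convex_cell (t : Finset Plane) : Convex ℝ (cell t) := convex_convexHull ℝ _

theorem mem_cell_of_mem {t : Finset Plane} {p : Plane} (hp : p ∈ t) : p ∈ cell t :=
  subset_convexHull ℝ _ (Finset.mem_coe.2 hp)

theorem affineMap_sum_apply {ι : Type*} (s : Finset ι) (f : ι → Plane →ᵃ[ℝ] ℝ) (x : Plane) :
    (∑ i ∈ s, f i) x = ∑ i ∈ s, f i x := by
  classical
  induction s using Finset.induction_on with
  | empty => simp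
  | insert i s hi ih => simp [Finset.sum_insert hi, ih]

/-- Three affinely independent points. -/
structure IsTriangle (t : Finset Plane) : Prop where
  indep : AffineIndependent ℝ ((↑) : t → Plane)
  card : t.card = 3

theorem isTriangle {K : Geometry.SimplicialComplex ℝ Plane} {t : Finset Plane}
    (ht : t ∈ triangles K) : IsTriangle t := ⟨K.indep ht.1, ht.2⟩

namespace IsTriangle

variable {t : Finset Plane} (ht : IsTriangle t)

/-- The affine basis of the vertices. -/
def basis : AffineBasis t ℝ Plane :=
  ⟨(↑), ht.indep, by
    rw [ht.indep.affineSpan_eq_top_iff_card_eq_finrank_add_one]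
    simp [ht.card]⟩

open Classical in
/-- The barycentric coordinate of the vertex `p`. -/
noncomputable def bary (p : Plane) : Plane →ᵃ[ℝ] ℝ := if hp : p ∈ t then ht.basis.coord ⟨p, hp⟩ else 0

theorem bary_self {p : Plane} (hp : p ∈ t) : ht.bary p p = 1 := by
  rw [bary, dif_pos hp]
  exact ht.basis.coord_apply_eq ⟨p, hp⟩

theorem bary_of_ne {p q : Plane} (hq : q ∈ t) (hpq : p ≠ q) : ht.bary p q = 0 := by
  rw [bary]
  split_ifs with hp
  · exact ht.basis.coord_apply_ne (i := ⟨p, hp⟩) (j := ⟨q, hq⟩) fun h => hpq (Subtype.ext_iff.1 h)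
  · rfl

theorem sum_bary (x : Plane) : ∑ p ∈ t, ht.bary p x = 1 := by
  rw [← ht.basis.sum_coord_apply_eq_one x, ← Finset.sum_attach]
  exact Finset.sum_congr rfl fun p _ => by rw [bary, dif_pos p.2]

theorem sum_bary_smul (x : Plane) : ∑ p ∈ t, ht.bary p x • p = x := by
  conv_rhs => rw [← ht.basis.linear_combination_coord_eq_self x]
  rw [← Finset.sum_attach]
  exact Finset.sum_congr rfl fun p _ => by rw [bary, dif_pos p.2]; rfl

theorem range_basis : range ht.basis = (t : Set Plane) := by
  ext x
  constructor
  · rintro ⟨p, rfl⟩; exact p.2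
  · intro hx; exact ⟨⟨x, hx⟩, rfl⟩

theorem mem_cell_iff {x : Plane} : x ∈ cell t ↔ ∀ p ∈ t, 0 ≤ ht.bary p x := by
  rw [cell, ← ht.range_basis, ht.basis.convexHull_eq_nonneg_coord]
  constructor
  · intro h p hp
    rw [bary, dif_pos hp]; exact h _
  · intro h p
    have := h p p.2
    rwa [bary, dif_pos p.2] at this

theorem mem_interior_iff {x : Plane} : x ∈ interior (cell t) ↔ ∀ p ∈ t, 0 < ht.bary p x := by
  rw [cell, ← ht.range_basis, ht.basis.interior_convexHull]
  constructor
  · intro h p hp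
    rw [bary, dif_pos hp]; exact h _
  · intro h p
    have := h p p.2
    rwa [bary, dif_pos p.2] at this

theorem continuous_bary (p : Plane) : Continuous (ht.bary p) :=
  (ht.bary p).continuous_of_finiteDimensional

include ht in
theorem centroid_mem : t.centroid ℝ id ∈ interior (cell t) := by
  have h := ht.basis.centroid_mem_interior_convexHull
  rw [ht.range_basis] at h
  have h2 := Finset.centroid_map ℝ t.attach (Function.Embedding.subtype (· ∈ t)) (id : Plane → Plane)
  rw [Finset.attach_map_val] at h2
  rw [h2]
  exact h

include ht in
theorem closure_interior : closure (interior (cell t)) = cell t := by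
  rw [(convex_cell t).closure_interior_eq_closure_of_nonempty_interior ⟨_, ht.centroid_mem⟩,
    (isClosed_cell t).closure_eq]

theorem bary_eq_zero_of_mem {s : Finset Plane} (hs : s ⊆ t) {p : Plane} (hp : p ∉ s) {x : Plane}
    (hx : x ∈ convexHull ℝ (s : Set Plane)) : ht.bary p x = 0 := by
  have : convexHull ℝ (s : Set Plane) ⊆ {y | ht.bary p y = 0} := by
    refine convexHull_min (fun q hq => ht.bary_of_ne (hs hq) fun h => hp (h ▸ hq)) ?_
    exact (convex_singleton (0 : ℝ)).affine_preimage (ht.bary p)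
  exact this hx

theorem mem_convexHull_of_bary {s : Finset Plane} (hs : s ⊆ t) {x : Plane} (hx : x ∈ cell t)
    (h : ∀ p ∈ t, p ∉ s → ht.bary p x = 0) : x ∈ convexHull ℝ (s : Set Plane) := by
  have h1 : ∑ p ∈ s, ht.bary p x = 1 := by
    rw [← ht.sum_bary x]
    exact Finset.sum_subset hs h
  have h2 : ∑ p ∈ s, ht.bary p x • p = x := by
    conv_rhs => rw [← ht.sum_bary_smul x]
    exact Finset.sum_subset hs fun p hp hps => by rw [h p hp hps, zero_smul]
  rw [← h2]
  exact (convex_convexHull ℝ _).sum_mem (fun p hp => ht.mem_cell_iff.1 hx p (hs hp)) h1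
    fun p hp => subset_convexHull ℝ _ hp

/-- The smallest face containing `x`. -/
noncomputable def carrier (x : Plane) : Finset Plane := t.filter fun p => ht.bary p x ≠ 0

theorem carrier_subset (x : Plane) : ht.carrier x ⊆ t := Finset.filter_subset _ _

theorem mem_convexHull_carrier {x : Plane} (hx : x ∈ cell t) :
    x ∈ convexHull ℝ (ht.carrier x : Set Plane) :=
  ht.mem_convexHull_of_bary (ht.carrier_subset x) hx fun p hp hps => by
    by_contra h
    exact hps (Finset.mem_filter.2 ⟨hp, h⟩)

/-- In a simplicial complex x lies in the hull of the common vertices of both triangles, where the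
coordinate of any vertex not shared vanishes. So the carrier of x is the same face seen from every
triangle through x; gluing of local interpolants rests on this. -/
theorem carrier_subset_of_mem {K : Geometry.SimplicialComplex ℝ Plane} {t' : Finset Plane}
    (htK : t ∈ triangles K) (ht' : t' ∈ triangles K) {x : Plane} (hx : x ∈ cell t)
    (hx' : x ∈ cell t') : ht.carrier x ⊆ t' := by
  have h := K.inter_subset_convexHull htK.1 ht'.1 ⟨hx, hx'⟩
  rw [← Finset.coe_inter] at h
  intro p hp
  by_contra hpt
  exact (Finset.mem_filter.1 hp).2 (ht.bary_eq_zero_of_mem Finset.inter_subset_left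
    (fun hh => hpt (Finset.mem_inter.1 hh).2) h)

/-- Affine maps are given by their vertex values. -/
theorem affine_apply (A : Plane →ᵃ[ℝ] ℝ) (x : Plane) : A x = ∑ p ∈ t, ht.bary p x * A p := by
  have h := ht.sum_bary_smul x
  have h1 := ht.sum_bary x
  have e : ∀ y, A y = A.linear y + A 0 := fun y => by
    rw [AffineMap.decomp' A]; simp
  conv_lhs => rw [e x, ← h, map_sum]
  simp only [map_smul, smul_eq_mul]
  conv_lhs => rw [← one_mul (A 0), ← h1, Finset.sum_mul, ← Finset.sum_add_distrib]
  exact Finset.sum_congr rfl fun p _ => by rw [e p]; ring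

/-- The affine map with given vertex values. -/
noncomputable def interp (val : Plane → ℝ) : Plane →ᵃ[ℝ] ℝ := ∑ p ∈ t, val p • ht.bary p

theorem interp_apply (val : Plane → ℝ) (x : Plane) :
    ht.interp val x = ∑ p ∈ t, val p * ht.bary p x := by
  rw [interp, affineMap_sum_apply]
  rfl

theorem interp_vertex (val : Plane → ℝ) {q : Plane} (hq : q ∈ t) : ht.interp val q = val q := by
  rw [interp_apply, Finset.sum_eq_single q]
  · rw [ht.bary_self hq, mul_one]
  · intro p _ hpq
    rw [ht.bary_of_ne hq hpq, mul_zero]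
  · exact fun h => (h hq).elim

end IsTriangle

end RobinRobin

namespace RobinRobin

/-! ### Fitted meshes -/

/-- A triangulation fitted to a decomposition. -/
structure IsFittedMesh (Ω Ω₁ Ω₂ : Set Plane) (K : Geometry.SimplicialComplex ℝ Plane) : Prop where
  dec : IsDecomposition Ω Ω₁ Ω₂
  tri : IsTriangulation K Ω
  cut : DoesNotCut (interface Ω₁ Ω₂) K

/-- The triangles with interior in `A`. -/
def cellsIn (K : Geometry.SimplicialComplex ℝ Plane) (A : Set Plane) : Set (Finset Plane) :=
  {t ∈ triangles K | interior (cell t) ⊆ A}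

theorem cell_subset_closure {K : Geometry.SimplicialComplex ℝ Plane} {A : Set Plane}
    {t : Finset Plane} (ht : t ∈ cellsIn K A) : cell t ⊆ closure A := by
  rw [← (isTriangle ht.1).closure_interior]
  exact closure_mono ht.2

/-- The carrier of an interior point consists of all three vertices, so two triangles sharing such a
point have the same vertices. -/
theorem disjoint_interior_cell {K : Geometry.SimplicialComplex ℝ Plane} {t t' : Finset Plane}
    (ht : t ∈ triangles K) (ht' : t' ∈ triangles K) (h : t ≠ t') :
    Disjoint (interior (cell t)) (interior (cell t')) := by
  refine Set.disjoint_left.2 fun x hx hx' => h ?_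
  have hT := isTriangle ht
  refine Finset.eq_of_subset_of_card_le ?_ (by rw [ht.2, ht'.2])
  intro p hp
  refine hT.carrier_subset_of_mem ht ht' (interior_subset hx) (interior_subset hx') ?_
  exact Finset.mem_filter.2 ⟨hp, (hT.mem_interior_iff.1 hx p hp).ne'⟩

namespace IsTriangulation

variable {Ω : Set Plane} {K : Geometry.SimplicialComplex ℝ Plane} (h : IsTriangulation K Ω)
include h

theorem finite_triangles : (triangles K).Finite := h.finite.subset fun _ ht => ht.1

theorem finite_cellsIn (A : Set Plane) : (cellsIn K A).Finite :=
  h.finite_triangles.subset fun _ ht => ht.1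

theorem cell_subset {t : Finset Plane} (ht : t ∈ triangles K) : cell t ⊆ closure Ω := by
  rw [← h.space_eq]
  exact K.convexHull_subset_space ht.1

theorem exists_mem_cell {x : Plane} (hx : x ∈ closure Ω) : ∃ t ∈ triangles K, x ∈ cell t := by
  rw [← h.space_eq, Geometry.SimplicialComplex.mem_space_iff] at hx
  obtain ⟨s, hs, hxs⟩ := hx
  obtain ⟨t, ht, hst⟩ := h.pure s hs
  exact ⟨t, ht, convexHull_mono (Finset.coe_subset.2 hst) hxs⟩

theorem interior_cell_subset (hΩ : IsPolygonalDomain Ω) {t : Finset Plane}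
    (ht : t ∈ triangles K) : interior (cell t) ⊆ Ω := by
  rw [← hΩ.interior_closure]
  exact interior_mono (h.cell_subset ht)

/-- Boundary points lie in boundary faces. -/
theorem carrier_notMem (hΩ : IsPolygonalDomain Ω) {t : Finset Plane} (ht : t ∈ triangles K)
    {x : Plane} (hx : x ∈ cell t) (hxΩ : x ∉ Ω) {p : Plane}
    (hp : p ∈ (isTriangle ht).carrier x) : p ∉ Ω := by
  classical
  intro hpΩ
  set hT := isTriangle ht
  set s := hT.carrier x with hs
  have hst : s ⊆ t := hT.carrier_subset x
  have hspos : ∀ i ∈ s, 0 < hT.bary i x := fun i hi =>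
    lt_of_le_of_ne (hT.mem_cell_iff.1 hx i (hst hi)) (Finset.mem_filter.1 hi).2.symm
  have hszero : ∀ i ∈ t, i ∉ s → hT.bary i x = 0 := fun i hi his => by
    by_contra hne
    exact his (Finset.mem_filter.2 ⟨hi, hne⟩)
  -- With one vertex, x would be the vertex p itself; with three, x would be interior to the
  -- triangle. Both put x in Ω, so x lies inside an edge.
  have hcard : s.card = 2 := by
    have h3 : s.card ≤ 3 := (Finset.card_le_card hst).trans_eq ht.2
    have h0 : 0 < s.card := Finset.card_pos.2 ⟨p, hp⟩
    interval_cases hc : s.card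
    · exfalso
      obtain ⟨a, ha⟩ := Finset.card_eq_one.1 hc
      have hxs := hT.mem_convexHull_carrier hx
      rw [← hs, ha] at hxs
      simp only [Finset.coe_singleton, convexHull_singleton, mem_singleton_iff] at hxs
      rw [ha, Finset.mem_singleton] at hp
      rw [hxs, ← hp] at hxΩ
      exact hxΩ hpΩ
    · rfl
    · exfalso
      have : s = t := Finset.eq_of_subset_of_card_le hst (by rw [ht.2, hc])
      exact hxΩ (h.interior_cell_subset hΩ ht
        (hT.mem_interior_iff.2 fun i hi => hspos i (this ▸ hi)))
  -- the remaining vertex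
  obtain ⟨m, hm⟩ : ∃ m, t \ s = {m} := by
    rw [← Finset.card_eq_one, Finset.card_sdiff_of_subset hst, ht.2, hcard]
  have hmt : m ∈ t ∧ m ∉ s := Finset.mem_sdiff.1 (hm ▸ Finset.mem_singleton_self m)
  have htm : ∀ i ∈ t, i ∉ s → i = m := fun i hi his =>
    Finset.mem_singleton.1 (hm ▸ Finset.mem_sdiff.2 ⟨hi, his⟩)
  -- a point of the open edge inside `Ω`
  obtain ⟨y, hyΩ, hypos, hym⟩ : ∃ y ∈ Ω, (∀ i ∈ s, 0 < hT.bary i y) ∧ hT.bary m y = 0 := by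
    have hc : Filter.Tendsto (fun η : ℝ => AffineMap.lineMap p x η) (nhdsWithin 0 (Ioi 0))
        (nhds p) := by
      have : Continuous fun η : ℝ => (AffineMap.lineMap p x : ℝ →ᵃ[ℝ] Plane) η :=
        AffineMap.lineMap_continuous
      have := this.tendsto 0
      rw [AffineMap.lineMap_apply_zero] at this
      exact this.mono_left nhdsWithin_le_nhds
    have h1 : ∀ᶠ η in nhdsWithin (0 : ℝ) (Ioi 0), AffineMap.lineMap p x η ∈ Ω :=
      hc (hΩ.isOpen.mem_nhds hpΩ)
    have h2 : ∀ᶠ η in nhdsWithin (0 : ℝ) (Ioi 0), η ∈ Ioo (0 : ℝ) 1 := Ioo_mem_nhdsGT one_pos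
    obtain ⟨η, hηΩ, hη⟩ := (h1.and h2).exists
    refine ⟨_, hηΩ, fun i hi => ?_, ?_⟩
    · rw [AffineMap.apply_lineMap, AffineMap.lineMap_apply_ring]
      have h2 : 0 ≤ hT.bary i p := hT.mem_cell_iff.1 (mem_cell_of_mem (hst hp)) i (hst hi)
      have h3 := mul_pos hη.1 (hspos i hi)
      have h4 := mul_nonneg (sub_nonneg.2 hη.2.le) h2
      linarith
    · rw [AffineMap.apply_lineMap, AffineMap.lineMap_apply_ring, hszero m hmt.1 hmt.2,
        hT.bary_of_ne (p := m) (hst hp) (fun hmp => hmt.2 (by rwa [hmp]))]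
      ring
  have hycell : y ∈ cell t := hT.mem_cell_iff.2 fun i hi => by
    by_cases his : i ∈ s
    · exact (hypos i his).le
    · rw [htm i hi his, hym]
  have hycar : s ⊆ hT.carrier y := fun i hi => Finset.mem_filter.2 ⟨hst hi, (hypos i hi).ne'⟩
  -- a triangle on the other side
  obtain ⟨t', ht', hyt', z, hzt', hzm⟩ : ∃ t' ∈ triangles K, y ∈ cell t' ∧
      ∃ z ∈ cell t', hT.bary m z < 0 := by
    have hc : Filter.Tendsto (fun η : ℝ => AffineMap.lineMap y m η) (nhdsWithin 0 (Iio 0))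
        (nhds y) := by
      have : Continuous fun η : ℝ => (AffineMap.lineMap y m : ℝ →ᵃ[ℝ] Plane) η :=
        AffineMap.lineMap_continuous
      have := this.tendsto 0
      rw [AffineMap.lineMap_apply_zero] at this
      exact this.mono_left nhdsWithin_le_nhds
    have hclosed : IsClosed (⋃ t' ∈ {t' ∈ triangles K | y ∉ cell t'}, cell t') :=
      (h.finite_triangles.subset fun _ h => h.1).isClosed_biUnion fun t' _ => isClosed_cell t'
    have hy' : y ∉ ⋃ t' ∈ {t' ∈ triangles K | y ∉ cell t'}, cell t' := by
      simp only [mem_iUnion, not_exists]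
      exact fun t' ht' hh => ht'.2 hh
    have h1 : ∀ᶠ η in nhdsWithin (0 : ℝ) (Iio 0), AffineMap.lineMap y m η ∈ Ω :=
      hc (hΩ.isOpen.mem_nhds hyΩ)
    have h2 : ∀ᶠ η in nhdsWithin (0 : ℝ) (Iio 0), AffineMap.lineMap y m η ∉
        ⋃ t' ∈ {t' ∈ triangles K | y ∉ cell t'}, cell t' :=
      hc (hclosed.isOpen_compl.mem_nhds hy')
    obtain ⟨η, ⟨hη1, hη2⟩, hη3⟩ := ((h1.and h2).and self_mem_nhdsWithin).exists
    obtain ⟨t', ht', hzt'⟩ := h.exists_mem_cell (subset_closure hη1)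
    refine ⟨t', ht', ?_, _, hzt', ?_⟩
    · by_contra hyt'
      exact hη2 (mem_iUnion₂.2 ⟨t', ⟨ht', hyt'⟩, hzt'⟩)
    · rw [AffineMap.apply_lineMap, AffineMap.lineMap_apply_ring, hym, hT.bary_self hmt.1]
      have : η < 0 := hη3
      linarith
  have hst' : s ⊆ t' := hycar.trans (hT.carrier_subset_of_mem ht ht' hycell hyt')
  have hT' := isTriangle ht'
  obtain ⟨m', hm'⟩ : ∃ m, t' \ s = {m} := by
    rw [← Finset.card_eq_one, Finset.card_sdiff_of_subset hst', ht'.2, hcard]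
  have hmt' : m' ∈ t' ∧ m' ∉ s := Finset.mem_sdiff.1 (hm' ▸ Finset.mem_singleton_self m')
  have htm' : ∀ i ∈ t', i ∉ s → i = m' := fun i hi his =>
    Finset.mem_singleton.1 (hm' ▸ Finset.mem_sdiff.2 ⟨hi, his⟩)
  -- The coordinate of m vanishes on the common edge, so it is a multiple of the coordinate of m'.
  -- The factor is negative because the second triangle reaches beyond the edge.
  have hprod : ∀ z, hT.bary m z = hT'.bary m' z * hT.bary m m' := fun z => by
    rw [hT'.affine_apply (hT.bary m) z]
    refine Finset.sum_eq_single m' (fun i hi him => ?_) fun hh => (hh hmt'.1).elim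
    have his : i ∈ s := by
      by_contra his
      exact him (htm' i hi his)
    rw [hT.bary_of_ne (p := m) (hst his) (fun hmi => hmt.2 (by rwa [hmi])), mul_zero]
  have hmm' : hT.bary m m' < 0 := by
    have h1 := hprod z
    have h2 := hT'.mem_cell_iff.1 hzt' m' hmt'.1
    by_contra hge
    have := mul_nonneg h2 (not_lt.1 hge)
    linarith
  have hx' : ∀ i ∈ s, 0 < hT'.bary i x := fun i hi => by
    have hxs : x ∈ cell t' := convexHull_mono (Finset.coe_subset.2 hst')
      (hT.mem_convexHull_carrier hx)
    refine lt_of_le_of_ne (hT'.mem_cell_iff.1 hxs i (hst' hi)) fun h0 => ?_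
    have h1 : x ∈ convexHull ℝ ((s.erase i : Finset Plane) : Set Plane) := by
      refine hT'.mem_convexHull_of_bary ((Finset.erase_subset _ _).trans hst') hxs ?_
      intro j hj hjs
      by_cases hji : j = i
      · rw [hji, ← h0]
      · refine hT'.bary_eq_zero_of_mem hst' (fun hjs' => hjs (Finset.mem_erase.2 ⟨hji, hjs'⟩))
          (hT.mem_convexHull_carrier hx)
    have h2 := hT.bary_eq_zero_of_mem ((Finset.erase_subset _ _).trans hst)
      (Finset.notMem_erase i s) h1
    exact (hspos i hi).ne' h2
  -- The two triangles lie on opposite sides of the edge and together fill a neighbourhood of x,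
  -- which makes x a point of the interior of the closure, that is of Ω.
  have hxi : x ∈ interior (closure Ω) := by
    rw [mem_interior_iff_mem_nhds]
    have e1 : ∀ᶠ z in nhds x, ∀ i ∈ s, 0 < hT.bary i z :=
      (Filter.eventually_all_finset s).2 fun i hi =>
        (hT.continuous_bary i).continuousAt.eventually (lt_mem_nhds (hspos i hi))
    have e2 : ∀ᶠ z in nhds x, ∀ i ∈ s, 0 < hT'.bary i z :=
      (Filter.eventually_all_finset s).2 fun i hi =>
        (hT'.continuous_bary i).continuousAt.eventually (lt_mem_nhds (hx' i hi))
    filter_upwards [e1, e2] with z hz1 hz2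
    by_cases hzm : 0 ≤ hT.bary m z
    · refine h.cell_subset ht (hT.mem_cell_iff.2 fun i hi => ?_)
      by_cases his : i ∈ s
      · exact (hz1 i his).le
      · rw [htm i hi his]; exact hzm
    · refine h.cell_subset ht' (hT'.mem_cell_iff.2 fun i hi => ?_)
      by_cases his : i ∈ s
      · exact (hz2 i his).le
      · rw [htm' i hi his]
        have h1 := hprod z
        by_contra hneg
        have := mul_pos_of_neg_of_neg (not_le.1 hneg) hmm'
        linarith
  rw [hΩ.interior_closure] at hxi
  exact hxΩ hxi

/-- Nodal interpolation. -/
theorem exists_interpolant (hΩ : IsPolygonalDomain Ω) (val : Plane → ℝ)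
    (hval : ∀ p ∉ Ω, val p = 0) :
    ∃ w ∈ spaceW K Ω, ∀ t ∈ triangles K, ∀ p ∈ t, w p = val p := by
  classical
  have hex : ∀ x, ∃ v : ℝ, (∀ t (ht : t ∈ triangles K), x ∈ cell t →
      v = (isTriangle ht).interp val x) ∧ (x ∉ Ω → v = 0) := by
    intro x
    by_cases hx : x ∈ closure Ω
    · obtain ⟨t, ht, hxt⟩ := h.exists_mem_cell hx
      refine ⟨(isTriangle ht).interp val x, fun t' ht' hxt' => ?_, fun hxΩ => ?_⟩
      · have hxs := (isTriangle ht).mem_convexHull_carrier hxt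
        have hs1 := (isTriangle ht).carrier_subset x
        have hs2 := (isTriangle ht).carrier_subset_of_mem ht ht' hxt hxt'
        -- Both affine interpolants take the prescribed values at the vertices of the carrier of x,
        -- so they agree on its hull.
        have hsub : convexHull ℝ ((isTriangle ht).carrier x : Set Plane) ⊆
            {y | ((isTriangle ht).interp val - (isTriangle ht').interp val) y = 0} := by
          refine convexHull_min (fun q hq => ?_) ((convex_singleton (0 : ℝ)).affine_preimage _)
          rw [mem_ofPred_eq, AffineMap.coe_sub, Pi.sub_apply, IsTriangle.interp_vertex _ _ (hs1 hq),
            IsTriangle.interp_vertex _ _ (hs2 hq), sub_self]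
        have := hsub hxs
        rw [mem_ofPred_eq, AffineMap.coe_sub, Pi.sub_apply] at this
        linarith
      · rw [IsTriangle.interp_apply]
        refine Finset.sum_eq_zero fun p hp => ?_
        -- Off Ω the carrier has only vertices off Ω, where the prescribed values vanish; the other
        -- vertices have zero weight.
        by_cases hpc : p ∈ (isTriangle ht).carrier x
        · rw [hval p (h.carrier_notMem hΩ ht hxt hxΩ hpc), zero_mul]
        · have : (isTriangle ht).bary p x = 0 := by
            by_contra hne
            exact hpc (Finset.mem_filter.2 ⟨hp, hne⟩)
          rw [this, mul_zero]
    · exact ⟨0, fun t ht hxt => (hx (h.cell_subset ht hxt)).elim, fun _ => rfl⟩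
  choose w hw hw0 using hex
  refine ⟨w, ⟨⟨?_, fun t ht => ⟨(isTriangle ht).interp val, fun x hx => hw x t ht hx⟩⟩,
    fun x hx => hw0 x hx⟩, fun t ht p hp => ?_⟩
  · have hfin := h.finite_triangles
    let f : Option (triangles K) → Set Plane := fun o => o.elim Ωᶜ fun t => cell t
    have : Finite (triangles K) := hfin
    refine LocallyFinite.continuous (f := f) (locallyFinite_of_finite _) ?_ ?_ ?_
    · refine eq_univ_of_forall fun x => ?_
      by_cases hx : x ∈ Ω
      · obtain ⟨t, ht, hxt⟩ := h.exists_mem_cell (subset_closure hx)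
        exact mem_iUnion.2 ⟨some ⟨t, ht⟩, hxt⟩
      · exact mem_iUnion.2 ⟨none, hx⟩
    · rintro (_ | t)
      · exact hΩ.isOpen.isClosed_compl
      · exact isClosed_cell _
    · rintro (_ | t)
      · exact continuousOn_const.congr fun x hx => hw0 x hx
      · exact ((isTriangle t.2).interp val).continuous_of_finiteDimensional.continuousOn.congr
          fun x hx => hw x t t.2 hx
  · rw [hw p t ht (mem_cell_of_mem hp), IsTriangle.interp_vertex _ _ hp]

end IsTriangulation

/-- Polar coordinates: the image of an interval times the unit circle. -/
theorem isPreconnected_punctured_ball (p : Plane) (ε : ℝ) :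
    IsPreconnected (Metric.ball p ε \ {p}) := by
  have hs : IsPreconnected (Metric.sphere (0 : Plane) 1) :=
    isPreconnected_sphere (by rw [← Module.finrank_eq_rank]; simp) 0 1
  have hprod := (isPreconnected_Ioo (a := (0 : ℝ)) (b := ε)).prod hs
  have := hprod.image (fun q : ℝ × Plane => p + q.1 • q.2) (by fun_prop)
  convert this using 1
  ext x
  constructor
  · rintro ⟨hx, hxp⟩
    have hne : x - p ≠ 0 := sub_ne_zero.2 hxp
    have hpos : 0 < ‖x - p‖ := norm_pos_iff.2 hne
    refine ⟨(‖x - p‖, ‖x - p‖⁻¹ • (x - p)), ⟨⟨hpos, ?_⟩, ?_⟩, ?_⟩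
    · rwa [← dist_eq_norm]
    · simp [norm_smul, hpos.ne']
    · simp [smul_smul, hpos.ne']
  · rintro ⟨⟨r, u⟩, ⟨hr, hu⟩, rfl⟩
    have hu' : ‖u‖ = 1 := by simpa using hu
    have hrp : 0 < r := hr.1
    refine ⟨?_, ?_⟩
    · rw [Metric.mem_ball, dist_eq_norm, add_sub_cancel_left, norm_smul, hu', mul_one,
        Real.norm_of_nonneg hrp.le]
      exact hr.2
    · intro hh
      have h0 : r • u = 0 := by simpa using hh
      rcases smul_eq_zero.1 h0 with h1 | h1
      · exact hrp.ne' h1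
      · rw [h1, norm_zero] at hu'
        exact zero_ne_one hu'

namespace IsFittedMesh

variable {Ω Ω₁ Ω₂ : Set Plane} {K : Geometry.SimplicialComplex ℝ Plane}
  (h : IsFittedMesh Ω Ω₁ Ω₂ K)
include h

theorem symm : IsFittedMesh Ω Ω₂ Ω₁ K :=
  ⟨h.dec.symm, h.tri, by rw [interface_comm]; exact h.cut⟩

/-- The interior of the triangle is convex, lies in Ω and misses the interface, so it is a connected
subset of the union of the disjoint open sets Ω₁ and Ω₂. -/
theorem mem_cellsIn_or {t : Finset Plane} (ht : t ∈ triangles K) :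
    t ∈ cellsIn K Ω₁ ∨ t ∈ cellsIn K Ω₂ := by
  have hsub := h.tri.interior_cell_subset h.dec.domain ht
  have hcov : interior (cell t) ⊆ Ω₁ ∪ Ω₂ := fun x hx => by
    by_contra hx12
    rw [mem_union, not_or] at hx12
    have h2 := h.dec.mem_closure₂_of_notMem (hsub hx) hx12.1
    have h1 := h.dec.symm.mem_closure₂_of_notMem (hsub hx) hx12.2
    exact (h.cut t ht).le_bot ⟨hx, h.dec.closure_inter_closure ▸ ⟨h1, h2⟩⟩
  rcases (convex_cell t).interior.isPreconnected.subset_or_subset h.dec.domain₁.isOpen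
    h.dec.domain₂.isOpen h.dec.disjoint hcov with h1 | h2
  · exact Or.inl ⟨ht, h1⟩
  · exact Or.inr ⟨ht, h2⟩

/-- The triangles of Ω₁ are finitely many closed sets covering Ω₁, so their union contains the
closure. -/
theorem exists_mem_cellsIn {x : Plane} (hx : x ∈ closure Ω₁) :
    ∃ t ∈ cellsIn K Ω₁, x ∈ cell t := by
  have hsub : Ω₁ ⊆ ⋃ t ∈ cellsIn K Ω₁, cell t := fun y hy => by
    obtain ⟨t, ht, hyt⟩ := h.tri.exists_mem_cell (subset_closure (h.dec.subset₁ hy))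
    rcases h.mem_cellsIn_or ht with h1 | h2
    · exact mem_iUnion₂.2 ⟨t, h1, hyt⟩
    · exact (h.dec.closure₂_subset_compl (cell_subset_closure h2 hyt) hy).elim
  have := closure_minimal hsub
    ((h.tri.finite_cellsIn Ω₁).isClosed_biUnion fun t _ => isClosed_cell t) hx
  simpa using this

/-- Points of the interface lie in faces with vertices on the interface. -/
theorem carrier_mem_interface {t : Finset Plane} (ht : t ∈ triangles K) {x : Plane}
    (hx : x ∈ cell t) (hxΓ : x ∈ interface Ω₁ Ω₂) {p : Plane}
    (hp : p ∈ (isTriangle ht).carrier x) : p ∈ interface Ω₁ Ω₂ := by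
  obtain ⟨t₁, ht₁, hx₁⟩ := h.exists_mem_cellsIn (h.dec.interface_subset_closure₁ hxΓ)
  obtain ⟨t₂, ht₂, hx₂⟩ := h.symm.exists_mem_cellsIn (h.dec.interface_subset_closure₂ hxΓ)
  rw [← h.dec.closure_inter_closure]
  exact ⟨cell_subset_closure ht₁ (mem_cell_of_mem
      ((isTriangle ht).carrier_subset_of_mem ht ht₁.1 hx hx₁ hp)),
    cell_subset_closure ht₂ (mem_cell_of_mem
      ((isTriangle ht).carrier_subset_of_mem ht ht₂.1 hx hx₂ hp))⟩

/-- A vertex of the interface inside `Ω` belongs to an edge of the interface. -/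
theorem exists_edge {t : Finset Plane} (ht : t ∈ triangles K) {p : Plane} (hpt : p ∈ t)
    (hpΓ : p ∈ interface Ω₁ Ω₂) (hpΩ : p ∈ Ω) :
    ∃ t₁ ∈ cellsIn K Ω₁, ∃ t₂ ∈ cellsIn K Ω₂, ∃ q, q ≠ p ∧ p ∈ t₁ ∧ q ∈ t₁ ∧ p ∈ t₂ ∧ q ∈ t₂ ∧
      segment ℝ p q ⊆ interface Ω₁ Ω₂ := by
  have hclosed : IsClosed (⋃ t' ∈ {t' ∈ triangles K | p ∉ cell t'}, cell t') :=
    (h.tri.finite_triangles.subset fun _ h => h.1).isClosed_biUnion fun t' _ => isClosed_cell t'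
  have hp' : p ∉ ⋃ t' ∈ {t' ∈ triangles K | p ∉ cell t'}, cell t' := by
    simp only [mem_iUnion, not_exists]
    exact fun t' ht' hh => ht'.2 hh
  -- The ball is small enough to lie in Ω and to meet only triangles that contain p.
  obtain ⟨ε, hε, hball⟩ := Metric.isOpen_iff.1 (h.dec.domain.isOpen.inter hclosed.isOpen_compl) p
    ⟨hpΩ, hp'⟩
  have hne : ∀ {A : Set Plane}, p ∈ closure A → p ∉ A →
      ((Metric.ball p ε \ {p}) ∩ closure A).Nonempty := by
    intro A hcl hA
    obtain ⟨y, hy, hyA⟩ := mem_closure_iff.1 hcl _ Metric.isOpen_ball (Metric.mem_ball_self hε)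
    exact ⟨y, ⟨hy, fun hyp => hA (hyp ▸ hyA)⟩, subset_closure hyA⟩
  have hp1 := h.dec.interface_subset_closure₁ hpΓ
  have hp2 := h.dec.interface_subset_closure₂ hpΓ
  -- The punctured ball is connected and covered by the two closures, each of which meets it. Hence
  -- they meet at a point other than p, so p is not isolated in the interface; a further vertex of
  -- the carrier of that point gives the edge.
  obtain ⟨x, ⟨hxb, hxp⟩, hx1, hx2⟩ := isPreconnected_closed_iff.1
    (isPreconnected_punctured_ball p ε) (closure Ω₁) (closure Ω₂) isClosed_closure isClosed_closure
    (fun y hy => h.dec.cover (hball hy.1).1)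
    (hne hp1 (h.dec.closure₂_subset_compl hp2))
    (hne hp2 (h.dec.symm.closure₂_subset_compl hp1))
  obtain ⟨t₁, ht₁, hxt₁⟩ := h.exists_mem_cellsIn hx1
  obtain ⟨t₂, ht₂, hxt₂⟩ := h.symm.exists_mem_cellsIn hx2
  have hvert : ∀ t' ∈ triangles K, x ∈ cell t' → p ∈ t' := by
    intro t' ht' hxt'
    have hpt' : p ∈ cell t' := by
      by_contra hpt'
      exact (hball hxb).2 (mem_iUnion₂.2 ⟨t', ⟨ht', hpt'⟩, hxt'⟩)
    refine (isTriangle ht).carrier_subset_of_mem ht ht' (mem_cell_of_mem hpt) hpt' ?_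
    refine Finset.mem_filter.2 ⟨hpt, ?_⟩
    rw [(isTriangle ht).bary_self hpt]
    exact one_ne_zero
  have hxs := (isTriangle ht₁.1).mem_convexHull_carrier hxt₁
  obtain ⟨q, hq, hqp⟩ : ∃ q ∈ (isTriangle ht₁.1).carrier x, q ≠ p := by
    by_contra! hall
    have hsub : ((isTriangle ht₁.1).carrier x : Set Plane) ⊆ {p} := fun q hq => hall q hq
    have := convexHull_mono (𝕜 := ℝ) hsub hxs
    rw [convexHull_singleton] at this
    exact hxp this
  have hq1 := (isTriangle ht₁.1).carrier_subset x hq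
  have hq2 := (isTriangle ht₁.1).carrier_subset_of_mem ht₁.1 ht₂.1 hxt₁ hxt₂ hq
  have hpt₁ := hvert t₁ ht₁.1 hxt₁
  have hpt₂ := hvert t₂ ht₂.1 hxt₂
  refine ⟨t₁, ht₁, t₂, ht₂, q, hqp, hpt₁, hq1, hpt₂, hq2, ?_⟩
  rw [← h.dec.closure_inter_closure]
  exact subset_inter
    (((convex_cell t₁).segment_subset (mem_cell_of_mem hpt₁) (mem_cell_of_mem hq1)).trans
      (cell_subset_closure ht₁))
    (((convex_cell t₂).segment_subset (mem_cell_of_mem hpt₂) (mem_cell_of_mem hq2)).trans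
      (cell_subset_closure ht₂))

/-- Functions of `W` agreeing at the vertices of the interface agree on the interface. -/
theorem eqOn_interface {w z : Plane → ℝ} (hw : w ∈ spaceW K Ω) (hz : z ∈ spaceW K Ω)
    (hwz : ∀ t ∈ triangles K, ∀ p ∈ t, p ∈ interface Ω₁ Ω₂ → w p = z p) :
    EqOn w z (interface Ω₁ Ω₂) := by
  intro x hx
  obtain ⟨t, ht, hxt⟩ := h.exists_mem_cellsIn (h.dec.interface_subset_closure₁ hx)
  obtain ⟨A, hA⟩ := hw.1.2 t ht.1
  obtain ⟨B, hB⟩ := hz.1.2 t ht.1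
  have hT := isTriangle ht.1
  rw [hA hxt, hB hxt, hT.affine_apply A, hT.affine_apply B]
  refine Finset.sum_congr rfl fun p hp => ?_
  by_cases hpc : p ∈ hT.carrier x
  · rw [← hA (mem_cell_of_mem hp), ← hB (mem_cell_of_mem hp),
      hwz t ht.1 p hp (h.carrier_mem_interface ht.1 hxt hx hpc)]
  · have : hT.bary p x = 0 := by
      by_contra hne
      exact hpc (Finset.mem_filter.2 ⟨hp, hne⟩)
    rw [this, zero_mul, zero_mul]

end IsFittedMesh

end RobinRobin

namespace RobinRobin

/-! ### Slopes and the energy of piecewise affine functions -/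

/-- The gradient on the triangle `t`. -/
noncomputable def slope (w : Plane → ℝ) (t : Finset Plane) : Plane :=
  gradient w (t.centroid ℝ id)

section Slope

variable {K : Geometry.SimplicialComplex ℝ Plane} {t : Finset Plane}

theorem gradient_eq_of_affine {w : Plane → ℝ} {g : Plane}
    (hg : ∀ x ∈ cell t, ∀ y ∈ cell t, w x - w y = inner ℝ g (x - y)) {x : Plane}
    (hx : x ∈ interior (cell t)) : gradient w x = g := by
  have h1 : HasGradientAt (fun y => inner ℝ g y + (w x - inner ℝ g x)) g x := by
    rw [hasGradientAt_iff_hasFDerivAt]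
    exact ((InnerProductSpace.toDual ℝ Plane g).hasFDerivAt).add_const _
  refine (h1.congr_of_eventuallyEq ?_).gradient
  filter_upwards [mem_interior_iff_mem_nhds.1 hx] with y hy
  have := hg y hy x (interior_subset hx)
  rw [inner_sub_right] at this
  linarith

theorem slope_eq_of_affine (ht : IsTriangle t) {w : Plane → ℝ} {g : Plane}
    (hg : ∀ x ∈ cell t, ∀ y ∈ cell t, w x - w y = inner ℝ g (x - y)) : slope w t = g :=
  gradient_eq_of_affine hg ht.centroid_mem

theorem exists_inner_of_affine (A : Plane →ᵃ[ℝ] ℝ) :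
    ∃ g : Plane, ∀ x y, A x - A y = inner ℝ g (x - y) := by
  refine ⟨(InnerProductSpace.toDual ℝ Plane).symm (LinearMap.toContinuousLinearMap A.linear),
    fun x y => ?_⟩
  rw [InnerProductSpace.toDual_symm_apply]
  have := A.linearMap_vsub x y
  simpa using this.symm

theorem sub_eq_inner_slope {w : Plane → ℝ} (hw : w ∈ piecewiseAffine K) (ht : t ∈ triangles K)
    {x y : Plane} (hx : x ∈ cell t) (hy : y ∈ cell t) :
    w x - w y = inner ℝ (slope w t) (x - y) := by
  obtain ⟨A, hA⟩ := hw.2 t ht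
  obtain ⟨g, hg⟩ := exists_inner_of_affine A
  have h1 : ∀ x ∈ cell t, ∀ y ∈ cell t, w x - w y = inner ℝ g (x - y) := fun x hx y hy => by
    rw [hA hx, hA hy, hg]
  rw [slope_eq_of_affine (isTriangle ht) h1]
  exact h1 x hx y hy

theorem gradient_eq_slope {w : Plane → ℝ} (hw : w ∈ piecewiseAffine K) (ht : t ∈ triangles K)
    {x : Plane} (hx : x ∈ interior (cell t)) : gradient w x = slope w t :=
  gradient_eq_of_affine (fun _ hx _ hy => sub_eq_inner_slope hw ht hx hy) hx

theorem slope_add {u v : Plane → ℝ} (hu : u ∈ piecewiseAffine K) (hv : v ∈ piecewiseAffine K)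
    (ht : t ∈ triangles K) : slope (u + v) t = slope u t + slope v t :=
  slope_eq_of_affine (isTriangle ht) fun x hx y hy => by
    rw [inner_add_left, ← sub_eq_inner_slope hu ht hx hy, ← sub_eq_inner_slope hv ht hx hy]
    simp only [Pi.add_apply]
    ring

theorem slope_smul (c : ℝ) {u : Plane → ℝ} (hu : u ∈ piecewiseAffine K)
    (ht : t ∈ triangles K) : slope (c • u) t = c • slope u t :=
  slope_eq_of_affine (isTriangle ht) fun x hx y hy => by
    rw [inner_smul_left, ← sub_eq_inner_slope hu ht hx hy]
    simp only [Pi.smul_apply, smul_eq_mul, conj_trivial]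
    ring

end Slope

/-- The finite set of triangles with interior in `A`. -/
noncomputable def IsTriangulation.cells {Ω : Set Plane} {K : Geometry.SimplicialComplex ℝ Plane}
    (h : IsTriangulation K Ω) (A : Set Plane) : Finset (Finset Plane) :=
  (h.finite_cellsIn A).toFinset

theorem IsTriangulation.mem_cells {Ω : Set Plane} {K : Geometry.SimplicialComplex ℝ Plane}
    (h : IsTriangulation K Ω) {A : Set Plane} {t : Finset Plane} :
    t ∈ h.cells A ↔ t ∈ cellsIn K A := (h.finite_cellsIn A).mem_toFinset

theorem energy_congr {Ω₁ : Set Plane} (hΩ : IsOpen Ω₁) (ν : ℝ) {u u' v v' : Plane → ℝ}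
    (hu : EqOn u u' Ω₁) (hv : EqOn v v' Ω₁) : energy ν Ω₁ u v = energy ν Ω₁ u' v' := by
  refine setIntegral_congr_fun hΩ.measurableSet fun x hx => ?_
  have hn := hΩ.mem_nhds hx
  have h1 : u =ᶠ[nhds x] u' := Filter.eventually_of_mem hn hu
  have h2 : v =ᶠ[nhds x] v' := Filter.eventually_of_mem hn hv
  simp only [h1.gradient_eq, h2.gradient_eq]

theorem interior_cell_ae_eq (t : Finset Plane) :
    interior (cell t) =ᵐ[volume] cell t :=
  interior_ae_eq_of_null_frontier ((convex_cell t).addHaar_frontier volume)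

theorem volume_cell_lt_top (t : Finset Plane) : volume (cell t) < ∞ :=
  (isCompact_cell t).measure_lt_top

namespace IsFittedMesh

variable {Ω Ω₁ Ω₂ : Set Plane} {K : Geometry.SimplicialComplex ℝ Plane}
  (h : IsFittedMesh Ω Ω₁ Ω₂ K)
include h

theorem ae_notMem_frontier : ∀ᵐ x : Plane, ∀ t ∈ h.tri.cells Ω₁, x ∉ frontier (cell t) := by
  rw [Finset.eventually_all]
  intro t _
  exact measure_eq_zero_iff_ae_notMem.1 ((convex_cell t).addHaar_frontier volume)

theorem ae_eq_biUnion : Ω₁ =ᵐ[volume] ⋃ t ∈ h.tri.cells Ω₁, interior (cell t) := by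
  filter_upwards [h.ae_notMem_frontier] with x hx
  refine propext ⟨fun hx1 => ?_, fun hx1 => ?_⟩
  · obtain ⟨t, ht, hxt⟩ := h.exists_mem_cellsIn (subset_closure hx1)
    have ht' := h.tri.mem_cells.2 ht
    refine mem_iUnion₂.2 ⟨t, ht', ?_⟩
    by_contra hxi
    exact hx t ht' ⟨subset_closure hxt, hxi⟩
  · obtain ⟨t, ht, hxt⟩ := mem_iUnion₂.1 hx1
    exact (h.tri.mem_cells.1 ht).2 hxt

theorem energy_eq_sum (ν : ℝ) {u v : Plane → ℝ} (hu : u ∈ piecewiseAffine K)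
    (hv : v ∈ piecewiseAffine K) :
    energy ν Ω₁ u v =
      ν * ∑ t ∈ h.tri.cells Ω₁, volume.real (cell t) * inner ℝ (slope u t) (slope v t) := by
  have hcongr : ∀ t ∈ h.tri.cells Ω₁, EqOn (fun x => ν * inner ℝ (gradient u x) (gradient v x))
      (fun _ => ν * inner ℝ (slope u t) (slope v t)) (interior (cell t)) := fun t ht x hx => by
    simp only [gradient_eq_slope hu (h.tri.mem_cells.1 ht).1 hx,
      gradient_eq_slope hv (h.tri.mem_cells.1 ht).1 hx]
  have hfin : ∀ t : Finset Plane, volume (interior (cell t)) < ∞ := fun t =>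
    (measure_mono interior_subset).trans_lt (volume_cell_lt_top t)
  rw [energy, setIntegral_congr_set h.ae_eq_biUnion, integral_biUnion_finset]
  · rw [Finset.mul_sum]
    refine Finset.sum_congr rfl fun t ht => ?_
    rw [setIntegral_congr_fun isOpen_interior.measurableSet (hcongr t ht), setIntegral_const,
      measureReal_congr (interior_cell_ae_eq t), smul_eq_mul]
    ring
  · exact fun t _ => isOpen_interior.measurableSet
  · intro t ht t' ht' hne
    exact disjoint_interior_cell (h.tri.mem_cells.1 ht).1 (h.tri.mem_cells.1 ht').1 hne
  · intro t ht
    exact (integrableOn_const (hfin t).ne).congr_fun (fun x hx => (hcongr t ht hx).symm)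
      isOpen_interior.measurableSet

/-- The piecewise constant norm of the gradient on the triangles of a subdomain. -/
noncomputable def upperGrad (w : Plane → ℝ) (x : Plane) : ℝ≥0∞ :=
  ∑ t ∈ h.tri.cells Ω₁, (cell t).indicator (fun _ => ‖slope w t‖ₑ) x

theorem measurable_upperGrad (w : Plane → ℝ) : Measurable (h.upperGrad w) :=
  Finset.measurable_sum _ fun t _ => measurable_const.indicator (isClosed_cell t).measurableSet

/-- No differentiation is needed. By the intermediate value theorem the interval between the end
values is covered by the images of the pieces of the segment in the triangles of Ω₁, together with
the value 0 taken off Ω. Its length is at most the sum of the lengths of these images, each bounded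
by a Lipschitz constant times the time spent in the triangle. -/
theorem isUpperGradient {w : Plane → ℝ} (hw : w ∈ spaceW K Ω) :
    IsUpperGradient Ω Ω₂ w (h.upperGrad w) where
  continuous := hw.1.1
  measurable := h.measurable_upperGrad w
  eq_zero := fun x hx => hw.2 x hx
  bound := by
    intro a u s hs hN
    set f : ℝ → ℝ := fun τ => w (a + τ • u) with hf
    have hfc : Continuous f := hw.1.1.comp (by fun_prop)
    set I : Finset Plane → Set ℝ := fun t => {τ | τ ∈ Icc 0 s ∧ a + τ • u ∈ cell t} with hI
    have hcov : uIcc (f 0) (f s) ⊆ {0} ∪ ⋃ t ∈ h.tri.cells Ω₁, f '' I t := by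
      have h1 : uIcc (f 0) (f s) ⊆ f '' Icc 0 s := by
        have := intermediate_value_uIcc (a := 0) (b := s) hfc.continuousOn
        rwa [uIcc_of_le hs] at this
      refine h1.trans ?_
      rintro _ ⟨τ, hτ, rfl⟩
      by_cases hΩ : a + τ • u ∈ Ω
      · obtain ⟨t, ht, hxt⟩ := h.exists_mem_cellsIn
          (h.dec.symm.mem_closure₂_of_notMem hΩ (hN τ hτ))
        exact Or.inr (mem_iUnion₂.2 ⟨t, h.tri.mem_cells.2 ht, τ, ⟨hτ, hxt⟩, rfl⟩)
      · exact Or.inl (hw.2 _ hΩ)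
    have hLip : ∀ t ∈ h.tri.cells Ω₁,
        volume (f '' I t) ≤ ‖slope w t‖ₑ * ‖u‖ₑ * volume (I t) := by
      intro t ht
      have hL : LipschitzOnWith (‖slope w t‖₊ * ‖u‖₊) f (I t) := by
        refine LipschitzOnWith.of_dist_le_mul fun τ hτ τ' hτ' => ?_
        rw [Real.dist_eq, hf]
        simp only
        rw [sub_eq_inner_slope hw.1 (h.tri.mem_cells.1 ht).1 hτ.2 hτ'.2]
        refine (abs_real_inner_le_norm _ _).trans ?_
        rw [add_sub_add_left_eq_sub, ← sub_smul, norm_smul, NNReal.coe_mul, coe_nnnorm, coe_nnnorm,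
          Real.dist_eq, Real.norm_eq_abs]
        exact le_of_eq (by ring)
      have := hL.hausdorffMeasure_image_le zero_le_one
      rw [hausdorffMeasure_real, ENNReal.rpow_one] at this
      simpa [enorm_eq_nnnorm] using this
    calc ‖w (a + s • u) - w a‖ₑ = volume (uIcc (f 0) (f s)) := by
          rw [Real.volume_interval, hf]
          simp [Real.enorm_eq_ofReal_abs]
      _ ≤ volume ({0} ∪ ⋃ t ∈ h.tri.cells Ω₁, f '' I t) := measure_mono hcov
      _ ≤ volume {0} + volume (⋃ t ∈ h.tri.cells Ω₁, f '' I t) := measure_union_le _ _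
      _ = volume (⋃ t ∈ h.tri.cells Ω₁, f '' I t) := by rw [Real.volume_singleton, zero_add]
      _ ≤ ∑ t ∈ h.tri.cells Ω₁, volume (f '' I t) := measure_biUnion_finset_le _ _
      _ ≤ ∑ t ∈ h.tri.cells Ω₁, ‖slope w t‖ₑ * ‖u‖ₑ * volume (I t) := Finset.sum_le_sum hLip
      _ = ‖u‖ₑ * ∑ t ∈ h.tri.cells Ω₁, ‖slope w t‖ₑ * volume (I t) := by
          rw [Finset.mul_sum]
          exact Finset.sum_congr rfl fun t _ => by ring
      _ = ‖u‖ₑ * ∫⁻ τ in Icc 0 s, h.upperGrad w (a + τ • u) := by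
          congr 1
          simp only [upperGrad]
          have hcl : ∀ t : Finset Plane, MeasurableSet {τ : ℝ | a + τ • u ∈ cell t} := fun t =>
            ((isClosed_cell t).preimage (by fun_prop :
              Continuous fun τ : ℝ => a + τ • u)).measurableSet
          rw [lintegral_finsetSum]
          · refine Finset.sum_congr rfl fun t _ => ?_
            have : (fun τ : ℝ => (cell t).indicator (fun _ => ‖slope w t‖ₑ) (a + τ • u)) =
                {τ : ℝ | a + τ • u ∈ cell t}.indicator fun _ => ‖slope w t‖ₑ := rfl
            rw [this, lintegral_indicator (hcl t), lintegral_const, Measure.restrict_apply_univ,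
              Measure.restrict_apply (hcl t), Set.inter_comm]
            rfl
          · intro t _
            exact measurable_const.indicator (hcl t)

/-- `upperGrad` adds up several slopes only on triangle boundaries, a null set; elsewhere at most
one term survives, and the square of the sum is the sum of the squares. -/
theorem lintegral_upperGrad_sq {w : Plane → ℝ} (hw : w ∈ piecewiseAffine K) :
    ∫⁻ x, h.upperGrad w x ^ 2 = ENNReal.ofReal (energy 1 Ω₁ w w) := by
  have hae : ∀ᵐ x : Plane, h.upperGrad w x ^ 2 =
      ∑ t ∈ h.tri.cells Ω₁, (cell t).indicator (fun _ => ‖slope w t‖ₑ ^ 2) x := by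
    filter_upwards [h.ae_notMem_frontier] with x hx
    by_cases hex : ∃ t ∈ h.tri.cells Ω₁, x ∈ cell t
    · obtain ⟨t, ht, hxt⟩ := hex
      have huniq : ∀ t' ∈ h.tri.cells Ω₁, t' ≠ t → x ∉ cell t' := fun t' ht' hne hxt' => by
        have hi : ∀ s ∈ h.tri.cells Ω₁, x ∈ cell s → x ∈ interior (cell s) := fun s hs hxs => by
          by_contra hxi
          exact hx s hs ⟨subset_closure hxs, hxi⟩
        exact (disjoint_interior_cell (h.tri.mem_cells.1 ht').1 (h.tri.mem_cells.1 ht).1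
          hne).le_bot ⟨hi t' ht' hxt', hi t ht hxt⟩
      rw [upperGrad, Finset.sum_eq_single_of_mem t ht
        (fun t' ht' hne => indicator_of_notMem (huniq t' ht' hne) _),
        Finset.sum_eq_single_of_mem t ht
        (fun t' ht' hne => indicator_of_notMem (huniq t' ht' hne) _),
        indicator_of_mem hxt, indicator_of_mem hxt]
    · push Not at hex
      rw [upperGrad, Finset.sum_eq_zero fun t ht => indicator_of_notMem (hex t ht) _,
        Finset.sum_eq_zero fun t ht => indicator_of_notMem (hex t ht) _]
      simp
  rw [lintegral_congr_ae hae, lintegral_finsetSum _ fun t _ =>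
    measurable_const.indicator (isClosed_cell t).measurableSet, h.energy_eq_sum 1 hw hw, one_mul,
    ENNReal.ofReal_sum_of_nonneg fun t _ =>
      mul_nonneg measureReal_nonneg real_inner_self_nonneg]
  refine Finset.sum_congr rfl fun t _ => ?_
  rw [lintegral_indicator (isClosed_cell t).measurableSet, lintegral_const,
    Measure.restrict_apply_univ, real_inner_self_eq_norm_sq,
    ENNReal.ofReal_mul measureReal_nonneg, ofReal_measureReal (volume_cell_lt_top t).ne,
    ENNReal.ofReal_pow (norm_nonneg _), ofReal_norm, mul_comm]

theorem energy_one_nonneg {w : Plane → ℝ} (hw : w ∈ piecewiseAffine K) :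
    0 ≤ energy 1 Ω₁ w w := by
  rw [h.energy_eq_sum 1 hw hw, one_mul]
  exact Finset.sum_nonneg fun t _ => mul_nonneg measureReal_nonneg real_inner_self_nonneg

omit h in
theorem energy_eq_mul (ν : ℝ) (A : Set Plane) (u v : Plane → ℝ) :
    energy ν A u v = ν * energy 1 A u v := by
  simp only [energy, one_mul]
  rw [integral_const_mul]

end IsFittedMesh

theorem IsDecomposition.exists_poincare {Ω Ω₁ Ω₂ : Set Plane} (h : IsDecomposition Ω Ω₁ Ω₂) :
    ∃ C > (0 : ℝ), ∀ K, IsFittedMesh Ω Ω₁ Ω₂ K → ∀ w ∈ spaceW K Ω,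
      ∫⁻ x in closure Ω₁, ‖w x‖ₑ ^ 2 ≤ ENNReal.ofReal (C * energy 1 Ω₁ w w) := by
  obtain ⟨C, hC⟩ := h.hasPoincare_closure
  refine ⟨C + 1, by positivity, fun K hK w hw => ?_⟩
  refine (hC w _ (hK.isUpperGradient hw)).trans ?_
  rw [hK.lintegral_upperGrad_sq hw.1, ENNReal.ofReal_mul (by positivity)]
  refine mul_le_mul' ?_ le_rfl
  rw [← ENNReal.ofReal_coe_nnreal]
  exact ENNReal.ofReal_le_ofReal (by linarith)

/-- This is what makes S₁ ≥ γ₂ when γ₂ is at most ν₁ divided by the constant. The added 1 in the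
proof only keeps the constant positive. -/
theorem IsDecomposition.exists_pairing_le {Ω Ω₁ Ω₂ : Set Plane} (h : IsDecomposition Ω Ω₁ Ω₂) :
    ∃ C > (0 : ℝ), ∀ K, IsFittedMesh Ω Ω₁ Ω₂ K → ∀ w ∈ spaceW K Ω,
      pairing (interface Ω₁ Ω₂) w w ≤ C * energy 1 Ω₁ w w := by
  obtain ⟨C, hC⟩ := h.exists_trace
  refine ⟨C + 1, by positivity, fun K hK w hw => ?_⟩
  have hE := hK.energy_one_nonneg hw.1
  have h1 := (lintegral_mono_set (μ := (Measure.hausdorffMeasure 1 : Measure Plane))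
    (f := fun x => ‖w x‖ₑ ^ 2) (inter_subset_left : interface Ω₁ Ω₂ ⊆ frontier Ω₁)).trans
    (hC w _ (hK.isUpperGradient hw))
  rw [hK.lintegral_upperGrad_sq hw.1, ← ENNReal.ofReal_coe_nnreal,
    ← ENNReal.ofReal_mul C.coe_nonneg] at h1
  rw [pairing, integral_eq_lintegral_of_nonneg_ae
    (Filter.Eventually.of_forall fun x => mul_self_nonneg _)
    (hw.1.1.mul hw.1.1).aestronglyMeasurable]
  refine ENNReal.toReal_le_of_le_ofReal (by positivity) (le_trans ?_ (h1.trans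
    (ENNReal.ofReal_le_ofReal (by nlinarith))))
  refine lintegral_mono fun x => ?_
  rw [Real.enorm_eq_ofReal_abs, ← ENNReal.ofReal_pow (abs_nonneg _), sq_abs, sq]

end RobinRobin

namespace RobinRobin

/-! ### Linear algebra -/

section LinearAlgebra

variable {V X : Type*} [AddCommGroup V] [Module ℝ V] [AddCommGroup X] [Module ℝ X]

/-- In finite dimension, a definite bilinear form represents each linear functional. -/
theorem exists_riesz [FiniteDimensional ℝ X] (B : X →ₗ[ℝ] X →ₗ[ℝ] ℝ)
    (hB : ∀ x, B x x = 0 → x = 0) (φ : X →ₗ[ℝ] ℝ) : ∃ x, ∀ y, B x y = φ y := by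
  have hinj : Function.Injective B := by
    rw [← LinearMap.ker_eq_bot, LinearMap.ker_eq_bot']
    intro x hx
    exact hB x (by rw [hx]; rfl)
  have hsurj : Function.Surjective B :=
    (LinearMap.injective_iff_surjective_of_finrank_eq_finrank
      (Subspace.dual_finrank_eq (K := ℝ) (V := X)).symm).1 hinj
  obtain ⟨x, hx⟩ := hsurj φ
  exact ⟨x, fun y => by rw [hx]⟩

/-- A real operator that is symmetric for a definite form, with Rayleigh quotients in `[a, b]`,
has its complex spectrum in `[a, b]`. -/
theorem spectrum_baseChange_subset [FiniteDimensional ℝ V] (Q : V →ₗ[ℝ] V →ₗ[ℝ] ℝ)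
    (hsymm : ∀ x y, Q x y = Q y x) (hpos : ∀ x, x ≠ 0 → 0 < Q x x) (T : Module.End ℝ V)
    (hT : ∀ x y, Q (T x) y = Q x (T y)) {a b : ℝ}
    (ha : ∀ x, a * Q x x ≤ Q (T x) x) (hb : ∀ x, Q (T x) x ≤ b * Q x x) :
    spectrum ℂ (LinearMap.baseChange ℂ T) ⊆ (fun t : ℝ => (t : ℂ)) '' Set.Icc a b := by
  classical
  let core : InnerProductSpace.Core ℝ V :=
    { inner := fun x y => Q x y
      conj_inner_symm := fun x y => by simpa using hsymm y x
      re_inner_nonneg := fun x => by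
        by_cases hx : x = 0
        · simp [hx]
        · simpa using (hpos x hx).le
      add_left := fun x y z => by simp
      smul_left := fun x y r => by simp
      definite := fun x hx => by
        by_contra hne
        exact (hpos x hne).ne' hx }
  let _ : NormedAddCommGroup V := core.toNormedAddCommGroup
  let _ : InnerProductSpace ℝ V := InnerProductSpace.ofCore core.toCore
  have hinner : ∀ x y : V, inner ℝ x y = Q x y := fun _ _ => rfl
  have hTs : T.IsSymmetric := fun x y => by rw [hinner, hinner]; exact hT x y
  set n := Module.finrank ℝ V with hn
  let bas := (hTs.eigenvectorBasis hn.symm)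
  let μ := hTs.eigenvalues hn.symm
  have hμ : ∀ i, T (bas i) = μ i • bas i := fun i => hTs.apply_eigenvectorBasis hn.symm i
  have hμab : ∀ i, μ i ∈ Set.Icc a b := by
    intro i
    have hne : bas i ≠ 0 := bas.orthonormal.ne_zero i
    have h0 := hpos _ hne
    have h1 := ha (bas i)
    have h2 := hb (bas i)
    rw [hμ i] at h1 h2
    simp only [map_smul, LinearMap.smul_apply, smul_eq_mul] at h1 h2
    exact ⟨le_of_mul_le_mul_right h1 h0, le_of_mul_le_mul_right h2 h0⟩
  intro z hz
  have hz' : Module.End.HasEigenvalue (LinearMap.baseChange ℂ T) z :=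
    Module.End.hasEigenvalue_iff_mem_spectrum.2 hz
  obtain ⟨v, hv⟩ := hz'.exists_hasEigenvector
  -- The real eigenbasis is still a basis after complexification and diagonalizes the operator with
  -- the same real eigenvalues. An eigenvector for z has a nonzero coordinate, which forces z to be
  -- one of them.
  let cb : Module.Basis (Fin n) ℂ (TensorProduct ℝ ℂ V) := bas.toBasis.baseChange ℂ
  have hcb : ∀ i, LinearMap.baseChange ℂ T (cb i) = (μ i : ℂ) • cb i := by
    intro i
    simp only [cb, Module.Basis.baseChange_apply, LinearMap.baseChange_tmul,
      OrthonormalBasis.coe_toBasis, hμ, TensorProduct.tmul_smul]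
    rw [← algebraMap_smul ℂ (μ i)]
    rfl
  have hex : ∃ i, cb.repr v i ≠ 0 := by
    by_contra! hall
    exact hv.2 (cb.repr.injective (Finsupp.ext fun i => by simpa using hall i))
  obtain ⟨i, hi⟩ := hex
  refine ⟨μ i, hμab i, ?_⟩
  have h1 : LinearMap.baseChange ℂ T v = z • v := hv.apply_eq_smul
  have h2 : cb.repr (LinearMap.baseChange ℂ T v) i = (μ i : ℂ) * cb.repr v i := by
    conv_lhs => rw [← cb.sum_repr v]
    rw [map_sum]
    simp only [map_smul, hcb, smul_smul]
    rw [map_sum]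
    simp only [map_smul, Module.Basis.repr_self, Finsupp.coe_finsetSum, Finset.sum_apply,
      Finsupp.smul_apply, smul_eq_mul]
    rw [Finset.sum_eq_single i]
    · simp [mul_comm]
    · intro j _ hj
      simp [hj]
    · simp
  rw [h1, map_smul, Finsupp.smul_apply, smul_eq_mul] at h2
  exact (mul_right_cancel₀ hi h2).symm

/-- A self-adjoint operator (with respect to a definite form) without kernel is invertible. -/
theorem isUnit_of_pos [FiniteDimensional ℝ V] (Q : V →ₗ[ℝ] V →ₗ[ℝ] ℝ) (T : Module.End ℝ V)
    (h : ∀ x, x ≠ 0 → 0 < Q (T x) x) : IsUnit T := by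
  rw [LinearMap.isUnit_iff_ker_eq_bot, LinearMap.ker_eq_bot']
  intro x hx
  by_contra hne
  have := h x hne
  rw [hx] at this
  simp at this

/-- The analysis of the preconditioned operator `P₄⁻¹ G` and of the error operator `R₄`. -/
theorem robin_spectrum [FiniteDimensional ℝ V] (B : V →ₗ[ℝ] V →ₗ[ℝ] ℝ)
    (hsymm : ∀ x y, B x y = B y x) (hpos : ∀ x, x ≠ 0 → 0 < B x x) (S₁ S₂ : Module.End ℝ V)
    (h₁ : ∀ x y, B (S₁ x) y = B x (S₁ y)) (h₂ : ∀ x y, B (S₂ x) y = B x (S₂ y))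
    {γ₁ γ₂ κ : ℝ} (hγ₁ : 0 < γ₁) (hγ₂ : 0 < γ₂) (hκ : 0 ≤ κ)
    (hlow : ∀ x, γ₂ * B x x ≤ B (S₁ x) x) (hnn : ∀ x, 0 ≤ B (S₂ x) x)
    (hup : ∀ x, x ≠ 0 → B (S₂ x) x < γ₁ * B x x)
    (hcomp : ∀ x, B (S₁ x) x ≤ κ * B (S₂ x) x) :
    IsUnit (γ₂ • 1 + S₂) ∧ IsUnit (γ₁ • 1 - S₂) ∧ IsUnit (γ₁ • 1 + S₁) ∧
    spectrum ℂ (LinearMap.baseChange ℂ (P4inv γ₁ γ₂ S₂ * opG γ₁ γ₂ S₁ S₂)) ⊆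
      (fun t : ℝ => (t : ℂ)) '' Set.Icc 1 (1 + κ) ∧
    (∀ θ : ℝ, 0 ≤ θ → spectrum ℂ (LinearMap.baseChange ℂ (R4 θ γ₁ γ₂ S₁ S₂)) ⊆
      (fun t : ℝ => (t : ℂ)) '' Set.Icc (1 - θ * (1 + κ)) (1 - θ)) := by
  have hnnB : ∀ x, 0 ≤ B x x := fun x => by
    by_cases hx : x = 0
    · simp [hx]
    · exact (hpos x hx).le
  have hup' : ∀ x, B (S₂ x) x ≤ γ₁ * B x x := fun x => by
    by_cases hx : x = 0
    · simp [hx]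
    · exact (hup x hx).le
  have u2 : IsUnit (γ₂ • 1 + S₂) := isUnit_of_pos B _ fun x hx => by
    have := hpos x hx
    have := hnn x
    simp only [LinearMap.add_apply, LinearMap.smul_apply, Module.End.one_apply, map_add, map_smul,
      smul_eq_mul]
    positivity
  have um : IsUnit (γ₁ • 1 - S₂) := isUnit_of_pos B _ fun x hx => by
    have := hup x hx
    simp only [LinearMap.sub_apply, LinearMap.smul_apply, Module.End.one_apply, map_sub, map_smul,
      smul_eq_mul]
    linarith
  have u1 : IsUnit (γ₁ • 1 + S₁) := isUnit_of_pos B _ fun x hx => by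
    have h0 := hpos x hx
    have := hlow x
    simp only [LinearMap.add_apply, LinearMap.smul_apply, Module.End.one_apply, map_add, map_smul,
      smul_eq_mul]
    nlinarith [mul_pos hγ₁ h0, mul_pos hγ₂ h0]
  refine ⟨u2, um, u1, ?_⟩
  set Xo : Module.End ℝ V := (γ₂ • 1 + S₂) * Ring.inverse (γ₁ • 1 - S₂) with hX
  set Y : Module.End ℝ V := (γ₂ • 1 - S₁) * Ring.inverse (γ₁ • 1 + S₁) with hY
  -- Writing x = (γ₁ + S₁)y, and x = (γ₁ - S₂)z below, removes the inverses: every inequality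
  -- becomes a polynomial one in a single symmetric operator, indicated below by its scalar analogue
  -- in s.
  have e1 : ∀ x, ∃ y, x = (γ₁ • 1 + S₁) y ∧ Y x = γ₂ • y - S₁ y := fun x => by
    refine ⟨Ring.inverse (γ₁ • 1 + S₁) x, ?_, ?_⟩
    · rw [← Module.End.mul_apply, Ring.mul_inverse_cancel _ u1]; rfl
    · rw [hY]; rfl
  have e2 : ∀ x, ∃ z, x = (γ₁ • 1 - S₂) z ∧ Xo x = γ₂ • z + S₂ z := fun x => by
    refine ⟨Ring.inverse (γ₁ • 1 - S₂) x, ?_, ?_⟩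
    · rw [← Module.End.mul_apply, Ring.mul_inverse_cancel _ um]; rfl
    · rw [hX]; rfl
  have hXsymm : ∀ x y, B (Xo x) y = B (Xo y) x := fun x y => by
    obtain ⟨z, rfl, hz⟩ := e2 x
    obtain ⟨w, rfl, hw⟩ := e2 y
    rw [hz, hw]
    simp only [LinearMap.sub_apply, LinearMap.smul_apply, Module.End.one_apply, map_sub, map_smul,
      map_add, LinearMap.add_apply, smul_eq_mul]
    linear_combination γ₁ * γ₂ * hsymm z w + γ₁ * (h₂ z w + hsymm z (S₂ w)) -
      γ₂ * (hsymm z (S₂ w) + h₂ w z) - hsymm (S₂ z) (S₂ w)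
  have hYsymm : ∀ x y, B (Y x) y = B (Y y) x := fun x y => by
    obtain ⟨z, rfl, hz⟩ := e1 x
    obtain ⟨w, rfl, hw⟩ := e1 y
    rw [hz, hw]
    simp only [LinearMap.sub_apply, LinearMap.smul_apply, Module.End.one_apply, map_sub, map_smul,
      map_add, LinearMap.add_apply, smul_eq_mul]
    linear_combination γ₁ * γ₂ * hsymm z w - γ₁ * (h₁ z w + hsymm z (S₁ w)) +
      γ₂ * (hsymm z (S₁ w) + h₁ w z) - hsymm (S₁ z) (S₁ w)
  -- Scalar form s² ≤ γ₁s. It follows from the Cauchy–Schwarz inequality for the semidefinite form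
  -- B(S₂·,·) applied to z and S₂z.
  have hS₂ : ∀ z, B (S₂ z) (S₂ z) ≤ γ₁ * B (S₂ z) z := fun z => by
    have h := LinearMap.BilinForm.apply_mul_apply_le_of_forall_zero_le (B.comp S₂) hnn z (S₂ z)
    simp only [LinearMap.comp_apply] at h
    rw [h₂ (S₂ z) z] at h
    have h3 := hup' (S₂ z)
    rcases (hnnB (S₂ z)).eq_or_lt with h0 | h0
    · rw [← h0]; exact mul_nonneg hγ₁.le (hnn z)
    · nlinarith [mul_le_mul_of_nonneg_left h3 (hnn z)]
  -- The difference of the two sides is (γ₁ - s)(γ₁γ₂ + s²) in scalar form.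
  have hXlow : ∀ x, B (S₂ x) x ≤ γ₁ * B (Xo x) x := fun x => by
    obtain ⟨z, rfl, hz⟩ := e2 x
    rw [hz]
    have k1 := hup' z
    have k2 := hup' (S₂ z)
    have k4 := mul_nonneg (mul_pos hγ₁ hγ₂).le (sub_nonneg.2 k1)
    simp only [LinearMap.sub_apply, LinearMap.smul_apply, Module.End.one_apply, map_sub, map_smul,
      map_add, LinearMap.add_apply, smul_eq_mul]
    have k5 : B (S₂ (S₂ z)) z = B (S₂ z) (S₂ z) := h₂ _ _
    have k6 : B z (S₂ z) = B (S₂ z) z := hsymm _ _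
    rw [k5, k6]
    linarith
  have hXpos : ∀ x, x ≠ 0 → 0 < B (Xo x) x := fun x hx => by
    obtain ⟨z, rfl, hz⟩ := e2 x
    have hz0 : z ≠ 0 := by rintro rfl; simp at hx
    rw [hz]
    have k4 := mul_pos hγ₂ (sub_pos.2 (hup z hz0))
    have k5 := hS₂ z
    simp only [LinearMap.sub_apply, LinearMap.smul_apply, Module.End.one_apply, map_sub, map_smul,
      map_add, LinearMap.add_apply, smul_eq_mul]
    have k6 : B z (S₂ z) = B (S₂ z) z := hsymm _ _
    rw [k6]
    linarith
  -- Scalar form γ₂s ≤ s², from Cauchy–Schwarz for `B` and γ₂ ≤ S₁.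
  have hS₁ : ∀ y, γ₂ * B (S₁ y) y ≤ B (S₁ y) (S₁ y) := fun y => by
    have h := LinearMap.BilinForm.apply_mul_apply_le_of_forall_zero_le B hnnB (S₁ y) y
    rw [hsymm y (S₁ y)] at h
    have h3 := hlow y
    rcases (hnnB y).eq_or_lt with h0 | h0
    · have : y = 0 := by
        by_contra hne
        exact (hpos y hne).ne h0
      simp [this]
    · nlinarith [mul_pos hγ₂ h0]
  have hS₁' : ∀ y, 0 ≤ B (S₁ y) y := fun y => (mul_nonneg hγ₂.le (hnnB y)).trans (hlow y)
  have hYneg : ∀ x, B (Y x) x ≤ 0 := fun x => by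
    obtain ⟨y, rfl, hy⟩ := e1 x
    rw [hy]
    have k1 := mul_nonneg hγ₁.le (sub_nonneg.2 (hlow y))
    have k2 := hS₁ y
    simp only [LinearMap.sub_apply, LinearMap.smul_apply, Module.End.one_apply, map_sub, map_smul,
      map_add, LinearMap.add_apply, smul_eq_mul]
    rw [hsymm y (S₁ y)]
    linarith
  -- The difference of the two sides is (γ₁ + s)(s² + γ₁γ₂) in scalar form; `k1` to `k4` are its
  -- four terms.
  have hYlow : ∀ x, -(γ₁ * B (Y x) x) ≤ B (S₁ x) x := fun x => by
    obtain ⟨y, rfl, hy⟩ := e1 x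
    rw [hy]
    have k1 := hS₁' (S₁ y)
    have k2 := mul_nonneg hγ₁.le (hnnB (S₁ y))
    have k3 := mul_nonneg (mul_pos hγ₁ hγ₂).le (hS₁' y)
    have k4 := mul_nonneg (mul_pos hγ₁ (mul_pos hγ₁ hγ₂)).le (hnnB y)
    simp only [LinearMap.sub_apply, LinearMap.smul_apply, Module.End.one_apply, map_sub, map_smul,
      map_add, LinearMap.add_apply, smul_eq_mul]
    have k5 : B (S₁ (S₁ y)) y = B (S₁ y) (S₁ y) := h₁ _ _
    rw [k5, hsymm y (S₁ y)]
    linarith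
  have hYX : ∀ x, -B (Y x) x ≤ κ * B (Xo x) x := fun x => by
    have k1 := hYlow x
    have k2 := hcomp x
    have k3 := mul_le_mul_of_nonneg_left (hXlow x) hκ
    have : γ₁ * (-B (Y x) x) ≤ γ₁ * (κ * B (Xo x) x) := by linarith
    exact le_of_mul_le_mul_left this hγ₁
  have hXP : Xo * P4inv γ₁ γ₂ S₂ = 1 := by
    rw [hX, P4inv, mul_assoc, ← mul_assoc (Ring.inverse (γ₁ • 1 - S₂)),
      Ring.inverse_mul_cancel _ um, one_mul, Ring.mul_inverse_cancel _ u2]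
  have hXT : ∀ x, Xo ((P4inv γ₁ γ₂ S₂ * opG γ₁ γ₂ S₁ S₂) x) = Xo x - Y x := fun x => by
    rw [← Module.End.mul_apply, ← mul_assoc, hXP, one_mul]
    rfl
  -- In the product B(X·,·) the form of X⁻¹(X - Y) is that of X - Y: symmetric, and free of `P4inv`.
  have key := spectrum_baseChange_subset (B.comp Xo) (fun x y => (hXsymm x y).trans rfl) hXpos
  refine ⟨key _ (fun x y => ?_) (fun x => ?_) (fun x => ?_), fun θ hθ =>
    key _ (fun x y => ?_) (fun x => ?_) (fun x => ?_)⟩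
  · simp only [LinearMap.comp_apply]
    rw [hXT, hXsymm x, hXT]
    simp [hXsymm x y, hYsymm x y]
  · simp only [LinearMap.comp_apply, hXT, map_sub, LinearMap.sub_apply]
    linarith [hYneg x]
  · simp only [LinearMap.comp_apply, hXT, map_sub, LinearMap.sub_apply]
    linarith [hYX x]
  · simp only [LinearMap.comp_apply, R4, LinearMap.sub_apply, LinearMap.smul_apply,
      Module.End.one_apply, map_sub, map_smul, smul_eq_mul, hXT]
    rw [hXsymm x ((P4inv γ₁ γ₂ S₂ * opG γ₁ γ₂ S₁ S₂) y), hXT]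
    simp [hXsymm x y, hYsymm x y]
  · simp only [LinearMap.comp_apply, R4, LinearMap.sub_apply, LinearMap.smul_apply,
      Module.End.one_apply, map_sub, map_smul, smul_eq_mul, hXT]
    nlinarith [mul_le_mul_of_nonneg_left (hYX x) hθ]
  · simp only [LinearMap.comp_apply, R4, LinearMap.sub_apply, LinearMap.smul_apply,
      Module.End.one_apply, map_sub, map_smul, smul_eq_mul, hXT]
    nlinarith [mul_le_mul_of_nonneg_left (hYneg x) hθ]

/-- `S` is the Schur complement of the form `a` on `X` with respect to the trace `tr : X → V`. -/
def IsAbstractSchur (a : X →ₗ[ℝ] X →ₗ[ℝ] ℝ) (B : V →ₗ[ℝ] V →ₗ[ℝ] ℝ) (tr : X →ₗ[ℝ] V)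
    (S : Module.End ℝ V) : Prop :=
  ∀ u, ∃ w, tr w = u ∧ ∀ z, B (S u) (tr z) = a w z

/-- The discrete harmonic functions are those `a`-orthogonal to the kernel of the trace.
Definiteness makes the trace injective on them, and projecting onto the kernel makes it surjective.
For harmonic w the number a(w,z) depends on z only through its trace, so the right inverse `s` is
immaterial, and `B` represents the resulting functional. -/
theorem existsUnique_abstractSchur [FiniteDimensional ℝ V] [FiniteDimensional ℝ X]
    (a : X →ₗ[ℝ] X →ₗ[ℝ] ℝ) (B : V →ₗ[ℝ] V →ₗ[ℝ] ℝ) (tr : X →ₗ[ℝ] V)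
    (ha : ∀ x, a x x = 0 → x = 0) (hB : ∀ x, B x x = 0 → x = 0)
    (htr : Function.Surjective tr) : ∃! S, IsAbstractSchur a B tr S := by
  refine existsUnique_of_exists_of_unique ?_ ?_
  · let Y : Submodule ℝ X :=
      { carrier := {w | ∀ v, tr v = 0 → a w v = 0}
        add_mem' := fun {x y} hx hy v hv => by simp [hx v hv, hy v hv]
        zero_mem' := fun v _ => by simp
        smul_mem' := fun c x hx v hv => by simp [hx v hv] }
    let t : Y →ₗ[ℝ] V := tr.comp Y.subtype
    have hinj : Function.Injective t := by
      rw [← LinearMap.ker_eq_bot, LinearMap.ker_eq_bot']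
      intro y hy
      exact Subtype.ext (ha _ (y.2 _ hy))
    have hsurj : Function.Surjective t := fun u => by
      obtain ⟨x, rfl⟩ := htr u
      obtain ⟨v, hv⟩ := exists_riesz (X := LinearMap.ker tr)
        ((a.compl₁₂ (LinearMap.ker tr).subtype (LinearMap.ker tr).subtype))
        (fun x hx => Subtype.ext (ha _ hx)) ((a x).comp (LinearMap.ker tr).subtype)
      refine ⟨⟨x - v, fun z hz => ?_⟩, ?_⟩
      · have h1 : a v z = a x z := hv ⟨z, hz⟩
        simp [h1]
      · have h2 : tr (v : X) = 0 := v.2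
        simp [t, h2]
    let E := LinearEquiv.ofBijective t ⟨hinj, hsurj⟩
    obtain ⟨s, hs⟩ := tr.exists_rightInverse_of_surjective (LinearMap.range_eq_top.2 htr)
    have hBinj : Function.Injective B := by
      rw [← LinearMap.ker_eq_bot, LinearMap.ker_eq_bot']
      exact fun x hx => hB x (by rw [hx]; rfl)
    let D := LinearEquiv.ofInjectiveOfFinrankEq (B : V →ₗ[ℝ] Module.Dual ℝ V) hBinj
      (Subspace.dual_finrank_eq (K := ℝ) (V := V)).symm
    have hD : ∀ φ : Module.Dual ℝ V, B (D.symm φ) = φ := fun φ => D.apply_symm_apply φ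
    let ψ : X →ₗ[ℝ] Module.Dual ℝ V := a.compl₂ s
    refine ⟨D.symm.toLinearMap ∘ₗ ψ ∘ₗ Y.subtype ∘ₗ E.symm.toLinearMap, fun u =>
      ⟨E.symm u, E.apply_symm_apply u, fun z => ?_⟩⟩
    simp only [LinearMap.comp_apply, LinearEquiv.coe_coe]
    rw [hD]
    have h0 : tr (s (tr z) - z) = 0 := by
      rw [map_sub, ← LinearMap.comp_apply tr s, hs]
      simp
    have h1 := (E.symm u).2 _ h0
    rw [map_sub, sub_eq_zero] at h1
    exact h1
  · intro S S' hS hS'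
    ext u
    obtain ⟨w, hw, h⟩ := hS u
    obtain ⟨w', hw', h'⟩ := hS' u
    have hww : w = w' := by
      refine sub_eq_zero.1 (ha _ ?_)
      have h1 := h (w - w')
      have h2 := h' (w - w')
      have h0 : tr (w - w') = 0 := by rw [map_sub, hw, hw', sub_self]
      rw [h0] at h1 h2
      rw [map_sub a, LinearMap.sub_apply, ← h1, ← h2]
      simp
    refine sub_eq_zero.1 (hB _ ?_)
    obtain ⟨z, hz⟩ := htr (S u - S' u)
    have h1 := h z
    have h2 := h' z
    rw [hz] at h1 h2
    rw [map_sub B, LinearMap.sub_apply, h1, h2, hww, sub_self]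

namespace IsAbstractSchur

variable {a : X →ₗ[ℝ] X →ₗ[ℝ] ℝ} {B : V →ₗ[ℝ] V →ₗ[ℝ] ℝ} {tr : X →ₗ[ℝ] V} {S : Module.End ℝ V}

theorem symmetric (h : IsAbstractSchur a B tr S) (hB : ∀ x y, B x y = B y x)
    (ha : ∀ x y, a x y = a y x) (x y : V) : B (S x) y = B x (S y) := by
  obtain ⟨w, rfl, hw⟩ := h x
  obtain ⟨z, rfl, hz⟩ := h y
  rw [hw, ha, ← hz, hB]

theorem exists_eq_energy (h : IsAbstractSchur a B tr S) (u : V) :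
    ∃ w, tr w = u ∧ B (S u) u = a w w := by
  obtain ⟨w, rfl, hw⟩ := h u
  exact ⟨w, rfl, hw w⟩

/-- The discrete harmonic extension minimizes the energy. -/
theorem le_energy (h : IsAbstractSchur a B tr S) (ha : ∀ x y, a x y = a y x)
    (hnn : ∀ x, 0 ≤ a x x) (z : X) : B (S (tr z)) (tr z) ≤ a z z := by
  obtain ⟨w, hw, hwz⟩ := h (tr z)
  have h1 := hwz w
  have h2 := hwz z
  have h3 := hnn (z - w)
  rw [hw] at h1
  simp only [map_sub, LinearMap.sub_apply] at h3
  rw [ha z w] at h3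
  linarith

/-- Robin problems on `X` are problems for `γ + S` on `V`. -/
theorem robin_trace (h : IsAbstractSchur a B tr S) (ha : ∀ x, a x x = 0 → x = 0)
    (hB : ∀ x, B x x = 0 → x = 0) (htr : Function.Surjective tr) {γ : ℝ} {g : V} {e : X}
    (he : ∀ v, a e v + γ * B (tr e) (tr v) = B g (tr v)) : (γ • 1 + S) (tr e) = g := by
  obtain ⟨w, hw, hwz⟩ := h (tr e)
  -- Against test functions of zero trace the Robin problem says that e is harmonic, so e is the
  -- harmonic extension of its own trace.
  have hew : e = w := by
    refine sub_eq_zero.1 (ha _ ?_)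
    have h0 : tr (e - w) = 0 := by rw [map_sub, hw, sub_self]
    have h1 := he (e - w)
    have h2 := hwz (e - w)
    rw [h0] at h1 h2
    simp only [map_zero, mul_zero, add_zero] at h1 h2
    rw [map_sub a, LinearMap.sub_apply, h1, ← h2, sub_self]
  refine sub_eq_zero.1 (hB _ ?_)
  obtain ⟨z, hz⟩ := htr ((γ • 1 + S) (tr e) - g)
  have h1 := he z
  have h2 := hwz z
  rw [← hew, hz] at h2
  rw [hz] at h1
  rw [map_sub B, LinearMap.sub_apply, ← h1, ← h2, LinearMap.add_apply, map_add B,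
    LinearMap.add_apply, LinearMap.smul_apply, Module.End.one_apply, map_smul B,
    LinearMap.smul_apply, smul_eq_mul]
  ring

/-- The harmonic extension of (γ + S)⁻¹g is a solution; this is the converse of `robin_trace`. -/
theorem exists_robin (h : IsAbstractSchur a B tr S) {γ : ℝ} (hu : IsUnit (γ • 1 + S)) (g : V) :
    ∃ e, ∀ v, a e v + γ * B (tr e) (tr v) = B g (tr v) := by
  obtain ⟨w, hw, hwz⟩ := h (Ring.inverse (γ • 1 + S) g)
  refine ⟨w, fun v => ?_⟩
  have hg : g = (γ • 1 + S) (Ring.inverse (γ • 1 + S) g) := by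
    rw [← Module.End.mul_apply, Ring.mul_inverse_cancel _ hu]; rfl
  rw [hw, ← hwz]
  conv_rhs => rw [hg]
  simp
  ring

end IsAbstractSchur

end LinearAlgebra

end RobinRobin

namespace RobinRobin

/-! ### Uniform meshes -/

/-- All triangles have diameter at most `h` and contain a disc of radius `κ h`. -/
structure IsUniformMesh (K : Geometry.SimplicialComplex ℝ Plane) (h κ : ℝ) : Prop where
  h_pos : 0 < h
  κ_pos : 0 < κ
  dist_le : ∀ t ∈ triangles K, ∀ x ∈ cell t, ∀ y ∈ cell t, dist x y ≤ h
  incircle : ∀ t ∈ triangles K, ∃ c, Metric.closedBall c (κ * h) ⊆ cell t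

/-- The parameter enters twice: h ≤ σ · diameter ≤ 2σ²r for the inscribed disc of any triangle.
Positivity of σ comes from the existence of a triangle. -/
theorem IsTriangulation.isUniformMesh {Ω : Set Plane} {K : Geometry.SimplicialComplex ℝ Plane}
    (h : IsTriangulation K Ω) (hΩ : Ω.Nonempty) {σ : ℝ} (hσ : IsRegularQuasiUniform K σ) :
    0 < σ ∧ IsUniformMesh K (meshSize K) (1 / (2 * σ ^ 2)) := by
  have hbd : ∀ t : Finset Plane, Bornology.IsBounded (cell t) := fun t =>
    (isCompact_cell t).isBounded
  have hle : ∀ t ∈ triangles K, Metric.diam (cell t) ≤ meshSize K := fun t ht =>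
    le_csSup (h.finite_triangles.image _).bddAbove (mem_image_of_mem _ ht)
  have hr : ∀ t ∈ triangles K, ∃ (c : Plane) (r : ℝ), 0 < r ∧ Metric.closedBall c r ⊆ cell t ∧
      0 < Metric.diam (cell t) ∧ Metric.diam (cell t) ≤ σ * (2 * r) := by
    intro t ht
    obtain ⟨c, r, hr, hsub, hd⟩ := hσ.regular t ht
    refine ⟨c, r, hr, hsub, ?_, hd⟩
    have h1 := Metric.diam_mono hsub (hbd t)
    rw [Metric.diam_closedBall_eq c hr.le] at h1
    linarith
  obtain ⟨x, hx⟩ := hΩ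
  obtain ⟨t₀, ht₀, -⟩ := h.exists_mem_cell (subset_closure hx)
  obtain ⟨c₀, r₀, hr₀, -, hd₀, hd₀'⟩ := hr t₀ ht₀
  have hσ0 : 0 < σ := by
    by_contra hneg
    have := mul_nonpos_of_nonpos_of_nonneg (not_lt.1 hneg) (by linarith : 0 ≤ 2 * r₀)
    linarith
  refine ⟨hσ0, ⟨hd₀.trans_le (hle t₀ ht₀), by positivity, fun t ht x hx y hy =>
    (Metric.dist_le_diam_of_mem (hbd t) hx hy).trans (hle t ht), fun t ht => ?_⟩⟩
  obtain ⟨c, r, hr, hsub, hd, hd'⟩ := hr t ht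
  refine ⟨c, (Metric.closedBall_subset_closedBall ?_).trans hsub⟩
  have h1 := hσ.quasiUniform t ht
  have h2 : meshSize K ≤ 2 * σ ^ 2 * r :=
    h1.trans ((mul_le_mul_of_nonneg_left hd' hσ0.le).trans_eq (by ring))
  rw [one_div, inv_mul_le_iff₀ (by positivity)]
  exact h2

/-- The area of the unit disc. -/
noncomputable def discArea : ℝ := volume.real (Metric.closedBall (0 : Plane) 1)

theorem measureReal_closedBall (x : Plane) {r : ℝ} (hr : 0 ≤ r) :
    volume.real (Metric.closedBall x r) = r ^ 2 * discArea := by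
  rw [discArea, Measure.real, Measure.addHaar_closedBall' volume x hr, ENNReal.toReal_mul,
    ENNReal.toReal_ofReal (by positivity)]
  simp [Measure.real]

theorem discArea_pos : 0 < discArea :=
  ENNReal.toReal_pos (Metric.measure_closedBall_pos volume 0 one_pos).ne'
    measure_closedBall_lt_top.ne

namespace IsUniformMesh

variable {K : Geometry.SimplicialComplex ℝ Plane} {h κ : ℝ} (hU : IsUniformMesh K h κ)
include hU

/-- The bound passes from the vertices to the whole triangle by convexity in each point. It is then
tested at the ends of the diameter of the inscribed disc parallel to g. -/
theorem norm_mul_le {t : Finset Plane} (ht : t ∈ triangles K) {g : Plane} {D : ℝ}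
    (hD : ∀ p ∈ t, ∀ q ∈ t, inner ℝ g (p - q) ≤ D) : ‖g‖ * (2 * (κ * h)) ≤ D := by
  obtain ⟨c, hc⟩ := hU.incircle t ht
  have hr : 0 < κ * h := mul_pos hU.κ_pos hU.h_pos
  have h1 : ∀ p ∈ t, ∀ y ∈ cell t, inner ℝ g (p - y) ≤ D := fun p hp => by
    have hconv : Convex ℝ {y : Plane | inner ℝ g (p - y) ≤ D} := by
      have : {y : Plane | inner ℝ g (p - y) ≤ D} = {y | inner ℝ g p - D ≤ inner ℝ g y} := by
        ext y; simp only [mem_ofPred_eq, inner_sub_right]; constructor <;> intro <;> linarith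
      rw [this]
      exact convex_halfSpace_ge (innerSL ℝ g).toLinearMap.isLinear _
    exact convexHull_min (fun q hq => hD p hp q hq) hconv
  have h2 : ∀ y ∈ cell t, ∀ x ∈ cell t, inner ℝ g (x - y) ≤ D := fun y hy => by
    have hconv : Convex ℝ {x : Plane | inner ℝ g (x - y) ≤ D} := by
      have : {x : Plane | inner ℝ g (x - y) ≤ D} = {x | inner ℝ g x ≤ inner ℝ g y + D} := by
        ext y; simp only [mem_ofPred_eq, inner_sub_right]; constructor <;> intro <;> linarith
      rw [this]
      exact convex_halfSpace_le (innerSL ℝ g).toLinearMap.isLinear _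
    exact convexHull_min (fun q hq => h1 q hq y hy) hconv
  by_cases hg : g = 0
  · subst hg
    have := h2 c (hc (Metric.mem_closedBall_self hr.le)) c (hc (Metric.mem_closedBall_self hr.le))
    simpa using this
  · have hgn : 0 < ‖g‖ := norm_pos_iff.2 hg
    have hm : ∀ s : ℝ, |s| ≤ κ * h → c + s • (‖g‖⁻¹ • g) ∈ cell t := fun s hs => by
      refine hc ?_
      rw [Metric.mem_closedBall, dist_eq_norm, add_sub_cancel_left, norm_smul, norm_smul, norm_inv,
        norm_norm, inv_mul_cancel₀ hgn.ne', mul_one]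
      exact hs
    have := h2 _ (hm (-(κ * h)) (by rw [abs_neg, abs_of_pos hr])) _
      (hm (κ * h) (by rw [abs_of_pos hr]))
    rw [add_sub_add_left_eq_sub, ← sub_smul, inner_smul_right, inner_smul_right,
      real_inner_self_eq_norm_sq] at this
    refine le_trans (le_of_eq ?_) this
    field_simp
    ring

theorem norm_slope_mul_le {t : Finset Plane} (ht : t ∈ triangles K) {w : Plane → ℝ}
    (hw : w ∈ piecewiseAffine K) {D : ℝ} (hD : ∀ p ∈ t, ∀ q ∈ t, w p - w q ≤ D) :
    ‖slope w t‖ * (2 * (κ * h)) ≤ D :=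
  hU.norm_mul_le ht fun p hp q hq => by
    rw [← sub_eq_inner_slope hw ht (mem_cell_of_mem hp) (mem_cell_of_mem hq)]
    exact hD p hp q hq

/-- The barycentric coordinate of p varies by at most 1 over the triangle, so its gradient g
satisfies |g|·2κh ≤ 1; it also drops by exactly 1 from p to q. -/
theorem le_dist {t : Finset Plane} (ht : t ∈ triangles K) {p q : Plane} (hp : p ∈ t) (hq : q ∈ t)
    (hpq : p ≠ q) : 2 * (κ * h) ≤ dist p q := by
  have hT := isTriangle ht
  obtain ⟨g, hg⟩ := exists_inner_of_affine (hT.bary p)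
  have h1 : ‖g‖ * (2 * (κ * h)) ≤ 1 := hU.norm_mul_le ht fun a ha b hb => by
    rw [← hg]
    have h0 := hT.mem_cell_iff.1 (mem_cell_of_mem hb) p hp
    have h2 : hT.bary p a ≤ 1 := by
      by_cases hpa : p = a
      · rw [← hpa, hT.bary_self hp]
      · rw [hT.bary_of_ne ha hpa]; exact zero_le_one
    linarith
  have h2 := hg p q
  rw [hT.bary_self hp, hT.bary_of_ne hq hpq, sub_zero] at h2
  have h3 := real_inner_le_norm g (p - q)
  rw [← h2, ← dist_eq_norm] at h3
  have hr : 0 < κ * h := mul_pos hU.κ_pos hU.h_pos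
  have h4 : ‖g‖ * (2 * (κ * h)) ≤ ‖g‖ * dist p q := h1.trans h3
  have hgn : 0 < ‖g‖ := by
    by_contra hneg
    have : ‖g‖ = 0 := le_antisymm (not_lt.1 hneg) (norm_nonneg g)
    rw [this] at h3
    linarith
  exact le_of_mul_le_mul_left h4 hgn

theorem measureReal_cell_le {t : Finset Plane} (ht : t ∈ triangles K) :
    volume.real (cell t) ≤ h ^ 2 * discArea := by
  obtain ⟨c, hc⟩ := hU.incircle t ht
  have hr : 0 < κ * h := mul_pos hU.κ_pos hU.h_pos
  rw [← measureReal_closedBall c hU.h_pos.le]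
  exact measureReal_mono (fun x hx =>
    hU.dist_le t ht x hx c (hc (Metric.mem_closedBall_self hr.le))) measure_closedBall_lt_top.ne

theorem le_measureReal_cell {t : Finset Plane} (ht : t ∈ triangles K) :
    (κ * h) ^ 2 * discArea ≤ volume.real (cell t) := by
  obtain ⟨c, hc⟩ := hU.incircle t ht
  rw [← measureReal_closedBall c (mul_pos hU.κ_pos hU.h_pos).le]
  exact measureReal_mono hc (volume_cell_lt_top t).ne

/-- A disc of radius `R h` meets a bounded number of triangles. -/
theorem card_le (x : Plane) {R : ℝ} (hR : 0 ≤ R) (S : Finset (Finset Plane))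
    (hS : ∀ t ∈ S, t ∈ triangles K ∧ (cell t ∩ Metric.closedBall x (R * h)).Nonempty) :
    (S.card : ℝ) ≤ ((R + 1) / κ) ^ 2 := by
  have hh := hU.h_pos
  have hκ := hU.κ_pos
  -- An area count: the disjoint interiors, each of area at least that of a disc of radius κh, fit
  -- into a disc of radius (R + 1)h.
  have hsub : ⋃ t ∈ S, interior (cell t) ⊆ Metric.closedBall x ((R + 1) * h) := by
    refine iUnion₂_subset fun t ht y hy => ?_
    obtain ⟨z, hz, hzx⟩ := (hS t ht).2
    rw [Metric.mem_closedBall] at *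
    have := hU.dist_le t (hS t ht).1 y (interior_subset hy) z hz
    linarith [dist_triangle y z x]
  have h1 := measureReal_mono hsub (measure_closedBall_lt_top (μ := volume)).ne
  rw [measureReal_biUnion_finset (fun t ht t' ht' hne =>
    disjoint_interior_cell (hS t ht).1 (hS t' ht').1 hne)
    (fun t _ => isOpen_interior.measurableSet)
    (fun t _ => ((measure_mono interior_subset).trans_lt (volume_cell_lt_top t)).ne),
    measureReal_closedBall x (by positivity)] at h1
  have h2 : (S.card : ℝ) * ((κ * h) ^ 2 * discArea) ≤
      ∑ t ∈ S, volume.real (interior (cell t)) := by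
    rw [← nsmul_eq_mul]
    refine Finset.card_nsmul_le_sum _ _ _ fun t ht => ?_
    rw [measureReal_congr (interior_cell_ae_eq t)]
    exact hU.le_measureReal_cell (hS t ht).1
  have h3 := h2.trans h1
  have hd := discArea_pos
  rw [div_pow, le_div_iff₀ (by positivity)]
  have h4 : (S.card : ℝ) * κ ^ 2 * (h ^ 2 * discArea) ≤ (R + 1) ^ 2 * (h ^ 2 * discArea) := by
    nlinarith
  exact le_of_mul_le_mul_right h4 (by positivity)

end IsUniformMesh

/-! ### Integration over edges -/

theorem hausdorffMeasure_interface_lt_top {Ω Ω₁ Ω₂ : Set Plane} (h : IsDecomposition Ω Ω₁ Ω₂) :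
    (Measure.hausdorffMeasure 1 : Measure Plane) (interface Ω₁ Ω₂) < ∞ :=
  (measure_mono inter_subset_left).trans_lt h.domain₁.hausdorffMeasure_frontier_lt_top

theorem IsDecomposition.isCompact_interface {Ω Ω₁ Ω₂ : Set Plane}
    (h : IsDecomposition Ω Ω₁ Ω₂) : IsCompact (interface Ω₁ Ω₂) :=
  h.domain₁.isCompact_closure.of_isClosed_subset h.isClosed_interface h.interface_subset_closure₁

theorem IsDecomposition.integrableOn_interface {Ω Ω₁ Ω₂ : Set Plane}
    (h : IsDecomposition Ω Ω₁ Ω₂) {f : Plane → ℝ} (hf : ContinuousOn f (interface Ω₁ Ω₂)) :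
    IntegrableOn f (interface Ω₁ Ω₂) (Measure.hausdorffMeasure 1 : Measure Plane) := by
  obtain ⟨C, hC⟩ := h.isCompact_interface.exists_bound_of_continuousOn hf
  have : IsFiniteMeasure ((Measure.hausdorffMeasure 1 : Measure Plane).restrict
      (interface Ω₁ Ω₂)) :=
    ⟨by rw [Measure.restrict_apply_univ]; exact hausdorffMeasure_interface_lt_top h⟩
  exact Integrable.of_bound (hf.aestronglyMeasurable h.isClosed_interface.measurableSet) C
    (ae_restrict_of_forall_mem h.isClosed_interface.measurableSet hC)

theorem setIntegral_segment (p q : Plane) {f : Plane → ℝ} (hf : Continuous f) :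
    ∫ x in segment ℝ p q, f x ∂(Measure.hausdorffMeasure 1 : Measure Plane) =
      dist p q * ∫ τ in (0 : ℝ)..1, f (AffineMap.lineMap p q τ) := by
  have hc : Continuous fun τ : ℝ => (AffineMap.lineMap p q : ℝ →ᵃ[ℝ] Plane) τ :=
    AffineMap.lineMap_continuous
  have hm : (Measure.hausdorffMeasure 1 : Measure Plane).restrict (segment ℝ p q) =
      nndist p q • Measure.map (fun τ : ℝ => (AffineMap.lineMap p q : ℝ →ᵃ[ℝ] Plane) τ)
        (volume.restrict (Icc (0 : ℝ) 1)) := by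
    ext A hA
    rw [Measure.restrict_apply hA, segment_eq_image_lineMap, ← Set.image_preimage_inter,
      hausdorffMeasure_lineMap_image, Measure.smul_apply, Measure.map_apply hc.measurable hA,
      Measure.restrict_apply (hc.measurable hA), hausdorffMeasure_real]
  rw [hm, integral_smul_nnreal_measure, integral_map hc.measurable.aemeasurable
    hf.aestronglyMeasurable, intervalIntegral.integral_of_le zero_le_one,
    integral_Icc_eq_integral_Ioc, NNReal.smul_def, coe_nndist, smul_eq_mul]

/-- The value at an end point of an edge is controlled by the integral over the edge. -/
theorem sq_le_setIntegral_segment {p q : Plane} {w : Plane → ℝ} (hwc : Continuous w)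
    (hw : ∀ τ ∈ Icc (0 : ℝ) 1, w (AffineMap.lineMap p q τ) = w p + τ * (w q - w p)) :
    dist p q * w p ^ 2 ≤
      4 * ∫ x in segment ℝ p q, w x * w x ∂(Measure.hausdorffMeasure 1 : Measure Plane) := by
  rw [setIntegral_segment p q (f := fun x => w x * w x) (hwc.mul hwc)]
  have h1 : ∫ τ in (0 : ℝ)..1, w (AffineMap.lineMap p q τ) * w (AffineMap.lineMap p q τ) =
      ∫ τ in (0 : ℝ)..1, (w p ^ 2 + 2 * w p * (w q - w p) * τ + (w q - w p) ^ 2 * τ ^ 2) := by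
    refine intervalIntegral.integral_congr fun τ hτ => ?_
    rw [uIcc_of_le zero_le_one] at hτ
    simp only [hw τ hτ]
    ring
  have hci : ∀ {f : ℝ → ℝ}, Continuous f → IntervalIntegrable f volume 0 1 :=
    fun hf => hf.intervalIntegrable _ _
  have h2 : ∫ τ in (0 : ℝ)..1, 2 * w p * (w q - w p) * τ = w p * (w q - w p) := by
    rw [intervalIntegral.integral_const_mul, integral_id]
    ring
  rw [h1, intervalIntegral.integral_add (hci (by fun_prop)) (hci (by fun_prop)),
    intervalIntegral.integral_add (hci (by fun_prop)) (hci (by fun_prop)), h2]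
  simp only [intervalIntegral.integral_const_mul, intervalIntegral.integral_const, integral_pow]
  have hd := dist_nonneg (x := p) (y := q)
  norm_num
  -- With end values a and b the mean of w² is (a² + ab + b²)/3, and 4(a² + ab + b²)/3 - a² = (a +
  -- 2b)²/3.
  nlinarith [mul_nonneg hd (sq_nonneg (w p + 2 * w q))]

end RobinRobin

namespace RobinRobin

/-! ### Discrete extensions -/

section Extension

variable {Ω Ω₁ Ω₂ : Set Plane} {K : Geometry.SimplicialComplex ℝ Plane} {h κ : ℝ}

/-- The energy is bounded by the vertex differences. -/
theorem IsFittedMesh.energy_le (hM : IsFittedMesh Ω Ω₁ Ω₂ K) (hU : IsUniformMesh K h κ)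
    {u : Plane → ℝ} (hu : u ∈ piecewiseAffine K) {D : Finset Plane → ℝ}
    (hD : ∀ t ∈ cellsIn K Ω₁, ∀ p ∈ t, ∀ q ∈ t, u p - u q ≤ D t) :
    energy 1 Ω₁ u u ≤ discArea / (4 * κ ^ 2) * ∑ t ∈ hM.tri.cells Ω₁, D t ^ 2 := by
  have hh := hU.h_pos
  have hκ := hU.κ_pos
  have hV := discArea_pos
  rw [hM.energy_eq_sum 1 hu hu, one_mul, Finset.mul_sum]
  refine Finset.sum_le_sum fun t ht => ?_
  have htc := hM.tri.mem_cells.1 ht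
  have h1 := hU.norm_slope_mul_le htc.1 hu (hD t htc)
  have h2 := hU.measureReal_cell_le htc.1
  rw [real_inner_self_eq_norm_sq]
  have h3 : ‖slope u t‖ ^ 2 * (4 * κ ^ 2 * h ^ 2) ≤ D t ^ 2 := by
    have := pow_le_pow_left₀ (by positivity) h1 2
    nlinarith
  -- Area is of order h² and slope of order D/h, so h cancels: the energy is scale invariant in the
  -- plane.
  calc volume.real (cell t) * ‖slope u t‖ ^ 2 ≤ h ^ 2 * discArea * ‖slope u t‖ ^ 2 := by gcongr
    _ = discArea / (4 * κ ^ 2) * (‖slope u t‖ ^ 2 * (4 * κ ^ 2 * h ^ 2)) := by field_simp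
    _ ≤ _ := by gcongr

/-- The nodal extension of the interface values by zero. -/
theorem IsFittedMesh.exists_zero_extension (hM : IsFittedMesh Ω Ω₁ Ω₂ K)
    (hU : IsUniformMesh K h κ) {w : Plane → ℝ} (hw : w ∈ spaceW K Ω) :
    ∃ w' ∈ spaceW K Ω, EqOn w' w (interface Ω₁ Ω₂) ∧ energy 1 Ω₁ w' w' ≤
      3 * discArea / κ ^ 2 *
        ∑ t ∈ hM.tri.cells Ω₁, ∑ p ∈ t, (interface Ω₁ Ω₂).indicator w p ^ 2 := by
  set val := (interface Ω₁ Ω₂).indicator w with hval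
  obtain ⟨w', hw', hv⟩ := hM.tri.exists_interpolant hM.dec.domain val fun p hp => by
    rw [hval, indicator_apply_eq_zero]
    exact fun _ => hw.2 p hp
  refine ⟨w', hw', hM.eqOn_interface hw' hw fun t ht p hp hpΓ => ?_, ?_⟩
  · rw [hv t ht p hp, hval, indicator_of_mem hpΓ]
  · refine (hM.energy_le hU hw'.1 (D := fun t => 2 * ∑ p ∈ t, |val p|)
      fun t ht p hp q hq => ?_).trans ?_
    · rw [hv t ht.1 p hp, hv t ht.1 q hq]
      have h1 := Finset.single_le_sum (f := fun p => |val p|) (fun i _ => abs_nonneg _) hp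
      have h2 := Finset.single_le_sum (f := fun p => |val p|) (fun i _ => abs_nonneg _) hq
      have h3 := le_abs_self (val p)
      have h4 := neg_abs_le (val q)
      linarith
    · rw [Finset.mul_sum, Finset.mul_sum]
      refine Finset.sum_le_sum fun t ht => ?_
      have h1 := sq_sum_le_card_mul_sum_sq (s := t) (f := fun p => |val p|)
      rw [(hM.tri.mem_cells.1 ht).1.2] at h1
      simp only [sq_abs] at h1
      have hκ := hU.κ_pos
      have hV := discArea_pos
      calc discArea / (4 * κ ^ 2) * (2 * ∑ p ∈ t, |val p|) ^ 2
          = discArea / κ ^ 2 * (∑ p ∈ t, |val p|) ^ 2 := by field_simp; ring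
        _ ≤ discArea / κ ^ 2 * ((3 : ℕ) * ∑ p ∈ t, val p ^ 2) := by gcongr
        _ = _ := by push_cast; ring

/-- The inverse inequality for the trace space. -/
theorem IsDecomposition.exists_inverse_inequality (hdec : IsDecomposition Ω Ω₁ Ω₂)
    (hκ : 0 < κ) :
    ∃ C > (0 : ℝ), ∀ K h, IsFittedMesh Ω Ω₁ Ω₂ K → IsUniformMesh K h κ → ∀ w ∈ spaceW K Ω,
      (∀ t ∈ triangles K, ∀ p ∈ t, p ∈ interface Ω₁ Ω₂ →
        w p ^ 2 ≤ 2 / (κ * h) * pairing (interface Ω₁ Ω₂) w w) ∧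
      ∃ w' ∈ spaceW K Ω, EqOn w' w (interface Ω₁ Ω₂) ∧
        energy 1 Ω₁ w' w' ≤ C * h⁻¹ * pairing (interface Ω₁ Ω₂) w w := by
  classical
  have hV := discArea_pos
  refine ⟨3 * discArea / κ ^ 2 * (2 / κ * (3 * ((1 + 1) / κ) ^ 2)) + 1, by positivity,
    fun K h hM hU w hw => ?_⟩
  have hh := hU.h_pos
  set μ : Measure Plane := Measure.hausdorffMeasure 1 with hμ
  set Γ := interface Ω₁ Ω₂ with hΓ
  have hint : IntegrableOn (fun x => w x * w x) Γ μ :=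
    hdec.integrableOn_interface (hw.1.1.mul hw.1.1).continuousOn
  -- Each vertex value is charged to a set `E` of interface points within distance h. It is an
  -- interface edge at p if the value is nonzero, since then p lies in Ω and `exists_edge` applies;
  -- otherwise `E` is empty. The factor 2/(κh) is 4 over the minimal edge length 2κh.
  have hE : ∀ p, (∃ t ∈ triangles K, p ∈ t) → ∃ E : Set Plane, IsClosed E ∧ E ⊆ Γ ∧
      (∀ x ∈ E, dist x p ≤ h) ∧
      Γ.indicator w p ^ 2 ≤ 2 / (κ * h) * ∫ x in E, w x * w x ∂μ := by
    rintro p ⟨t, ht, hpt⟩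
    by_cases h0 : Γ.indicator w p = 0
    · exact ⟨∅, isClosed_empty, empty_subset _, fun x hx => hx.elim, by simp [h0]⟩
    · have hpΓ : p ∈ Γ := mem_of_indicator_ne_zero h0
      rw [indicator_of_mem hpΓ] at h0 ⊢
      have hpΩ : p ∈ Ω := by
        by_contra hpΩ
        exact h0 (hw.2 p hpΩ)
      obtain ⟨t₁, ht₁, -, -, q, hqp, hp1, hq1, -, -, hseg⟩ := hM.exists_edge ht hpt hpΓ hpΩ
      have hsub : segment ℝ p q ⊆ cell t₁ :=
        (convex_cell t₁).segment_subset (mem_cell_of_mem hp1) (mem_cell_of_mem hq1)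
      refine ⟨segment ℝ p q, ?_, hseg, fun x hx =>
        hU.dist_le t₁ ht₁.1 x (hsub hx) p (mem_cell_of_mem hp1), ?_⟩
      · rw [← convexHull_pair]
        exact ((Set.toFinite {p, q}).isCompact_convexHull ℝ).isClosed
      · have h1 := sq_le_setIntegral_segment (p := p) (q := q) hw.1.1 fun τ hτ => by
          have hmem : AffineMap.lineMap p q τ ∈ cell t₁ := hsub (by
            rw [segment_eq_image_lineMap]; exact mem_image_of_mem _ hτ)
          have e1 := sub_eq_inner_slope hw.1 ht₁.1 hmem (mem_cell_of_mem hp1)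
          have e2 := sub_eq_inner_slope hw.1 ht₁.1 (mem_cell_of_mem hq1) (mem_cell_of_mem hp1)
          rw [AffineMap.lineMap_apply, vsub_eq_sub, vadd_eq_add, add_sub_cancel_right,
            inner_smul_right, ← e2] at e1
          rw [AffineMap.lineMap_apply, vsub_eq_sub, vadd_eq_add]
          linarith
        have h2 := hU.le_dist ht₁.1 hp1 hq1 hqp.symm
        have h3 := mul_le_mul_of_nonneg_right h2 (sq_nonneg (w p))
        rw [div_mul_eq_mul_div, le_div_iff₀ (by positivity)]
        linarith
  refine ⟨fun t ht p hp hpΓ => ?_, ?_⟩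
  · obtain ⟨E, -, hEΓ, -, hle⟩ := hE p ⟨t, ht, hp⟩
    rw [indicator_of_mem hpΓ] at hle
    refine hle.trans (mul_le_mul_of_nonneg_left ?_ (by positivity))
    exact setIntegral_mono_set hint (Filter.Eventually.of_forall fun x => mul_self_nonneg _)
      (Filter.Eventually.of_forall hEΓ)
  obtain ⟨w', hw', hww', hen⟩ := hM.exists_zero_extension hU hw
  refine ⟨w', hw', hww', hen.trans ?_⟩
  choose! E hEc hEΓ hEd hEle using hE
  have hsum : ∑ t ∈ hM.tri.cells Ω₁, ∑ p ∈ t, Γ.indicator w p ^ 2 ≤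
      2 / (κ * h) * (3 * ((1 + 1) / κ) ^ 2 * pairing Γ w w) := by
    have hmem : ∀ t ∈ hM.tri.cells Ω₁, ∀ p ∈ t, ∃ t ∈ triangles K, p ∈ t := fun t ht p hp =>
      ⟨t, (hM.tri.mem_cells.1 ht).1, hp⟩
    have hind : ∀ p, (∃ t ∈ triangles K, p ∈ t) →
        IntegrableOn ((E p).indicator fun x => w x * w x) Γ μ := fun p hp =>
      hint.indicator (hEc p hp).measurableSet
    calc ∑ t ∈ hM.tri.cells Ω₁, ∑ p ∈ t, Γ.indicator w p ^ 2
        ≤ ∑ t ∈ hM.tri.cells Ω₁, ∑ p ∈ t,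
          2 / (κ * h) * ∫ x in Γ, (E p).indicator (fun x => w x * w x) x ∂μ := by
          refine Finset.sum_le_sum fun t ht => Finset.sum_le_sum fun p hp => ?_
          have hp' := hmem t ht p hp
          rw [setIntegral_indicator (hEc p hp').measurableSet, inter_eq_right.2 (hEΓ p hp')]
          exact hEle p hp'
      _ = 2 / (κ * h) * ∫ x in Γ, ∑ t ∈ hM.tri.cells Ω₁, ∑ p ∈ t,
            (E p).indicator (fun x => w x * w x) x ∂μ := by
          rw [integral_finsetSum _ fun t ht => integrable_finsetSum _ fun p hp =>
            hind p (hmem t ht p hp), Finset.mul_sum]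
          refine Finset.sum_congr rfl fun t ht => ?_
          rw [integral_finsetSum _ fun p hp => hind p (hmem t ht p hp), Finset.mul_sum]
      _ ≤ 2 / (κ * h) * ∫ x in Γ, 3 * ((1 + 1) / κ) ^ 2 * (w x * w x) ∂μ := by
          refine mul_le_mul_of_nonneg_left ?_ (by positivity)
          refine setIntegral_mono_on (integrable_finsetSum _ fun t ht =>
            integrable_finsetSum _ fun p hp => hind p (hmem t ht p hp)) (hint.const_mul _)
            hdec.isClosed_interface.measurableSet fun x _ => ?_
          -- A point x of the interface is charged only by vertices of triangles meeting the disc of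
          -- radius h about x; their number is bounded, with three vertices each.
          have hS := hU.card_le x zero_le_one
            ((hM.tri.cells Ω₁).filter fun t => (cell t ∩ Metric.closedBall x (1 * h)).Nonempty)
            fun t ht => ⟨(hM.tri.mem_cells.1 (Finset.mem_filter.1 ht).1).1,
              (Finset.mem_filter.1 ht).2⟩
          have hx0 := mul_self_nonneg (w x)
          calc ∑ t ∈ hM.tri.cells Ω₁, ∑ p ∈ t, (E p).indicator (fun x => w x * w x) x
              ≤ ∑ t ∈ hM.tri.cells Ω₁,
                if (cell t ∩ Metric.closedBall x (1 * h)).Nonempty then 3 * (w x * w x) else 0 := by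
                refine Finset.sum_le_sum fun t ht => ?_
                split_ifs with hne
                · have h3 : (t.card : ℝ) = 3 := by
                    rw [(hM.tri.mem_cells.1 ht).1.2]; norm_num
                  rw [← h3, ← nsmul_eq_mul]
                  exact Finset.sum_le_card_nsmul _ _ _ fun p _ => indicator_le_self' (fun _ _ => hx0) x
                · refine (Finset.sum_eq_zero fun p hp => ?_).le
                  refine indicator_of_notMem (fun hxE => hne ⟨p, mem_cell_of_mem hp, ?_⟩) _
                  rw [Metric.mem_closedBall, dist_comm, one_mul]
                  exact hEd p (hmem t ht p hp) x hxE
            _ = _ * (3 * (w x * w x)) := by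
                rw [← Finset.sum_filter, Finset.sum_const, nsmul_eq_mul]
            _ ≤ ((1 + 1) / κ) ^ 2 * (3 * (w x * w x)) :=
                mul_le_mul_of_nonneg_right hS (by positivity)
            _ = _ := by ring
      _ = _ := by rw [integral_const_mul]; rfl
  have hp0 : 0 ≤ pairing Γ w w := integral_nonneg fun x => mul_self_nonneg _
  calc 3 * discArea / κ ^ 2 * ∑ t ∈ hM.tri.cells Ω₁, ∑ p ∈ t, Γ.indicator w p ^ 2
      ≤ 3 * discArea / κ ^ 2 * (2 / (κ * h) * (3 * ((1 + 1) / κ) ^ 2 * pairing Γ w w)) := by gcongr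
    _ = 3 * discArea / κ ^ 2 * (2 / κ * (3 * ((1 + 1) / κ) ^ 2)) * h⁻¹ * pairing Γ w w := by
        field_simp
    _ ≤ _ := by
        have : 0 ≤ h⁻¹ * pairing Γ w w := by positivity
        nlinarith

/-- The sum of the absolute values at the vertices. -/
def vertexSum (w : Plane → ℝ) (t : Finset Plane) : ℝ := ∑ p ∈ t, |w p|

theorem vertexSum_nonneg (w : Plane → ℝ) (t : Finset Plane) : 0 ≤ vertexSum w t :=
  Finset.sum_nonneg fun _ _ => abs_nonneg _

theorem abs_le_vertexSum {w : Plane → ℝ} (hw : w ∈ piecewiseAffine K) {t : Finset Plane}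
    (ht : t ∈ triangles K) {x : Plane} (hx : x ∈ cell t) : |w x| ≤ vertexSum w t := by
  obtain ⟨A, hA⟩ := hw.2 t ht
  have hT := isTriangle ht
  rw [hA hx, hT.affine_apply A]
  refine (Finset.abs_sum_le_sum_abs _ _).trans (Finset.sum_le_sum fun p hp => ?_)
  have h0 := hT.mem_cell_iff.1 hx p hp
  have h1 : hT.bary p x ≤ 1 := by
    rw [← hT.sum_bary x]
    exact Finset.single_le_sum (f := fun p => hT.bary p x) (fun i hi => hT.mem_cell_iff.1 hx i hi) hp
  rw [abs_mul, abs_of_nonneg h0, hA (mem_cell_of_mem hp)]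
  exact mul_le_of_le_one_left (abs_nonneg _) h1

theorem IsUniformMesh.le_of_subset_closedBall (hU : IsUniformMesh K h κ) {t : Finset Plane}
    (ht : t ∈ triangles K) {x : Plane} {R : ℝ} (hsub : cell t ⊆ Metric.closedBall x R) :
    h ≤ R / κ := by
  have hκ := hU.κ_pos
  have hh := hU.h_pos
  obtain ⟨c, hc⟩ := hU.incircle t ht
  have hR : 0 ≤ R := dist_nonneg.trans (hsub (hc (Metric.mem_closedBall_self (by positivity))))
  have h1 := Metric.diam_mono (hc.trans hsub) Metric.isBounded_closedBall
  rw [Metric.diam_closedBall_eq c (by positivity), Metric.diam_closedBall_eq x hR] at h1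
  rw [le_div_iff₀ hκ]
  linarith

/-- The discrete Poincaré inequality. -/
theorem IsDecomposition.exists_discrete_poincare (hdec : IsDecomposition Ω Ω₁ Ω₂)
    (hκ : 0 < κ) :
    ∃ C > (0 : ℝ), ∀ K h, IsFittedMesh Ω Ω₁ Ω₂ K → IsUniformMesh K h κ → ∀ w ∈ spaceW K Ω,
      ∀ S : Finset (Finset Plane), (∀ t ∈ S, t ∈ cellsIn K Ω₁) →
      ∑ t ∈ S, (h * vertexSum w t) ^ 2 ≤ C * energy 1 Ω₁ w w ∧
      ∑ t ∈ S, (h * ‖slope w t‖) ^ 2 ≤ C * energy 1 Ω₁ w w := by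
  classical
  have hV := discArea_pos
  obtain ⟨CP, hCP, hP⟩ := hdec.exists_poincare
  obtain ⟨R, hR⟩ := hdec.domain.isCompact_closure.isBounded.subset_closedBall 0
  set c := κ ^ 2 * discArea with hc
  have hc0 : 0 < c := by positivity
  refine ⟨(18 * CP + 18 * (R / κ) ^ 2 + 1) / c, by positivity, fun K h hM hU w hw S hS => ?_⟩
  have hh := hU.h_pos
  set En := energy 1 Ω₁ w w with hEn
  have hEn0 : 0 ≤ En := hM.energy_one_nonneg hw.1
  have harea : ∀ t ∈ S, c * h ^ 2 ≤ volume.real (cell t) := fun t ht => by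
    have := hU.le_measureReal_cell (hS t ht).1
    rw [hc]
    linarith
  have hslope : ∑ t ∈ S, volume.real (cell t) * ‖slope w t‖ ^ 2 ≤ En := by
    rw [hEn, hM.energy_eq_sum 1 hw.1 hw.1, one_mul]
    simp only [real_inner_self_eq_norm_sq]
    refine Finset.sum_le_sum_of_subset_of_nonneg (fun t ht => hM.tri.mem_cells.2 (hS t ht))
      fun t _ _ => by positivity
  have hslope' : c * ∑ t ∈ S, (h * ‖slope w t‖) ^ 2 ≤ En := by
    rw [Finset.mul_sum]
    refine (Finset.sum_le_sum fun t ht => ?_).trans hslope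
    have := mul_le_mul_of_nonneg_right (harea t ht) (sq_nonneg ‖slope w t‖)
    linarith
  constructor
  · have hint : IntegrableOn (fun x => w x ^ 2) (closure Ω₁) :=
      (hw.1.1.pow 2).continuousOn.integrableOn_compact hdec.domain₁.isCompact_closure
    have hPr : ∫ x in closure Ω₁, w x ^ 2 ≤ CP * En := by
      rw [integral_eq_lintegral_of_nonneg_ae (Filter.Eventually.of_forall fun x => sq_nonneg _)
        (hw.1.1.pow 2).aestronglyMeasurable]
      refine ENNReal.toReal_le_of_le_ofReal (by positivity) (le_trans ?_ (hP K hM w hw))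
      refine lintegral_mono fun x => ?_
      rw [Real.enorm_eq_ofReal_abs, ← ENNReal.ofReal_pow (abs_nonneg _), sq_abs]
    have hfin : ∀ t : Finset Plane, volume (interior (cell t)) ≠ ∞ := fun t =>
      ((measure_mono interior_subset).trans_lt (volume_cell_lt_top t)).ne
    have hisub : ∀ t ∈ S, interior (cell t) ⊆ closure Ω₁ := fun t ht =>
      (hS t ht).2.trans subset_closure
    -- Vertex values differ from w(x) by at most h times the slope. The factor 18 is 3² for the
    -- three vertices times 2 for the square of a sum.
    have hloc : ∀ t ∈ S, volume.real (cell t) * vertexSum w t ^ 2 ≤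
        18 * (∫ x in interior (cell t), w x ^ 2) +
          18 * (h ^ 2 * (volume.real (cell t) * ‖slope w t‖ ^ 2)) := by
      intro t ht
      have hpt : ∀ x ∈ interior (cell t), vertexSum w t ^ 2 ≤
          18 * w x ^ 2 + 18 * (h * ‖slope w t‖) ^ 2 := by
        intro x hx
        have h1 : ∀ p ∈ t, |w p| ≤ |w x| + h * ‖slope w t‖ := fun p hp => by
          have e1 := sub_eq_inner_slope hw.1 (hS t ht).1 (mem_cell_of_mem hp) (interior_subset hx)
          have e2 := abs_real_inner_le_norm (slope w t) (p - x)
          rw [← e1, ← dist_eq_norm] at e2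
          have e3 := hU.dist_le t (hS t ht).1 p (mem_cell_of_mem hp) x (interior_subset hx)
          have e4 := abs_sub_abs_le_abs_sub (w p) (w x)
          have e5 := mul_le_mul_of_nonneg_left e3 (norm_nonneg (slope w t))
          linarith
        have h2 : vertexSum w t ≤ 3 * (|w x| + h * ‖slope w t‖) := by
          refine (Finset.sum_le_card_nsmul _ _ _ h1).trans_eq ?_
          rw [(hS t ht).1.2, nsmul_eq_mul]
          norm_num
        have h3 := pow_le_pow_left₀ (vertexSum_nonneg w t) h2 2
        have h4 := sq_nonneg (|w x| - h * ‖slope w t‖)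
        have h5 := sq_abs (w x)
        nlinarith
      have hi := hint.mono_set (hisub t ht)
      have hmono := setIntegral_mono_on (integrableOn_const (hfin t))
        ((hi.const_mul 18).add (integrableOn_const (C := 18 * (h * ‖slope w t‖) ^ 2) (hfin t)))
        isOpen_interior.measurableSet hpt
      simp only [Pi.add_apply] at hmono
      rw [integral_add (hi.const_mul 18) (integrableOn_const (hfin t)), setIntegral_const,
        setIntegral_const, integral_const_mul, smul_eq_mul, smul_eq_mul,
        measureReal_congr (interior_cell_ae_eq t)] at hmono
      refine hmono.trans_eq ?_
      ring
    have hsumint : ∑ t ∈ S, ∫ x in interior (cell t), w x ^ 2 ≤ CP * En := by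
      rw [← integral_biUnion_finset S (fun t _ => isOpen_interior.measurableSet)
        (fun t ht t' ht' hne => disjoint_interior_cell (hS t ht).1 (hS t' ht').1 hne)
        fun t ht => hint.mono_set (hisub t ht)]
      refine (setIntegral_mono_set hint (Filter.Eventually.of_forall fun x => sq_nonneg _)
        (Filter.Eventually.of_forall (iUnion₂_subset hisub))).trans hPr
    have hsum := Finset.sum_le_sum hloc
    rw [Finset.sum_add_distrib, ← Finset.mul_sum, ← Finset.mul_sum, ← Finset.mul_sum] at hsum
    have hleft : c * ∑ t ∈ S, (h * vertexSum w t) ^ 2 ≤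
        ∑ t ∈ S, volume.real (cell t) * vertexSum w t ^ 2 := by
      rw [Finset.mul_sum]
      refine Finset.sum_le_sum fun t ht => ?_
      have := mul_le_mul_of_nonneg_right (harea t ht) (sq_nonneg (vertexSum w t))
      linarith
    rw [div_mul_eq_mul_div, le_div_iff₀ hc0]
    rcases S.eq_empty_or_nonempty with rfl | ⟨t, ht⟩
    · simp only [Finset.sum_empty, zero_mul]
      positivity
    -- The slope term still carries h², which the size of Ω bounds: an inscribed disc of radius κh
    -- fits into a disc of radius R.
    · have hhR := hU.le_of_subset_closedBall (hS t ht).1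
        ((hM.tri.cell_subset (hS t ht).1).trans hR)
      have hhR2 := pow_le_pow_left₀ hh.le hhR 2
      have h6 := mul_le_mul hhR2 hslope (Finset.sum_nonneg fun t _ => by positivity) (by positivity)
      linarith
  · rw [div_mul_eq_mul_div, le_div_iff₀ hc0]
    have : 0 ≤ (18 * CP + 18 * (R / κ) ^ 2) * En := by positivity
    linarith

end Extension

end RobinRobin

namespace RobinRobin

/-! ### Reflection in the boundary and the discrete extension theorem -/

/-- A Lipschitz involution exchanging, locally, the two sides of a Lipschitz boundary. -/
theorem IsPolygonalDomain.exists_reflection {Ω : Set Plane} (hΩ : IsPolygonalDomain Ω) {x : Plane}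
    (hx : x ∈ frontier Ω) : ∃ (r : ℝ) (Λ : ℝ≥0) (Φ : Plane → Plane), 0 < r ∧ LipschitzWith Λ Φ ∧
      (∀ y, Φ (Φ y) = y) ∧ (∀ y ∈ Metric.ball x r, y ∈ closure Ω → Φ y ∉ Ω) ∧
      ∀ y ∈ Metric.ball x r, y ∈ frontier Ω → Φ y = y := by
  obtain ⟨e, r, L, φ, hr, hφ, hg⟩ := hΩ.lipschitz x hx
  have hn : ∀ i, ‖e i‖ = 1 := e.orthonormal.1
  have hlip : ∀ i, LipschitzWith 1 fun y : Plane => inner ℝ (e i) y := fun i =>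
    LipschitzWith.of_dist_le_mul fun y z => by
      rw [Real.dist_eq, ← inner_sub_right, dist_eq_norm]
      simpa [hn] using abs_real_inner_le_norm (e i) (y - z)
  -- The reflection keeps the first coordinate and sends the second coordinate s to 2φ - s,
  -- exchanging the two sides of the graph.
  set ψ : Plane → ℝ := fun y => 2 * (φ (inner ℝ (e 0) y) - inner ℝ (e 1) y) with hψ
  set Φ : Plane → Plane := fun y => y + ψ y • e 1 with hΦ
  have hψl : LipschitzWith (2 * (L * 1 + 1)) ψ := by
    have h1 := (hφ.comp (hlip 0)).sub (hlip 1)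
    refine LipschitzWith.of_dist_le_mul fun y z => ?_
    have := h1.dist_le_mul y z
    rw [Real.dist_eq] at this ⊢
    simp only [Function.comp_apply] at this
    rw [hψ]
    simp only
    rw [← mul_sub, abs_mul, abs_two, NNReal.coe_mul, NNReal.coe_two, mul_assoc]
    linarith
  have hΦl : LipschitzWith (1 + 2 * (L * 1 + 1)) Φ := by
    refine LipschitzWith.id.add (LipschitzWith.of_dist_le_mul fun y z => ?_)
    rw [dist_eq_norm, ← sub_smul, norm_smul, hn, mul_one, ← dist_eq_norm]
    exact hψl.dist_le_mul y z
  have h0 : ∀ y, inner ℝ (e 0) (Φ y) = inner ℝ (e 0) y := fun y =>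
    (inner_basis_add_smul e y _).1
  have h1 : ∀ y, inner ℝ (e 1) (Φ y) = inner ℝ (e 1) y + ψ y := fun y =>
    (inner_basis_add_smul e y _).2
  have hψΦ : ∀ y, ψ (Φ y) = -ψ y := fun y => by
    simp only [hψ] at *
    rw [h0, h1]
    ring
  have hΦf : ∀ y ∈ Metric.ball x r, y ∈ frontier Ω → Φ y = y := fun y hy hyf => by
    have := (frontier_eq_graph hφ.continuous hg hy).1 hyf
    simp [hΦ, hψ, this]
  have hxx : Φ x = x := hΦf x (Metric.mem_ball_self hr) hx
  have hΛ : (0 : ℝ) < ((1 + 2 * (L * 1 + 1) : ℝ≥0) : ℝ) := by positivity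
  have hΛ1 : (1 : ℝ) ≤ ((1 + 2 * (L * 1 + 1) : ℝ≥0) : ℝ) := by
    push_cast
    have := L.coe_nonneg
    linarith
  have hrr : r / ((1 + 2 * (L * 1 + 1) : ℝ≥0) : ℝ) ≤ r := div_le_self hr.le hΛ1
  -- The radius is divided by the Lipschitz constant so that reflected points remain in the ball
  -- where the graph describes Ω.
  refine ⟨r / ((1 + 2 * (L * 1 + 1) : ℝ≥0) : ℝ), _, Φ, by positivity, hΦl, fun y => ?_,
    fun y hy hyc => ?_, fun y hy hyf => hΦf y (Metric.ball_subset_ball hrr hy) hyf⟩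
  · change Φ y + ψ (Φ y) • e 1 = y
    rw [hψΦ]
    change y + ψ y • e 1 + (-ψ y) • e 1 = y
    rw [neg_smul, add_neg_cancel_right]
  · have hyr := Metric.ball_subset_ball hrr hy
    have hΦr : Φ y ∈ Metric.ball x r := by
      have h2 := hΦl.dist_le_mul y x
      rw [hxx] at h2
      rw [Metric.mem_ball] at hy ⊢
      rw [lt_div_iff₀ hΛ] at hy
      linarith
    intro hmem
    have h3 := (hg _ hΦr).1 hmem
    rw [h0, h1] at h3
    have h4 : φ (inner ℝ (e 0) y) ≤ inner ℝ (e 1) y := by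
      by_cases hyΩ : y ∈ Ω
      · exact ((hg y hyr).1 hyΩ).le
      · exact ((frontier_eq_graph hφ.continuous hg hyr).1
          ⟨hyc, fun hi => hyΩ (interior_subset hi)⟩).ge
    simp only [hψ] at h3
    linarith

/-- A Lipschitz partition of unity on the boundary with local reflections. -/
theorem IsPolygonalDomain.exists_reflections {Ω : Set Plane} (hΩ : IsPolygonalDomain Ω) :
    ∃ (J : Finset Plane) (χ : Plane → Plane → ℝ) (Φ : Plane → Plane → Plane) (Λ : ℝ≥0) (δ : ℝ),
      0 < δ ∧ (∀ j ∈ J, LipschitzWith Λ (χ j) ∧ LipschitzWith Λ (Φ j) ∧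
        (∀ y, Φ j (Φ j y) = y) ∧ (∀ y, 0 ≤ χ j y ∧ χ j y ≤ 1) ∧
        (∀ y ∈ closure Ω, ∀ z, χ j z ≠ 0 → dist y z ≤ δ → Φ j y ∉ Ω) ∧
        ∀ y ∈ frontier Ω, χ j y ≠ 0 → Φ j y = y) ∧
      ∀ y ∈ frontier Ω, ∑ j ∈ J, χ j y = 1 := by
  classical
  choose! r Λ Φ hr hΛ hinv hside hfix using fun x hx => hΩ.exists_reflection (x := x) hx
  obtain ⟨J, hJ, hcov⟩ := (hΩ.isCompact_closure.of_isClosed_subset isClosed_frontier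
    frontier_subset_closure).elim_nhds_subcover (fun x => Metric.ball x (r x / 2))
    (fun x hx => Metric.ball_mem_nhds x (half_pos (hr x hx)))
  obtain ⟨f, hf⟩ := SmoothPartitionOfUnity.exists_isSubordinate
    (modelWithCornersSelf ℝ Plane) (isClosed_frontier (s := Ω))
    (fun j : J => Metric.ball (j : Plane) (r j / 2)) (fun j => Metric.isOpen_ball)
    (fun y hy => by
      obtain ⟨x, hx, hyx⟩ := mem_iUnion₂.1 (hcov hy)
      exact mem_iUnion.2 ⟨⟨x, hx⟩, hyx⟩)
  have hLf : ∀ j : J, ∃ C, LipschitzWith C (f j) := fun j => by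
    have hcs : HasCompactSupport (f j) :=
      (isCompact_closedBall (j : Plane) (r j / 2)).of_isClosed_subset (isClosed_tsupport _)
        ((hf j).trans Metric.ball_subset_closedBall)
    exact ContDiff.lipschitzWith_of_hasCompactSupport hcs ((f j).contMDiff.contDiff) (by simp)
  choose Cf hCf using hLf
  let χ : Plane → Plane → ℝ := fun j => if hj : j ∈ J then f ⟨j, hj⟩ else 0
  have hχ : ∀ j (hj : j ∈ J), χ j = f ⟨j, hj⟩ := fun j hj => by simp only [χ, dif_pos hj]
  have hsupp : ∀ j ∈ J, ∀ y, χ j y ≠ 0 → dist y j < r j / 2 := fun j hj y hy => by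
    rw [hχ j hj] at hy
    exact hf ⟨j, hj⟩ (subset_tsupport _ hy)
  -- The cut-offs live in balls of half the chart radius, so every point within δ of a support is
  -- still in the chart ball.
  obtain ⟨δ, hδ, hδr⟩ : ∃ δ > 0, ∀ j ∈ J, δ ≤ r j / 2 := by
    rcases J.eq_empty_or_nonempty with rfl | hne
    · exact ⟨1, one_pos, by simp⟩
    · refine ⟨J.inf' hne fun j => r j / 2, ?_, fun j hj => Finset.inf'_le _ hj⟩
      rw [gt_iff_lt, Finset.lt_inf'_iff]
      exact fun j hj => half_pos (hr j (hJ j hj))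
  refine ⟨J, χ, Φ, (∑ j : J, Cf j) + ∑ j ∈ J, Λ j, δ, hδ, fun j hj => ⟨?_, ?_, hinv j (hJ j hj),
    fun y => ?_, fun y hy z hz hyz => ?_, fun y hy hy0 => ?_⟩, fun y hy => ?_⟩
  · rw [hχ j hj]
    refine (hCf ⟨j, hj⟩).weaken ?_
    exact (Finset.single_le_sum (f := Cf) (fun _ _ => zero_le) (Finset.mem_univ _)).trans
      le_self_add
  · exact (hΛ j (hJ j hj)).weaken
      ((Finset.single_le_sum (f := Λ) (fun _ _ => zero_le) hj).trans le_add_self)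
  · rw [hχ j hj]
    exact ⟨f.nonneg _ _, f.le_one _ _⟩
  · refine hside j (hJ j hj) y ?_ hy
    have h1 := hsupp j hj z hz
    have h2 := hδr j hj
    rw [Metric.mem_ball]
    linarith [dist_triangle y z j]
  · refine hfix j (hJ j hj) y ?_ hy
    have h1 := hsupp j hj y hy0
    have h2 := hr j (hJ j hj)
    rw [Metric.mem_ball]
    linarith
  · have h1 := f.sum_eq_one hy
    rw [finsum_eq_sum_of_fintype] at h1
    rw [← h1, ← Finset.sum_attach]
    exact Finset.sum_congr rfl fun j _ => by rw [hχ j j.2]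

section Extension

variable {Ω Ω₁ Ω₂ : Set Plane} {K : Geometry.SimplicialComplex ℝ Plane} {h κ : ℝ}

/-- Along a connected set avoiding `Ω₁`, the variation of a finite element function is controlled by
the triangles of `Ω₂` met by the set. -/
theorem IsFittedMesh.abs_sub_le_of_isPreconnected (hM : IsFittedMesh Ω Ω₁ Ω₂ K)
    (hU : IsUniformMesh K h κ) {w : Plane → ℝ} (hw : w ∈ spaceW K Ω) {P : Set Plane}
    (hP : IsPreconnected P) (hPΩ : ∀ x ∈ P, x ∉ Ω₁) {N : Finset (Finset Plane)}
    (hN : ∀ t ∈ cellsIn K Ω₂, (cell t ∩ P).Nonempty → t ∈ N) (hNt : ∀ t ∈ N, t ∈ triangles K)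
    {a b : Plane} (ha : a ∈ P) (hb : b ∈ P) :
    |w a - w b| ≤ ∑ t ∈ N, h * ‖slope w t‖ := by
  -- The image of a connected set contains the interval between two of its values; off Ω the only
  -- value is 0, and the rest is covered by images of triangles of Ω₂.
  have hcov : uIcc (w b) (w a) ⊆ {0} ∪ ⋃ t ∈ N, w '' cell t := by
    have h1 : uIcc (w b) (w a) ⊆ w '' P :=
      (hP.image w hw.1.1.continuousOn).ordConnected.uIcc_subset (mem_image_of_mem _ hb)
        (mem_image_of_mem _ ha)
    refine h1.trans ?_
    rintro _ ⟨x, hx, rfl⟩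
    by_cases hΩ : x ∈ Ω
    · obtain ⟨t, ht, hxt⟩ := hM.symm.exists_mem_cellsIn
        (hM.dec.mem_closure₂_of_notMem hΩ (hPΩ x hx))
      exact Or.inr (mem_iUnion₂.2 ⟨t, hN t ht ⟨x, hxt, hx⟩, mem_image_of_mem _ hxt⟩)
    · exact Or.inl (hw.2 x hΩ)
  have hvol : ∀ t ∈ N, volume (w '' cell t) ≤ ENNReal.ofReal (h * ‖slope w t‖) := by
    intro t ht
    refine (Real.volume_le_diam _).trans (Metric.ediam_le ?_)
    rintro _ ⟨x, hx, rfl⟩ _ ⟨y, hy, rfl⟩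
    rw [edist_dist, Real.dist_eq, sub_eq_inner_slope hw.1 (hNt t ht) hx hy]
    refine ENNReal.ofReal_le_ofReal ((abs_real_inner_le_norm _ _).trans ?_)
    rw [← dist_eq_norm, mul_comm]
    exact mul_le_mul_of_nonneg_right (hU.dist_le t (hNt t ht) x hx y hy) (norm_nonneg _)
  have hh := hU.h_pos
  have hfin : ENNReal.ofReal |w a - w b| ≤ ENNReal.ofReal (∑ t ∈ N, h * ‖slope w t‖) := by
    calc ENNReal.ofReal |w a - w b| = volume (uIcc (w b) (w a)) := Real.volume_interval.symm
      _ ≤ volume ({0} ∪ ⋃ t ∈ N, w '' cell t) := measure_mono hcov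
      _ ≤ volume {0} + volume (⋃ t ∈ N, w '' cell t) := measure_union_le _ _
      _ = volume (⋃ t ∈ N, w '' cell t) := by rw [Real.volume_singleton, zero_add]
      _ ≤ ∑ t ∈ N, volume (w '' cell t) := measure_biUnion_finset_le _ _
      _ ≤ ∑ t ∈ N, ENNReal.ofReal (h * ‖slope w t‖) := Finset.sum_le_sum hvol
      _ = _ := (ENNReal.ofReal_sum_of_nonneg fun t _ => by positivity).symm
  exact (ENNReal.ofReal_le_ofReal_iff (Finset.sum_nonneg fun t _ => by positivity)).1 hfin

/-- Double counting. -/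
theorem sum_sum_filter_le {α : Type*} (A B : Finset α) (R : α → α → Prop)
    [∀ a b, Decidable (R a b)] {N : ℝ} (hN : ∀ b ∈ B, ((A.filter fun a => R a b).card : ℝ) ≤ N)
    {X : α → ℝ} (hX : ∀ b ∈ B, 0 ≤ X b) :
    ∑ a ∈ A, ∑ b ∈ B.filter (R a), X b ≤ N * ∑ b ∈ B, X b := by
  simp only [Finset.sum_filter]
  rw [Finset.sum_comm, Finset.mul_sum]
  refine Finset.sum_le_sum fun b hb => ?_
  rw [← Finset.sum_filter, Finset.sum_const, nsmul_eq_mul]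
  exact mul_le_mul_of_nonneg_right (hN b hb) (hX b hb)

/-- The discrete extension theorem on coarse meshes. -/
theorem IsDecomposition.exists_extension_coarse (hdec : IsDecomposition Ω Ω₁ Ω₂)
    (hκ : 0 < κ) {δ : ℝ} (hδ : 0 < δ) :
    ∃ C > (0 : ℝ), ∀ K h, IsFittedMesh Ω Ω₁ Ω₂ K → IsUniformMesh K h κ → δ ≤ h →
      ∀ w ∈ spaceW K Ω, ∃ w' ∈ spaceW K Ω, EqOn w' w (interface Ω₁ Ω₂) ∧
        energy 1 Ω₁ w' w' ≤ C * energy 1 Ω₂ w w := by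
  classical
  have hV := discArea_pos
  obtain ⟨CP, hCP, hP⟩ := hdec.symm.exists_discrete_poincare hκ
  refine ⟨3 * discArea / κ ^ 2 * (3 * (((1 + 1) / κ) ^ 2 * ((δ ^ 2)⁻¹ * CP))), by positivity,
    fun K h hM hU hδh w hw => ?_⟩
  have hh := hU.h_pos
  obtain ⟨w', hw', hww', hen⟩ := hM.exists_zero_extension hU hw
  refine ⟨w', hw', hww', hen.trans ?_⟩
  rw [mul_assoc]
  refine mul_le_mul_of_nonneg_left ?_ (by positivity)
  set R : Finset Plane → Finset Plane → Prop := fun t t' => (cell t ∩ cell t').Nonempty with hR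
  -- An interface vertex also lies in a triangle of Ω₂, whose vertex values bound it. Since h ≥ δ,
  -- the discrete Poincaré inequality then controls these values without the weight h.
  have h1 : ∀ t ∈ hM.tri.cells Ω₁, ∑ p ∈ t, (interface Ω₁ Ω₂).indicator w p ^ 2 ≤
      3 * ∑ t' ∈ (hM.tri.cells Ω₂).filter (R t), vertexSum w t' ^ 2 := by
    intro t ht
    have h3 : (t.card : ℝ) = 3 := by rw [(hM.tri.mem_cells.1 ht).1.2]; norm_num
    rw [← h3, ← nsmul_eq_mul]
    refine Finset.sum_le_card_nsmul _ _ _ fun p hp => ?_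
    by_cases hpΓ : p ∈ interface Ω₁ Ω₂
    · rw [indicator_of_mem hpΓ]
      obtain ⟨t', ht', hpt'⟩ := hM.symm.exists_mem_cellsIn (hM.dec.interface_subset_closure₂ hpΓ)
      refine le_trans ?_ (Finset.single_le_sum (f := fun t' => vertexSum w t' ^ 2)
        (fun _ _ => sq_nonneg _) (Finset.mem_filter.2 ⟨hM.tri.mem_cells.2 ht', p,
          mem_cell_of_mem hp, hpt'⟩))
      rw [← sq_abs]
      exact pow_le_pow_left₀ (abs_nonneg _) (abs_le_vertexSum hw.1 ht'.1 hpt') 2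
    · rw [indicator_of_notMem hpΓ, sq, zero_mul]
      exact Finset.sum_nonneg fun _ _ => sq_nonneg _
  refine (Finset.sum_le_sum h1).trans ?_
  rw [← Finset.mul_sum, mul_assoc]
  refine mul_le_mul_of_nonneg_left ?_ (by norm_num)
  refine (sum_sum_filter_le (hM.tri.cells Ω₁) (hM.tri.cells Ω₂) R (N := ((1 + 1) / κ) ^ 2)
    (fun t' ht' => ?_) fun _ _ => sq_nonneg _).trans ?_
  · have ht'' := (hM.tri.mem_cells.1 ht').1
    obtain ⟨p, hp⟩ : t'.Nonempty := Finset.card_pos.1 (by rw [ht''.2]; norm_num)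
    refine hU.card_le p zero_le_one _ fun t ht => ?_
    obtain ⟨ht1, y, hy, hy'⟩ := Finset.mem_filter.1 ht
    refine ⟨(hM.tri.mem_cells.1 ht1).1, y, hy, ?_⟩
    rw [Metric.mem_closedBall, one_mul]
    exact hU.dist_le t' ht'' y hy' p (mem_cell_of_mem hp)
  · rw [mul_assoc, mul_assoc]
    refine mul_le_mul_of_nonneg_left ?_ (by positivity)
    rw [inv_mul_eq_div, le_div_iff₀ (by positivity)]
    refine le_trans ?_ (hP K h hM.symm hU w hw (hM.tri.cells Ω₂)
      fun t ht => hM.tri.mem_cells.1 ht).1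
    rw [Finset.sum_mul]
    refine Finset.sum_le_sum fun t _ => ?_
    have := mul_le_mul_of_nonneg_left (pow_le_pow_left₀ hδ.le hδh 2) (sq_nonneg (vertexSum w t))
    linarith

/-- The discrete extension theorem on fine meshes. -/
theorem IsDecomposition.exists_extension_fine (hdec : IsDecomposition Ω Ω₁ Ω₂) (hκ : 0 < κ) :
    ∃ δ > (0 : ℝ), ∃ C > (0 : ℝ), ∀ K h, IsFittedMesh Ω Ω₁ Ω₂ K → IsUniformMesh K h κ → h ≤ δ →
      ∀ w ∈ spaceW K Ω, ∃ w' ∈ spaceW K Ω, EqOn w' w (interface Ω₁ Ω₂) ∧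
        energy 1 Ω₁ w' w' ≤ C * energy 1 Ω₂ w w := by
  classical
  have hV := discArea_pos
  obtain ⟨J, χ, Φ, Λ, δ, hδ, hJ, hsum⟩ := hdec.domain₁.exists_reflections
  obtain ⟨CP, hCP, hP⟩ := hdec.symm.exists_discrete_poincare hκ
  set n : ℝ := (((Λ : ℝ) + 1) / κ) ^ 2 with hn
  have hn0 : 0 ≤ n := sq_nonneg _
  set C : ℝ := discArea / (4 * κ ^ 2) * (J.card * (n * (J.card * (n * ((2 * (Λ : ℝ) ^ 2 + 2) *
    CP))))) with hC
  have hC0 : 0 ≤ C := by positivity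
  refine ⟨δ, hδ, C + 1, by positivity, fun K h hM hU hhδ w hw => ?_⟩
  have hh := hU.h_pos
  have hE0 : 0 ≤ energy 1 Ω₂ w w := hM.symm.energy_one_nonneg hw.1
  -- Vertices of Ω₁ take averaged reflected values of w; all other vertices, in particular those on
  -- the interface, keep the value of w.
  let val : Plane → ℝ := fun q => if q ∈ Ω₁ then ∑ j ∈ J, χ j q * w (Φ j q) else w q
  obtain ⟨w', hw', hval⟩ := hM.tri.exists_interpolant hdec.domain val fun p hp => by
    simp only [val, if_neg fun h1 => hp (hdec.subset₁ h1)]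
    exact hw.2 p hp
  have hvalf : ∀ q, q ∉ Ω₁ → val q = w q := fun q hq => by simp only [val, if_neg hq]
  refine ⟨w', hw', hM.eqOn_interface hw' hw fun t ht p hp hpΓ => ?_, ?_⟩
  · rw [hval t ht p hp, hvalf p fun h1 => hpΓ.1.2 (by rwa [hdec.domain₁.isOpen.interior_eq])]
  set N : Plane → Finset Plane → Finset (Finset Plane) := fun j t =>
    (hM.tri.cells Ω₂).filter fun t' => (cell t' ∩ Φ j '' cell t).Nonempty with hN
  set Y : Finset Plane → ℝ := fun t' => Λ * (h * vertexSum w t') + h * ‖slope w t'‖ with hY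
  have hY0 : ∀ t', 0 ≤ Y t' := fun t' => by
    have := vertexSum_nonneg w t'
    positivity
  have hnt : ∀ t ∈ triangles K, t.Nonempty := fun t ht =>
    Finset.card_pos.1 (by rw [ht.2]; norm_num)
  -- The averaged formula also holds at boundary vertices of Ω₁, because the active reflections fix
  -- them and the cut-offs sum to 1.
  have hv : ∀ t ∈ cellsIn K Ω₁, ∀ p ∈ t, w' p = ∑ j ∈ J, χ j p * w (Φ j p) := by
    intro t ht p hp
    rw [hval t ht.1 p hp]
    by_cases hpΩ : p ∈ Ω₁
    · simp only [val, if_pos hpΩ]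
    · have hpf : p ∈ frontier Ω₁ := ⟨cell_subset_closure ht (mem_cell_of_mem hp),
        fun hi => hpΩ (interior_subset hi)⟩
      rw [hvalf p hpΩ, ← one_mul (w p), ← hsum p hpf, Finset.sum_mul]
      refine Finset.sum_congr rfl fun j hj => ?_
      by_cases h0 : χ j p = 0
      · rw [h0, zero_mul, zero_mul]
      · rw [(hJ j hj).2.2.2.2.2 p hpf h0]
  have hD : ∀ t ∈ cellsIn K Ω₁, ∀ p ∈ t, ∀ q ∈ t,
      w' p - w' q ≤ ∑ j ∈ J, ∑ t' ∈ N j t, Y t' := by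
    intro t ht p hp q hq
    rw [hv t ht p hp, hv t ht q hq, ← Finset.sum_sub_distrib]
    refine Finset.sum_le_sum fun j hj => ?_
    obtain ⟨hχl, hΦl, -, h01, hside, -⟩ := hJ j hj
    have hpc := mem_cell_of_mem hp
    have hqc := mem_cell_of_mem hq
    by_cases h0 : χ j p = 0 ∧ χ j q = 0
    · rw [h0.1, h0.2, zero_mul, zero_mul, sub_zero]
      exact Finset.sum_nonneg fun _ _ => hY0 _
    have hz : ∃ z ∈ cell t, χ j z ≠ 0 := by
      by_cases h1 : χ j p = 0
      · exact ⟨q, hqc, fun h2 => h0 ⟨h1, h2⟩⟩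
      · exact ⟨p, hpc, h1⟩
    obtain ⟨z, hz, hz0⟩ := hz
    -- Here h ≤ δ is used: a triangle touching the support of the cut-off lies entirely in the
    -- chart, and its reflection leaves Ω₁.
    have hPΩ : ∀ x ∈ Φ j '' cell t, x ∉ Ω₁ := by
      rintro _ ⟨y, hy, rfl⟩
      exact hside y (cell_subset_closure ht hy) z hz0 ((hU.dist_le t ht.1 y hy z hz).trans hhδ)
    have hNmem : ∀ t' ∈ cellsIn K Ω₂, (cell t' ∩ Φ j '' cell t).Nonempty → t' ∈ N j t :=
      fun t' ht' hne => Finset.mem_filter.2 ⟨hM.tri.mem_cells.2 ht', hne⟩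
    have hNt : ∀ t' ∈ N j t, t' ∈ triangles K := fun t' ht' =>
      (hM.tri.mem_cells.1 (Finset.mem_filter.1 ht').1).1
    have h1 := hM.abs_sub_le_of_isPreconnected hU hw
      ((convex_cell t).isPreconnected.image _ hΦl.continuous.continuousOn) hPΩ hNmem hNt
      (mem_image_of_mem _ hpc) (mem_image_of_mem _ hqc)
    have h2 : |w (Φ j q)| ≤ ∑ t' ∈ N j t, vertexSum w t' := by
      by_cases hΩq : Φ j q ∈ Ω
      · obtain ⟨t', ht', hqt'⟩ := hM.symm.exists_mem_cellsIn
          (hdec.mem_closure₂_of_notMem hΩq (hPΩ _ (mem_image_of_mem _ hqc)))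
        exact (abs_le_vertexSum hw.1 ht'.1 hqt').trans (Finset.single_le_sum
          (f := fun t' => vertexSum w t') (fun _ _ => vertexSum_nonneg _ _)
          (hNmem t' ht' ⟨_, hqt', mem_image_of_mem _ hqc⟩))
      · rw [hw.2 _ hΩq, abs_zero]
        exact Finset.sum_nonneg fun _ _ => vertexSum_nonneg _ _
    have h3 : |χ j p - χ j q| ≤ Λ * h := by
      rw [← Real.dist_eq]
      exact (hχl.dist_le_mul p q).trans (mul_le_mul_of_nonneg_left
        (hU.dist_le t ht.1 p hpc q hqc) Λ.2)
    have hsplit : ∑ t' ∈ N j t, Y t' = Λ * h * (∑ t' ∈ N j t, vertexSum w t') +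
        ∑ t' ∈ N j t, h * ‖slope w t'‖ := by
      rw [Finset.mul_sum, ← Finset.sum_add_distrib]
      exact Finset.sum_congr rfl fun _ _ => by simp only [hY]; ring
    -- Discrete product rule. The variation of the cut-off gives the h-weighted vertex values, the
    -- variation of w along the connected image of the triangle gives the slopes.
    have h4 : χ j p * w (Φ j p) - χ j q * w (Φ j q) =
        (χ j p - χ j q) * w (Φ j q) + χ j p * (w (Φ j p) - w (Φ j q)) := by ring
    rw [hsplit, h4]
    refine (le_abs_self _).trans ((abs_add_le _ _).trans (add_le_add ?_ ?_))
    · rw [abs_mul]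
      exact mul_le_mul h3 h2 (abs_nonneg _) (mul_nonneg Λ.2 hh.le)
    · rw [abs_mul, abs_of_nonneg (h01 p).1]
      exact (mul_le_of_le_one_left (abs_nonneg _) (h01 p).2).trans h1
  have hcard : ∀ j ∈ J, ∀ t ∈ hM.tri.cells Ω₁, ((N j t).card : ℝ) ≤ n := by
    intro j hj t ht
    have ht' := (hM.tri.mem_cells.1 ht).1
    obtain ⟨p, hp⟩ := hnt t ht'
    refine hU.card_le (Φ j p) Λ.2 _ fun t' ht'' => ?_
    obtain ⟨h1, x, hx, y, hy, rfl⟩ := Finset.mem_filter.1 ht''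
    refine ⟨(hM.tri.mem_cells.1 h1).1, _, hx, ?_⟩
    exact ((hJ j hj).2.1.dist_le_mul y p).trans (mul_le_mul_of_nonneg_left
      (hU.dist_le t ht' y hy p (mem_cell_of_mem hp)) Λ.2)
  -- The same count in the other direction; since the reflection is an involution, its inverse is
  -- Lipschitz too.
  have hcard' : ∀ j ∈ J, ∀ t' ∈ hM.tri.cells Ω₂, (((hM.tri.cells Ω₁).filter fun t =>
      (cell t' ∩ Φ j '' cell t).Nonempty).card : ℝ) ≤ n := by
    intro j hj t' ht'
    have ht'' := (hM.tri.mem_cells.1 ht').1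
    obtain ⟨p, hp⟩ := hnt t' ht''
    refine hU.card_le (Φ j p) Λ.2 _ fun t ht => ?_
    obtain ⟨h1, x, hx, y, hy, rfl⟩ := Finset.mem_filter.1 ht
    refine ⟨(hM.tri.mem_cells.1 h1).1, y, hy, ?_⟩
    have h2 := (hJ j hj).2.1.dist_le_mul (Φ j y) p
    rw [(hJ j hj).2.2.1 y] at h2
    exact h2.trans (mul_le_mul_of_nonneg_left
      (hU.dist_le t' ht'' _ hx p (mem_cell_of_mem hp)) Λ.2)
  have hYs : ∑ t' ∈ hM.tri.cells Ω₂, Y t' ^ 2 ≤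
      (2 * (Λ : ℝ) ^ 2 + 2) * CP * energy 1 Ω₂ w w := by
    obtain ⟨h1, h2⟩ := hP K h hM.symm hU w hw (hM.tri.cells Ω₂)
      fun t ht => hM.tri.mem_cells.1 ht
    have h3 : ∑ t' ∈ hM.tri.cells Ω₂, Y t' ^ 2 ≤ 2 * (Λ : ℝ) ^ 2 *
        ∑ t' ∈ hM.tri.cells Ω₂, (h * vertexSum w t') ^ 2 +
        2 * ∑ t' ∈ hM.tri.cells Ω₂, (h * ‖slope w t'‖) ^ 2 := by
      rw [Finset.mul_sum, Finset.mul_sum, ← Finset.sum_add_distrib]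
      refine Finset.sum_le_sum fun t' _ => ?_
      simp only [hY]
      have := sq_nonneg (Λ * (h * vertexSum w t') - h * ‖slope w t'‖)
      linarith [add_sq (Λ * (h * vertexSum w t')) (h * ‖slope w t'‖),
        sub_sq (Λ * (h * vertexSum w t')) (h * ‖slope w t'‖),
        mul_pow (Λ : ℝ) (h * vertexSum w t') 2]
    have h4 := mul_le_mul_of_nonneg_left h1 (by positivity : (0 : ℝ) ≤ 2 * (Λ : ℝ) ^ 2)
    linarith
  have hDs : ∑ t ∈ hM.tri.cells Ω₁, (∑ j ∈ J, ∑ t' ∈ N j t, Y t') ^ 2 ≤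
      J.card * (n * (J.card * (n * ((2 * (Λ : ℝ) ^ 2 + 2) * CP * energy 1 Ω₂ w w)))) := by
    calc ∑ t ∈ hM.tri.cells Ω₁, (∑ j ∈ J, ∑ t' ∈ N j t, Y t') ^ 2
        ≤ ∑ t ∈ hM.tri.cells Ω₁, J.card * (n * ∑ j ∈ J, ∑ t' ∈ N j t, Y t' ^ 2) := by
          refine Finset.sum_le_sum fun t ht => sq_sum_le_card_mul_sum_sq.trans ?_
          refine mul_le_mul_of_nonneg_left ?_ (Nat.cast_nonneg _)
          rw [Finset.mul_sum]
          refine Finset.sum_le_sum fun j hj => sq_sum_le_card_mul_sum_sq.trans ?_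
          exact mul_le_mul_of_nonneg_right (hcard j hj t ht)
            (Finset.sum_nonneg fun _ _ => sq_nonneg _)
      _ = J.card * (n * ∑ j ∈ J, ∑ t ∈ hM.tri.cells Ω₁, ∑ t' ∈ N j t, Y t' ^ 2) := by
          rw [← Finset.mul_sum, ← Finset.mul_sum, Finset.sum_comm]
      _ ≤ _ := by
          refine mul_le_mul_of_nonneg_left (mul_le_mul_of_nonneg_left ?_ hn0) (Nat.cast_nonneg _)
          rw [← nsmul_eq_mul]
          refine Finset.sum_le_card_nsmul _ _ _ fun j hj => ?_
          refine (sum_sum_filter_le _ _ (fun t t' => (cell t' ∩ Φ j '' cell t).Nonempty)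
            (hcard' j hj) fun _ _ => sq_nonneg _).trans ?_
          exact mul_le_mul_of_nonneg_left hYs hn0
  have h5 := mul_le_mul_of_nonneg_left hDs (by positivity : 0 ≤ discArea / (4 * κ ^ 2))
  have h6 := hM.energy_le hU hw'.1 hD
  rw [hC]
  linarith

/-- The discrete extension theorem: finite element functions extend across the interface. -/
theorem IsDecomposition.exists_extension (hdec : IsDecomposition Ω Ω₁ Ω₂) (hκ : 0 < κ) :
    ∃ C > (0 : ℝ), ∀ K h, IsFittedMesh Ω Ω₁ Ω₂ K → IsUniformMesh K h κ →
      ∀ w ∈ spaceW K Ω, ∃ w' ∈ spaceW K Ω, EqOn w' w (interface Ω₁ Ω₂) ∧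
        energy 1 Ω₁ w' w' ≤ C * energy 1 Ω₂ w w := by
  obtain ⟨δ, hδ, C, hC, hf⟩ := hdec.exists_extension_fine hκ
  obtain ⟨C', hC', hc⟩ := hdec.exists_extension_coarse hκ hδ
  refine ⟨C + C', by positivity, fun K h hM hU w hw => ?_⟩
  have hE := hM.symm.energy_one_nonneg hw.1
  rcases le_total h δ with hh | hh
  · obtain ⟨w', hw', h1, h2⟩ := hf K h hM hU hh w hw
    exact ⟨w', hw', h1, by nlinarith [mul_nonneg hC'.le hE]⟩
  · obtain ⟨w', hw', h1, h2⟩ := hc K h hM hU hh w hw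
    exact ⟨w', hw', h1, by nlinarith [mul_nonneg hC.le hE]⟩

end Extension

end RobinRobin

namespace RobinRobin

/-! ### The error operator -/

section ErrorOperator

variable {V X₁ X₂ W : Type*} [AddCommGroup V] [Module ℝ V] [AddCommGroup X₁] [Module ℝ X₁]
  [AddCommGroup X₂] [Module ℝ X₂] [AddCommGroup W] [Module ℝ W]

/-- The relation for e₂ turns the second term of G d into (γ₂ + S₂)e₂, so the preconditioner gives
P₄⁻¹G d = d - (γ₁ - S₂)e₂. -/
theorem R4_apply {γ₁ γ₂ : ℝ} {S₁ S₂ : Module.End ℝ V} (h₁ : IsUnit (γ₂ • 1 + S₂))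
    (h₂ : IsUnit (γ₁ • 1 - S₂)) (h₃ : IsUnit (γ₁ • 1 + S₁)) (θ : ℝ) {d e₁ e₂ : V}
    (he₁ : (γ₁ • 1 + S₁) e₁ = d) (he₂ : (γ₂ • 1 + S₂) e₂ = (γ₂ • 1 - S₁) e₁) :
    R4 θ γ₁ γ₂ S₁ S₂ d = θ • (γ₁ • 1 - S₂) e₂ + (1 - θ) • d := by
  have hinv : ∀ {T : Module.End ℝ V}, IsUnit T → ∀ x, Ring.inverse T (T x) = x := fun hT x => by
    rw [← Module.End.mul_apply, Ring.inverse_mul_cancel _ hT, Module.End.one_apply]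
  have hinv' : ∀ {T : Module.End ℝ V}, IsUnit T → ∀ x, T (Ring.inverse T x) = x := fun hT x => by
    rw [← Module.End.mul_apply, Ring.mul_inverse_cancel _ hT, Module.End.one_apply]
  have hG : opG γ₁ γ₂ S₁ S₂ d =
      (γ₂ • 1 + S₂) (Ring.inverse (γ₁ • 1 - S₂) d) - (γ₂ • 1 + S₂) e₂ := by
    rw [he₂]
    conv_rhs => enter [2]; rw [← hinv h₃ e₁, he₁]
    rfl
  have hP : P4inv γ₁ γ₂ S₂ (opG γ₁ γ₂ S₁ S₂ d) = d - (γ₁ • 1 - S₂) e₂ := by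
    rw [hG, P4inv, Module.End.mul_apply, map_sub, hinv h₁, hinv h₁, map_sub, hinv' h₂]
  rw [R4, LinearMap.sub_apply, LinearMap.smul_apply, Module.End.mul_apply, hP,
    Module.End.one_apply, smul_sub, sub_smul, one_smul]
  abel

/-- `g'` results from `g` by a sweep of the algorithm, for abstract forms and loads. -/
def IsAbstractSweep (a₁ : X₁ →ₗ[ℝ] X₁ →ₗ[ℝ] ℝ) (a₂ : X₂ →ₗ[ℝ] X₂ →ₗ[ℝ] ℝ)
    (B : V →ₗ[ℝ] V →ₗ[ℝ] ℝ) (tr₁ : X₁ →ₗ[ℝ] V) (tr₂ : X₂ →ₗ[ℝ] V) (L₁ : X₁ →ₗ[ℝ] ℝ)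
    (L₂ : X₂ →ₗ[ℝ] ℝ) (γ₁ γ₂ θ : ℝ) (g g' : V) : Prop :=
  ∃ u₁ u₂ g₂ gt, (∀ v, a₁ u₁ v + γ₁ * B (tr₁ u₁) (tr₁ v) = L₁ v + B g (tr₁ v)) ∧
    g₂ = (γ₁ + γ₂) • tr₁ u₁ - g ∧
    (∀ v, a₂ u₂ v + γ₂ * B (tr₂ u₂) (tr₂ v) = L₂ v + B g₂ (tr₂ v)) ∧
    gt = (γ₁ + γ₂) • tr₂ u₂ - g₂ ∧ g' = θ • gt + (1 - θ) • g

/-- The residual of the Galerkin solution in the first subdomain vanishes on functions of zero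
trace, because these extend by zero to W (`hext`). It is thus a functional of the trace, and `B`
represents it by the datum gs. Errors relative to u solve source-free Robin problems, to which
`robin_trace` and `R4_apply` apply. -/
theorem exists_error_operator [FiniteDimensional ℝ V] [FiniteDimensional ℝ W]
    {a₁ : X₁ →ₗ[ℝ] X₁ →ₗ[ℝ] ℝ} {a₂ : X₂ →ₗ[ℝ] X₂ →ₗ[ℝ] ℝ} {B : V →ₗ[ℝ] V →ₗ[ℝ] ℝ}
    {tr₁ : X₁ →ₗ[ℝ] V} {tr₂ : X₂ →ₗ[ℝ] V} {ρ₁ : W →ₗ[ℝ] X₁} {ρ₂ : W →ₗ[ℝ] X₂}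
    {S₁ S₂ : Module.End ℝ V} (hS₁ : IsAbstractSchur a₁ B tr₁ S₁)
    (hS₂ : IsAbstractSchur a₂ B tr₂ S₂)
    (hnn₁ : ∀ x, 0 ≤ a₁ x x) (hnn₂ : ∀ x, 0 ≤ a₂ x x)
    (ha₁ : ∀ x, a₁ x x = 0 → x = 0) (ha₂ : ∀ x, a₂ x x = 0 → x = 0)
    (hB : ∀ x, B x x = 0 → x = 0) (htr₁ : Function.Surjective tr₁)
    (htr₂ : Function.Surjective tr₂) (hρ₂ : Function.Surjective ρ₂)
    (hρ : ∀ w, ρ₁ w = 0 → ρ₂ w = 0 → w = 0) (htr : ∀ w, tr₁ (ρ₁ w) = tr₂ (ρ₂ w))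
    (hext : ∀ z, tr₁ z = 0 → ∃ w, ρ₁ w = z ∧ ρ₂ w = 0) {γ₁ γ₂ : ℝ}
    (h₁ : IsUnit (γ₂ • 1 + S₂)) (h₂ : IsUnit (γ₁ • 1 - S₂)) (h₃ : IsUnit (γ₁ • 1 + S₁))
    (θ : ℝ) (L₁ : X₁ →ₗ[ℝ] ℝ) (L₂ : X₂ →ₗ[ℝ] ℝ) :
    ∃ u gs, (∀ v, a₁ (ρ₁ u) (ρ₁ v) + a₂ (ρ₂ u) (ρ₂ v) = L₁ (ρ₁ v) + L₂ (ρ₂ v)) ∧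
      (∀ v, a₁ (ρ₁ u) v + γ₁ * B (tr₁ (ρ₁ u)) (tr₁ v) = L₁ v + B gs (tr₁ v)) ∧
      ∀ g g', IsAbstractSweep a₁ a₂ B tr₁ tr₂ L₁ L₂ γ₁ γ₂ θ g g' ↔
        g' - gs = R4 θ γ₁ γ₂ S₁ S₂ (g - gs) := by
  obtain ⟨u, hu⟩ := exists_riesz (a₁.compl₁₂ ρ₁ ρ₁ + a₂.compl₁₂ ρ₂ ρ₂) (fun w hw => by
    have hw' : a₁ (ρ₁ w) (ρ₁ w) + a₂ (ρ₂ w) (ρ₂ w) = 0 := hw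
    have h1 := hnn₁ (ρ₁ w)
    have h2 := hnn₂ (ρ₂ w)
    exact hρ w (ha₁ _ (by linarith)) (ha₂ _ (by linarith))) (L₁.comp ρ₁ + L₂.comp ρ₂)
  replace hu : ∀ v, a₁ (ρ₁ u) (ρ₁ v) + a₂ (ρ₂ u) (ρ₂ v) = L₁ (ρ₁ v) + L₂ (ρ₂ v) := hu
  obtain ⟨s, hs⟩ := tr₁.exists_rightInverse_of_surjective (LinearMap.range_eq_top.2 htr₁)
  obtain ⟨gs, hgs⟩ := exists_riesz B hB
    ((a₁ (ρ₁ u) + γ₁ • (B (tr₁ (ρ₁ u))).comp tr₁ - L₁).comp s)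
  have hker : ∀ z, tr₁ z = 0 → a₁ (ρ₁ u) z = L₁ z := fun z hz => by
    obtain ⟨w, rfl, hw⟩ := hext z hz
    have h4 := hu w
    rw [hw, map_zero, map_zero] at h4
    linarith
  have hss : ∀ x, tr₁ (s x) = x := fun x => LinearMap.congr_fun hs x
  have hu1 : ∀ v, a₁ (ρ₁ u) v + γ₁ * B (tr₁ (ρ₁ u)) (tr₁ v) = L₁ v + B gs (tr₁ v) := fun v => by
    have h4 := hker (v - s (tr₁ v)) (by rw [map_sub, hss, sub_self])
    have h5 : B gs (tr₁ v) = a₁ (ρ₁ u) (s (tr₁ v)) +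
        γ₁ * B (tr₁ (ρ₁ u)) (tr₁ (s (tr₁ v))) - L₁ (s (tr₁ v)) := hgs (tr₁ v)
    rw [hss] at h5
    simp only [map_sub] at h4
    linarith
  set us := tr₁ (ρ₁ u) with hus
  -- Subtracting the first Robin equation from the Galerkin equation shows that u also solves the
  -- second Robin problem, with the datum the algorithm would transmit.
  have hu2 : ∀ v, a₂ (ρ₂ u) v + γ₂ * B us (tr₂ v) =
      L₂ v + B ((γ₁ + γ₂) • us - gs) (tr₂ v) := fun v => by
    obtain ⟨w, rfl⟩ := hρ₂ v
    have h4 := hu w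
    have h5 := hu1 (ρ₁ w)
    rw [htr w] at h5
    simp only [map_sub, map_smul, LinearMap.sub_apply, LinearMap.smul_apply, smul_eq_mul]
    linarith
  have hfwd : ∀ g g', IsAbstractSweep a₁ a₂ B tr₁ tr₂ L₁ L₂ γ₁ γ₂ θ g g' →
      g' - gs = R4 θ γ₁ γ₂ S₁ S₂ (g - gs) := by
    rintro g g' ⟨u₁, u₂, g₂, gt, hr₁, rfl, hr₂, rfl, rfl⟩
    have e₁ : (γ₁ • 1 + S₁) (tr₁ (u₁ - ρ₁ u)) = g - gs :=
      hS₁.robin_trace ha₁ hB htr₁ fun v => by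
        have h4 := hr₁ v
        have h5 := hu1 v
        simp only [map_sub, LinearMap.sub_apply]
        rw [← hus]
        linarith
    have e₂ : (γ₂ • 1 + S₂) (tr₂ (u₂ - ρ₂ u)) =
        ((γ₁ + γ₂) • tr₁ u₁ - g) - ((γ₁ + γ₂) • us - gs) :=
      hS₂.robin_trace ha₂ hB htr₂ fun v => by
        have h4 := hr₂ v
        have h5 := hu2 v
        rw [map_sub tr₂, ← htr u, ← hus]
        simp only [map_sub, LinearMap.sub_apply] at h4 h5 ⊢
        linarith
    rw [map_sub tr₁, ← hus] at e₁
    rw [map_sub tr₂, ← htr u, ← hus] at e₂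
    rw [R4_apply h₁ h₂ h₃ θ e₁ (e₂ := tr₂ u₂ - us)]
    · have e₃ : (γ₁ • 1 - S₂) (tr₂ u₂ - us) =
          (γ₁ + γ₂) • (tr₂ u₂ - us) - (γ₂ • 1 + S₂) (tr₂ u₂ - us) := by
        simp only [LinearMap.sub_apply, LinearMap.add_apply, LinearMap.smul_apply,
          Module.End.one_apply]
        module
      rw [e₃, e₂]
      module
    · rw [e₂]
      -- The transmitted error is (γ₁ + γ₂)e₁ - d, and d = (γ₁ + S₁)e₁, which leaves (γ₂ - S₁)e₁.
      have e₃ : (γ₂ • 1 - S₁) (tr₁ u₁ - us) =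
          (γ₁ + γ₂) • (tr₁ u₁ - us) - (γ₁ • 1 + S₁) (tr₁ u₁ - us) := by
        simp only [LinearMap.sub_apply, LinearMap.add_apply, LinearMap.smul_apply,
          Module.End.one_apply]
        module
      rw [e₃, e₁]
      module
  refine ⟨u, gs, hu, hu1, fun g g' => ⟨hfwd g g', fun h => ?_⟩⟩
  -- A sweep from g exists, by solving the two error problems; its result obeys the forward
  -- implication and so must be g'.
  obtain ⟨e₁, he₁⟩ := hS₁.exists_robin h₃ (g - gs)
  obtain ⟨e₂, he₂⟩ := hS₂.exists_robin h₁
    (((γ₁ + γ₂) • tr₁ (ρ₁ u + e₁) - g) - ((γ₁ + γ₂) • us - gs))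
  have hsw : IsAbstractSweep a₁ a₂ B tr₁ tr₂ L₁ L₂ γ₁ γ₂ θ g _ :=
    ⟨ρ₁ u + e₁, ρ₂ u + e₂, _, _, fun v => by
      have h4 := he₁ v
      have h5 := hu1 v
      simp only [map_add, map_sub, LinearMap.add_apply, LinearMap.sub_apply] at h4 ⊢
      rw [← hus]
      linarith, rfl, fun v => by
      have h4 := he₂ v
      have h5 := hu2 v
      rw [map_add tr₂, ← htr u, ← hus]
      simp only [map_add, map_sub, LinearMap.add_apply, LinearMap.sub_apply] at h4 h5 ⊢
      linarith, rfl, rfl⟩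
  have h6 := hfwd g _ hsw
  rw [← h, sub_left_inj] at h6
  rwa [h6] at hsw

end ErrorOperator

end RobinRobin

namespace RobinRobin

/-! ### The forms as bilinear maps on the finite element spaces -/

theorem energy_comm (ν : ℝ) (A : Set Plane) (u v : Plane → ℝ) :
    energy ν A u v = energy ν A v u := by
  simp only [energy, real_inner_comm]

theorem pairing_comm (Γ : Set Plane) (u v : Plane → ℝ) : pairing Γ u v = pairing Γ v u := by
  simp only [pairing, mul_comm]

theorem pairing_congr {Γ : Set Plane} (hΓ : IsClosed Γ) {u u' v v' : Plane → ℝ}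
    (hu : EqOn u u' Γ) (hv : EqOn v v' Γ) : pairing Γ u v = pairing Γ u' v' :=
  setIntegral_congr_fun hΓ.measurableSet fun x hx => by simp only [hu hx, hv hx]

theorem load_congr {A : Set Plane} (hA : IsOpen A) (f : Plane → ℝ) {v v' : Plane → ℝ}
    (hv : EqOn v v' A) : load f A v = load f A v' :=
  setIntegral_congr_fun hA.measurableSet fun x hx => by simp only [hv hx]

theorem eqOn_restrictTo (s : Set Plane) (v : Plane → ℝ) : EqOn (restrictTo s v) v s :=
  fun _ hx => indicator_of_mem hx v

theorem restrictTo_eq {s : Set Plane} {u v : Plane → ℝ} (h : EqOn u v s) :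
    restrictTo s u = restrictTo s v := indicator_congr h

theorem exists_mem_spaceW {K : Geometry.SimplicialComplex ℝ Plane} {Ω A : Set Plane}
    {u : Plane → ℝ} (hu : u ∈ subW K Ω A) :
    ∃ w ∈ spaceW K Ω, restrictTo (closure A) w = u ∧ EqOn u w (closure A) := by
  obtain ⟨w, hw, rfl⟩ := hu
  exact ⟨w, hw, rfl, eqOn_restrictTo _ _⟩

/-- Restriction to a subdomain. -/
noncomputable def restrictSub (K : Geometry.SimplicialComplex ℝ Plane) (Ω A : Set Plane) :
    spaceW K Ω →ₗ[ℝ] subW K Ω A :=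
  (restrictTo (closure A)).restrict fun _ hw => Submodule.mem_map_of_mem hw

theorem restrictSub_surjective (K : Geometry.SimplicialComplex ℝ Plane) (Ω A : Set Plane) :
    Function.Surjective (restrictSub K Ω A) := by
  rintro ⟨_, w, hw, rfl⟩
  exact ⟨⟨w, hw⟩, rfl⟩

theorem eqOn_restrictSub {K : Geometry.SimplicialComplex ℝ Plane} {Ω A : Set Plane}
    (w : spaceW K Ω) : EqOn (restrictSub K Ω A w : Plane → ℝ) w (closure A) :=
  eqOn_restrictTo _ _

instance {K : Geometry.SimplicialComplex ℝ Plane} {Ω Γ : Set Plane}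
    [FiniteDimensional ℝ (spaceW K Ω)] : FiniteDimensional ℝ (spaceV K Ω Γ) :=
  inferInstanceAs (FiniteDimensional ℝ ((spaceW K Ω).map (restrictTo Γ)))

instance {K : Geometry.SimplicialComplex ℝ Plane} {Ω A : Set Plane}
    [FiniteDimensional ℝ (spaceW K Ω)] : FiniteDimensional ℝ (subW K Ω A) :=
  inferInstanceAs (FiniteDimensional ℝ ((spaceW K Ω).map (restrictTo (closure A))))

theorem IsTriangulation.finiteDimensional {K : Geometry.SimplicialComplex ℝ Plane} {Ω : Set Plane}
    (h : IsTriangulation K Ω) : FiniteDimensional ℝ (spaceW K Ω) := by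
  have hfin : Finite (⋃ t ∈ triangles K, (t : Set Plane) : Set Plane) :=
    (h.finite_triangles.biUnion fun t _ => t.finite_toSet).to_subtype
  let e : spaceW K Ω →ₗ[ℝ] ((⋃ t ∈ triangles K, (t : Set Plane) : Set Plane) → ℝ) :=
    (LinearMap.funLeft ℝ ℝ Subtype.val).comp (spaceW K Ω).subtype
  refine FiniteDimensional.of_injective e ((injective_iff_map_eq_zero e).2 fun w hw => ?_)
  refine Subtype.ext (funext fun x => ?_)
  by_cases hx : x ∈ Ω
  · obtain ⟨t, ht, hxt⟩ := h.exists_mem_cell (subset_closure hx)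
    obtain ⟨A, hA⟩ := w.2.1.2 t ht
    rw [hA hxt, (isTriangle ht).affine_apply A]
    refine Finset.sum_eq_zero fun p hp => ?_
    have h1 : w.1 p = 0 := congrFun hw ⟨p, mem_iUnion₂.2 ⟨t, ht, hp⟩⟩
    rw [← hA (mem_cell_of_mem hp), h1, mul_zero]
  · exact w.2.2 x hx

namespace IsFittedMesh

variable {Ω Ω₁ Ω₂ Γ : Set Plane} {K : Geometry.SimplicialComplex ℝ Plane}
  (h : IsFittedMesh Ω Ω₁ Ω₂ K) (hΓ : Γ = interface Ω₁ Ω₂)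
include h

theorem energy_add_left (ν : ℝ) {u u' v : Plane → ℝ} (hu : u ∈ piecewiseAffine K)
    (hu' : u' ∈ piecewiseAffine K) (hv : v ∈ piecewiseAffine K) :
    energy ν Ω₁ (u + u') v = energy ν Ω₁ u v + energy ν Ω₁ u' v := by
  rw [h.energy_eq_sum ν (add_mem hu hu') hv, h.energy_eq_sum ν hu hv, h.energy_eq_sum ν hu' hv,
    ← mul_add, ← Finset.sum_add_distrib]
  refine congrArg _ (Finset.sum_congr rfl fun t ht => ?_)
  rw [slope_add hu hu' (h.tri.mem_cells.1 ht).1, inner_add_left, mul_add]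

theorem energy_smul_left (ν c : ℝ) {u v : Plane → ℝ} (hu : u ∈ piecewiseAffine K)
    (hv : v ∈ piecewiseAffine K) : energy ν Ω₁ (c • u) v = c * energy ν Ω₁ u v := by
  rw [h.energy_eq_sum ν ((piecewiseAffine K).smul_mem c hu) hv, h.energy_eq_sum ν hu hv,
    mul_left_comm, Finset.mul_sum (a := c)]
  refine congrArg _ (Finset.sum_congr rfl fun t ht => ?_)
  rw [slope_smul c hu (h.tri.mem_cells.1 ht).1, inner_smul_left, conj_trivial]
  ring

theorem energy_congr_closure (ν : ℝ) {u u' v v' : Plane → ℝ} (hu : EqOn u u' (closure Ω₁))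
    (hv : EqOn v v' (closure Ω₁)) : energy ν Ω₁ u v = energy ν Ω₁ u' v' :=
  energy_congr h.dec.domain₁.isOpen ν (hu.mono subset_closure) (hv.mono subset_closure)

theorem exists_energy_form (ν : ℝ) : ∃ a : subW K Ω Ω₁ →ₗ[ℝ] subW K Ω Ω₁ →ₗ[ℝ] ℝ,
    ∀ u v, a u v = energy ν Ω₁ u v := by
  have hadd : ∀ u u' v : subW K Ω Ω₁, energy ν Ω₁ (u + u' : subW K Ω Ω₁) v =
      energy ν Ω₁ u v + energy ν Ω₁ u' v := fun u u' v => by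
    obtain ⟨w, hw, -, hu⟩ := exists_mem_spaceW u.2
    obtain ⟨w', hw', -, hu'⟩ := exists_mem_spaceW u'.2
    obtain ⟨z, hz, -, hv⟩ := exists_mem_spaceW v.2
    rw [h.energy_congr_closure ν hu hv, h.energy_congr_closure ν hu' hv,
      ← h.energy_add_left ν hw.1 hw'.1 hz.1]
    exact h.energy_congr_closure ν (fun x hx => by simp [hu hx, hu' hx]) hv
  have hsmul : ∀ (c : ℝ) (u v : subW K Ω Ω₁), energy ν Ω₁ (c • u : subW K Ω Ω₁) v =
      c * energy ν Ω₁ u v := fun c u v => by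
    obtain ⟨w, hw, -, hu⟩ := exists_mem_spaceW u.2
    obtain ⟨z, hz, -, hv⟩ := exists_mem_spaceW v.2
    rw [h.energy_congr_closure ν hu hv, ← h.energy_smul_left ν c hw.1 hz.1]
    exact h.energy_congr_closure ν (fun x hx => by simp [hu hx]) hv
  exact ⟨LinearMap.mk₂ ℝ (fun u v => energy ν Ω₁ u v) hadd hsmul
    (fun u v v' => by rw [energy_comm, hadd, energy_comm, energy_comm ν Ω₁ v'])
    (fun c u v => by rw [energy_comm, hsmul, energy_comm, smul_eq_mul]), fun _ _ => rfl⟩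

theorem energy_nonneg {ν : ℝ} (hν : 0 < ν) (u : subW K Ω Ω₁) : 0 ≤ energy ν Ω₁ u u := by
  obtain ⟨w, hw, -, hu⟩ := exists_mem_spaceW u.2
  rw [h.energy_congr_closure ν hu hu, energy_eq_mul]
  exact mul_nonneg hν.le (h.energy_one_nonneg hw.1)

theorem eq_zero_of_energy {ν : ℝ} (hν : 0 < ν) (u : subW K Ω Ω₁) (hu0 : energy ν Ω₁ u u = 0) :
    u = 0 := by
  obtain ⟨w, hw, hwu, hu⟩ := exists_mem_spaceW u.2
  rw [h.energy_congr_closure ν hu hu, energy_eq_mul, mul_eq_zero, or_iff_right hν.ne'] at hu0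
  obtain ⟨C, hC, hP⟩ := h.dec.exists_poincare
  have h1 := hP K h w hw
  rw [hu0, mul_zero, ENNReal.ofReal_zero, nonpos_iff_eq_zero,
    lintegral_eq_zero_iff (hw.1.1.enorm.measurable.pow_const 2)] at h1
  have h2 : EqOn w 0 Ω₁ := by
    refine Measure.eqOn_open_of_ae_eq (μ := volume) ?_ h.dec.domain₁.isOpen
      hw.1.1.continuousOn continuousOn_const
    filter_upwards [ae_restrict_of_ae_restrict_of_subset subset_closure h1] with x hx
    simpa using hx
  have h3 : EqOn w 0 (closure Ω₁) := h2.closure hw.1.1 continuous_const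
  refine Subtype.ext ?_
  rw [← hwu, restrictTo_eq h3]
  exact map_zero _

theorem exists_load_form {f : Plane → ℝ} (hf : MemLp f 2 (volume.restrict Ω)) :
    ∃ L : subW K Ω Ω₁ →ₗ[ℝ] ℝ, ∀ v, L v = load f Ω₁ v := by
  have hfin : IsFiniteMeasure ((volume : Measure Plane).restrict Ω) :=
    ⟨by rw [Measure.restrict_apply_univ]; exact h.dec.domain.isBounded.measure_lt_top⟩
  have hf1 : IntegrableOn f Ω₁ := (hf.integrable (by norm_num)).mono_measure
    (Measure.restrict_mono h.dec.subset₁ le_rfl)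
  have hint : ∀ v : subW K Ω Ω₁, IntegrableOn (fun x => f x * v.1 x) Ω₁ := fun v => by
    obtain ⟨w, hw, -, hv⟩ := exists_mem_spaceW v.2
    obtain ⟨C, hC⟩ := h.dec.domain₁.isCompact_closure.exists_bound_of_continuousOn
      hw.1.1.continuousOn
    have hm := h.dec.domain₁.isOpen.measurableSet
    have h1 : IntegrableOn (fun x => f x * w x) Ω₁ :=
      hf1.mul_bdd (c := C) hw.1.1.aestronglyMeasurable
        ((ae_restrict_mem hm).mono fun x hx => hC x (subset_closure hx))
    exact h1.congr_fun (fun x hx => by simp only [hv (subset_closure hx)]) hm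
  refine ⟨{ toFun := fun v => load f Ω₁ v, map_add' := fun u v => ?_,
            map_smul' := fun c v => ?_ }, fun _ => rfl⟩
  · simp only [load]
    rw [← integral_add (hint u) (hint v)]
    exact integral_congr_ae (.of_forall fun x => by simp [mul_add])
  · simp only [load, RingHom.id_apply, smul_eq_mul]
    rw [← integral_const_mul]
    exact integral_congr_ae (.of_forall fun x => by simp [mul_left_comm])

include hΓ

theorem isClosed_of_eq : IsClosed Γ := hΓ ▸ h.dec.isClosed_interface

theorem exists_pairing_form : ∃ B : spaceV K Ω Γ →ₗ[ℝ] spaceV K Ω Γ →ₗ[ℝ] ℝ,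
    ∀ u v, B u v = pairing Γ u v := by
  have hc : ∀ v : spaceV K Ω Γ, ContinuousOn v.1 Γ := fun v => by
    obtain ⟨w, hw, hwv⟩ := v.2
    rw [← hwv]
    exact hw.1.1.continuousOn.congr (eqOn_restrictTo _ _)
  have hint : ∀ u v : spaceV K Ω Γ, IntegrableOn (fun x => u.1 x * v.1 x) Γ
      (Measure.hausdorffMeasure 1 : Measure Plane) := fun u v => by
    have h1 := (hc u).mul (hc v)
    subst hΓ
    exact h.dec.integrableOn_interface h1
  have hadd : ∀ u u' v : spaceV K Ω Γ, pairing Γ (u + u' : spaceV K Ω Γ) v =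
      pairing Γ u v + pairing Γ u' v := fun u u' v => by
    simp only [pairing]
    rw [← integral_add (hint u v) (hint u' v)]
    exact integral_congr_ae (.of_forall fun x => by simp [add_mul])
  have hsmul : ∀ (c : ℝ) (u v : spaceV K Ω Γ), pairing Γ (c • u : spaceV K Ω Γ) v =
      c * pairing Γ u v := fun c u v => by
    simp only [pairing]
    rw [← integral_const_mul]
    exact integral_congr_ae (.of_forall fun x => by simp [mul_assoc])
  exact ⟨LinearMap.mk₂ ℝ (fun u v => pairing Γ u v) hadd hsmul
    (fun u v v' => by rw [pairing_comm, hadd, pairing_comm, pairing_comm Γ v'])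
    (fun c u v => by rw [pairing_comm, hsmul, pairing_comm, smul_eq_mul]), fun _ _ => rfl⟩

/-- A zero integral alone would not exclude nonzero values on parts of the interface of length zero.
The vertex bound of the inverse inequality forces all interface vertex values to vanish, and these
determine the function. -/
theorem pairing_pos {m κ : ℝ} (hU : IsUniformMesh K m κ) (v : spaceV K Ω Γ) (hv : v ≠ 0) :
    0 < pairing Γ v v := by
  refine lt_of_le_of_ne (integral_nonneg fun x => mul_self_nonneg _) fun h0 => hv ?_
  obtain ⟨w, hw, hwv⟩ := v.2
  have hcl := h.isClosed_of_eq hΓ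
  have h1 : pairing Γ w w = 0 := by
    rw [h0, ← hwv]
    exact (pairing_congr hcl (eqOn_restrictTo _ _) (eqOn_restrictTo _ _)).symm
  subst hΓ
  obtain ⟨C, -, hC⟩ := h.dec.exists_inverse_inequality hU.κ_pos
  have h2 : EqOn w 0 (interface Ω₁ Ω₂) := h.eqOn_interface hw (zero_mem _)
    fun t ht p hp hpΓ => by
      have h3 := (hC K m h hU w hw).1 t ht p hp hpΓ
      rw [h1, mul_zero] at h3
      exact pow_eq_zero_iff two_ne_zero |>.1 (le_antisymm h3 (sq_nonneg _))
  refine Subtype.ext ?_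
  rw [← hwv, restrictTo_eq h2]
  exact map_zero _

theorem exists_trace_map : ∃ tr : subW K Ω Ω₁ →ₗ[ℝ] spaceV K Ω Γ, Function.Surjective tr ∧
    ∀ u, (tr u : Plane → ℝ) = restrictTo Γ u := by
  have hsub : Γ ⊆ closure Ω₁ := hΓ ▸ h.dec.interface_subset_closure₁
  have hres : ∀ w, restrictTo Γ (restrictTo (closure Ω₁) w) = restrictTo Γ w := fun w =>
    restrictTo_eq ((eqOn_restrictTo _ w).mono hsub)
  refine ⟨(restrictTo Γ).restrict ?_, ?_, fun _ => rfl⟩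
  · rintro _ ⟨w, hw, rfl⟩
    rw [hres]
    exact Submodule.mem_map_of_mem hw
  · rintro ⟨_, w, hw, rfl⟩
    exact ⟨⟨_, w, hw, rfl⟩, Subtype.ext (hres w)⟩

omit h hΓ in
theorem trace_eq_iff {tr : subW K Ω Ω₁ →ₗ[ℝ] spaceV K Ω Γ}
    (htr : ∀ u, (tr u : Plane → ℝ) = restrictTo Γ u) {u : subW K Ω Ω₁} {v : spaceV K Ω Γ} :
    tr u = v ↔ EqOn u.1 v.1 Γ := by
  rw [Subtype.ext_iff, htr]
  constructor
  · intro hv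
    rw [← hv]
    exact (eqOn_restrictTo _ _).symm
  · intro hv
    obtain ⟨w, hw, hwv⟩ := v.2
    rw [restrictTo_eq hv, ← hwv]
    exact restrictTo_eq (eqOn_restrictTo _ _)

/-- The Dirichlet condition is automatic, since ∂Ω₁ off the interface lies outside Ω; the functions
of W₁ with zero trace contain those of W₁⁰, which gives harmonicity. -/
theorem isSchur_iff {ν : ℝ} {a : subW K Ω Ω₁ →ₗ[ℝ] subW K Ω Ω₁ →ₗ[ℝ] ℝ}
    (ha : ∀ u v, a u v = energy ν Ω₁ u v) {B : spaceV K Ω Γ →ₗ[ℝ] spaceV K Ω Γ →ₗ[ℝ] ℝ}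
    (hB : ∀ u v, B u v = pairing Γ u v) {tr : subW K Ω Ω₁ →ₗ[ℝ] spaceV K Ω Γ}
    (htr : ∀ u, (tr u : Plane → ℝ) = restrictTo Γ u) (S : Module.End ℝ (spaceV K Ω Γ)) :
    IsSchur K Ω Ω₁ Γ ν S ↔ IsAbstractSchur a B tr S := by
  refine forall_congr' fun u => ⟨?_, ?_⟩
  · rintro ⟨w, hw, hS⟩
    refine ⟨⟨w, hw.mem⟩, (trace_eq_iff htr).2 hw.trace, fun z => ?_⟩
    rw [hB, ha]
    exact hS (tr z) z z.2 ((trace_eq_iff htr).1 rfl)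
  · rintro ⟨w, hw, hS⟩
    refine ⟨w, ⟨w.2, fun v hv => ?_, fun x hx => ?_, (trace_eq_iff htr).1 hw⟩,
      fun v z hz hzv => ?_⟩
    · have h1 := hS ⟨v, hv.1⟩
      have h2 : tr ⟨v, hv.1⟩ = 0 := (trace_eq_iff htr).2 fun x hx => hv.2 x (by
        subst hΓ
        exact hx.1)
      rw [h2, map_zero, ha] at h1
      exact h1.symm
    · obtain ⟨w', hw', -, hww'⟩ := exists_mem_spaceW w.2
      rw [hww' hx.1.1]
      subst hΓ
      exact hw'.2 x (h.dec.frontier_diff_subset hx)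
    · rw [← hB, ← ha w ⟨z, hz⟩, ← hS, (trace_eq_iff htr (u := ⟨z, hz⟩)).2 hzv]

/-- A function of `W₁` vanishing on the interface extends by zero. -/
theorem mem_spaceW_of_eqOn_zero {z : Plane → ℝ} (hz : z ∈ subW K Ω Ω₁) (hz0 : EqOn z 0 Γ) :
    z ∈ spaceW K Ω ∧ restrictTo (closure Ω₁) z = z ∧ EqOn z 0 (closure Ω₂) := by
  subst hΓ
  obtain ⟨w, hw, rfl, hzw⟩ := exists_mem_spaceW hz
  have h0 : EqOn (restrictTo (closure Ω₁) w) 0 (closure Ω₂) := fun x hx => by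
    by_cases hx1 : x ∈ closure Ω₁
    · exact hz0 (h.dec.closure_inter_closure ▸ ⟨hx1, hx⟩)
    · exact indicator_of_notMem hx1 w
  refine ⟨⟨⟨?_, fun t ht => ?_⟩, fun x hx => ?_⟩, restrictTo_eq hzw, h0⟩
  · refine continuous_indicator (fun x hx => ?_) hw.1.1.continuousOn
    have hxf := frontier_closure_subset hx
    by_cases hxΩ : x ∈ Ω
    · have h1 := h.dec.mem_of_frontier hxf hxΩ
      rw [← hzw h1.1.1]
      exact hz0 h1
    · exact hw.2 x hxΩ
  · rcases h.mem_cellsIn_or ht with h1 | h1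
    · obtain ⟨A, hA⟩ := hw.1.2 t ht
      exact ⟨A, (hzw.mono (cell_subset_closure h1)).trans hA⟩
    · exact ⟨0, h0.mono (cell_subset_closure h1)⟩
  · by_cases hx1 : x ∈ closure Ω₁
    · rw [hzw hx1]
      exact hw.2 x hx
    · exact indicator_of_notMem hx1 w

end IsFittedMesh

end RobinRobin

/-! ### Transfer of the abstract results to the finite element spaces. -/

namespace RobinRobin

theorem spectralRadius_le_of_spectrum_subset {A : Type*} [Ring A] [Algebra ℂ A] {T : A} {a b m : ℝ}
    (hT : spectrum ℂ T ⊆ (fun t : ℝ => (t : ℂ)) '' Icc a b) (ha : -m ≤ a) (hb : b ≤ m) :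
    spectralRadius ℂ T ≤ ENNReal.ofReal m := by
  refine iSup₂_le fun z hz => ?_
  obtain ⟨t, ht, rfl⟩ := hT hz
  rw [← enorm_eq_nnnorm, ← ofReal_norm, Complex.norm_real, Real.norm_eq_abs]
  exact ENNReal.ofReal_le_ofReal (abs_le.2 ⟨ha.trans ht.1, ht.2.trans hb⟩)

theorem eq_iff_forall_mem {K : Geometry.SimplicialComplex ℝ Plane} {Ω Γ : Set Plane}
    {u v : spaceV K Ω Γ} : u = v ↔ EqOn u.1 v.1 Γ := by
  refine ⟨fun h => h ▸ eqOn_refl _ _, fun h => Subtype.ext ?_⟩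
  obtain ⟨w, hw, hwu⟩ := u.2
  obtain ⟨w', hw', hwv⟩ := v.2
  rw [← hwu, ← hwv] at h ⊢
  exact restrictTo_eq ((eqOn_restrictTo Γ w).symm.trans (h.trans (eqOn_restrictTo Γ w')))

/-- The forms, loads and traces on one subdomain. -/
structure IsSubdomainForm (K : Geometry.SimplicialComplex ℝ Plane) (Ω Ωi Γ : Set Plane) (ν : ℝ)
    (B : spaceV K Ω Γ →ₗ[ℝ] spaceV K Ω Γ →ₗ[ℝ] ℝ)
    (a : subW K Ω Ωi →ₗ[ℝ] subW K Ω Ωi →ₗ[ℝ] ℝ) (tr : subW K Ω Ωi →ₗ[ℝ] spaceV K Ω Γ) :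
    Prop where
  form : ∀ u v, a u v = energy ν Ωi u v
  pairing : ∀ u v, B u v = pairing Γ u v
  trace : ∀ u, (tr u : Plane → ℝ) = restrictTo Γ u
  surjective : Function.Surjective tr

section Subdomain

variable {Ω Ω₁ Ω₂ Γ : Set Plane} {K : Geometry.SimplicialComplex ℝ Plane} {ν : ℝ}
  {B : spaceV K Ω Γ →ₗ[ℝ] spaceV K Ω Γ →ₗ[ℝ] ℝ}
  {a : subW K Ω Ω₁ →ₗ[ℝ] subW K Ω Ω₁ →ₗ[ℝ] ℝ} {tr : subW K Ω Ω₁ →ₗ[ℝ] spaceV K Ω Γ}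

theorem IsFittedMesh.exists_isSubdomainForm (h : IsFittedMesh Ω Ω₁ Ω₂ K)
    (hΓ : Γ = interface Ω₁ Ω₂) (ν : ℝ) (hB : ∀ u v, B u v = pairing Γ u v) :
    ∃ a tr, IsSubdomainForm K Ω Ω₁ Γ ν B a tr := by
  obtain ⟨a, ha⟩ := h.exists_energy_form ν
  obtain ⟨tr, hs, htr⟩ := h.exists_trace_map hΓ
  exact ⟨a, tr, ha, hB, htr, hs⟩

namespace IsSubdomainForm

variable (hF : IsSubdomainForm K Ω Ω₁ Γ ν B a tr)
include hF

theorem eqOn_trace (u : subW K Ω Ω₁) : EqOn (tr u).1 u.1 Γ := by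
  rw [hF.trace]
  exact eqOn_restrictTo _ _

theorem symm (u v : subW K Ω Ω₁) : a u v = a v u := by
  rw [hF.form, hF.form, energy_comm]

theorem nonneg (h : IsFittedMesh Ω Ω₁ Ω₂ K) (hν : 0 < ν) (u : subW K Ω Ω₁) : 0 ≤ a u u := by
  rw [hF.form]
  exact h.energy_nonneg hν u

theorem definite (h : IsFittedMesh Ω Ω₁ Ω₂ K) (hν : 0 < ν) (u : subW K Ω Ω₁) (hu : a u u = 0) :
    u = 0 :=
  h.eq_zero_of_energy hν u (by rw [← hF.form, hu])

theorem restrictSub_eq (h : IsFittedMesh Ω Ω₁ Ω₂ K) (w : spaceW K Ω) :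
    a (restrictSub K Ω Ω₁ w) (restrictSub K Ω Ω₁ w) = ν * energy 1 Ω₁ w w := by
  rw [hF.form, ← IsFittedMesh.energy_eq_mul]
  exact h.energy_congr_closure ν (eqOn_restrictSub w) (eqOn_restrictSub w)

theorem trace_restrictSub (hΓ : Γ ⊆ closure Ω₁) {w : spaceW K Ω} {v : spaceV K Ω Γ} :
    tr (restrictSub K Ω Ω₁ w) = v ↔ EqOn w.1 v.1 Γ := by
  rw [eq_iff_forall_mem]
  have h1 : EqOn (tr (restrictSub K Ω Ω₁ w)).1 w Γ :=
    (hF.eqOn_trace _).trans ((eqOn_restrictSub w).mono hΓ)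
  exact ⟨fun h2 => h1.symm.trans h2, fun h2 => h1.trans h2⟩

theorem satisfiesRobin_iff (h : IsFittedMesh Ω Ω₁ Ω₂ K) (hΓ : Γ = interface Ω₁ Ω₂)
    {f : Plane → ℝ} {L : subW K Ω Ω₁ →ₗ[ℝ] ℝ} (hL : ∀ v, L v = load f Ω₁ v) {γ : ℝ}
    {g : spaceV K Ω Γ} {u : Plane → ℝ} {w : subW K Ω Ω₁} (hu : EqOn u w (closure Ω₁)) :
    SatisfiesRobin K Ω Ω₁ Γ ν γ f g u ↔
      ∀ v, a w v + γ * B (tr w) (tr v) = L v + B g (tr v) := by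
  have hsub : Γ ⊆ closure Ω₁ := hΓ ▸ h.dec.interface_subset_closure₁
  have hcl := h.isClosed_of_eq hΓ
  rw [Subtype.forall]
  refine forall₂_congr fun v hv => ?_
  have h1 := hF.eqOn_trace ⟨v, hv⟩
  rw [hF.form, hF.pairing, hF.pairing, hL, h.energy_congr_closure ν hu (eqOn_refl v _),
    pairing_congr hcl ((hu.mono hsub).trans (hF.eqOn_trace w).symm) h1.symm,
    pairing_congr hcl (eqOn_refl g.1 _) h1.symm]

end IsSubdomainForm

end Subdomain

section Sweep

variable {Ω Ω₁ Ω₂ : Set Plane} {K : Geometry.SimplicialComplex ℝ Plane} {ν₁ ν₂ : ℝ}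
  {B : spaceV K Ω (interface Ω₁ Ω₂) →ₗ[ℝ] spaceV K Ω (interface Ω₁ Ω₂) →ₗ[ℝ] ℝ}
  {a₁ : subW K Ω Ω₁ →ₗ[ℝ] subW K Ω Ω₁ →ₗ[ℝ] ℝ} {a₂ : subW K Ω Ω₂ →ₗ[ℝ] subW K Ω Ω₂ →ₗ[ℝ] ℝ}
  {tr₁ : subW K Ω Ω₁ →ₗ[ℝ] spaceV K Ω (interface Ω₁ Ω₂)}
  {tr₂ : subW K Ω Ω₂ →ₗ[ℝ] spaceV K Ω (interface Ω₁ Ω₂)}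

theorem IsFittedMesh.isSweep_iff (h : IsFittedMesh Ω Ω₁ Ω₂ K)
    (hF₁ : IsSubdomainForm K Ω Ω₁ (interface Ω₁ Ω₂) ν₁ B a₁ tr₁)
    (hF₂ : IsSubdomainForm K Ω Ω₂ (interface Ω₁ Ω₂) ν₂ B a₂ tr₂) {f : Plane → ℝ}
    {L₁ : subW K Ω Ω₁ →ₗ[ℝ] ℝ} (hL₁ : ∀ v, L₁ v = load f Ω₁ v)
    {L₂ : subW K Ω Ω₂ →ₗ[ℝ] ℝ} (hL₂ : ∀ v, L₂ v = load f Ω₂ v) {γ₁ γ₂ θ : ℝ}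
    {g g' : spaceV K Ω (interface Ω₁ Ω₂)} :
    IsSweep K Ω Ω₁ Ω₂ ν₁ ν₂ γ₁ γ₂ θ f g g' ↔
      IsAbstractSweep a₁ a₂ B tr₁ tr₂ L₁ L₂ γ₁ γ₂ θ g g' := by
  have hΓ₂ : interface Ω₁ Ω₂ = interface Ω₂ Ω₁ := (interface_comm Ω₁ Ω₂).symm
  have heq : ∀ {A : Set Plane} {tr : subW K Ω A →ₗ[ℝ] spaceV K Ω (interface Ω₁ Ω₂)}
      {u : subW K Ω A}, EqOn (tr u).1 u.1 (interface Ω₁ Ω₂) →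
      ∀ {c : ℝ} {g₂ g : spaceV K Ω (interface Ω₁ Ω₂)},
      (∀ x ∈ interface Ω₁ Ω₂, g₂.1 x = c * u.1 x - g.1 x) ↔ g₂ = c • tr u - g :=
    fun {A tr u} hu {c g₂ g} => by
      rw [eq_iff_forall_mem]
      refine forall₂_congr fun x hx => ?_
      rw [← hu hx]
      rfl
  constructor
  · rintro ⟨u₁, hu₁, u₂, hu₂, g₂, gt, h1, h2, h3, h4, h5⟩
    exact ⟨⟨u₁, hu₁⟩, ⟨u₂, hu₂⟩, g₂, gt,
      (hF₁.satisfiesRobin_iff h rfl hL₁ (eqOn_refl _ _)).1 h1,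
      (heq (hF₁.eqOn_trace ⟨u₁, hu₁⟩)).1 h2,
      (hF₂.satisfiesRobin_iff h.symm hΓ₂ hL₂ (eqOn_refl _ _)).1 h3,
      (heq (hF₂.eqOn_trace ⟨u₂, hu₂⟩)).1 h4, h5⟩
  · rintro ⟨u₁, u₂, g₂, gt, h1, h2, h3, h4, h5⟩
    exact ⟨u₁, u₁.2, u₂, u₂.2, g₂, gt,
      (hF₁.satisfiesRobin_iff h rfl hL₁ (eqOn_refl _ _)).2 h1,
      (heq (hF₁.eqOn_trace u₁)).2 h2,
      (hF₂.satisfiesRobin_iff h.symm hΓ₂ hL₂ (eqOn_refl _ _)).2 h3,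
      (heq (hF₂.eqOn_trace u₂)).2 h4, h5⟩

theorem IsFittedMesh.exists_error_operator (h : IsFittedMesh Ω Ω₁ Ω₂ K)
    (hF₁ : IsSubdomainForm K Ω Ω₁ (interface Ω₁ Ω₂) ν₁ B a₁ tr₁)
    (hF₂ : IsSubdomainForm K Ω Ω₂ (interface Ω₁ Ω₂) ν₂ B a₂ tr₂) (hν₁ : 0 < ν₁) (hν₂ : 0 < ν₂)
    (hB : ∀ x, B x x = 0 → x = 0) {S₁ S₂ : Module.End ℝ (spaceV K Ω (interface Ω₁ Ω₂))}
    (hS₁ : IsAbstractSchur a₁ B tr₁ S₁) (hS₂ : IsAbstractSchur a₂ B tr₂ S₂) {γ₁ γ₂ : ℝ}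
    (h₁ : IsUnit (γ₂ • 1 + S₂)) (h₂ : IsUnit (γ₁ • 1 - S₂)) (h₃ : IsUnit (γ₁ • 1 + S₁))
    (θ : ℝ) {f : Plane → ℝ} (hf : MemLp f 2 (volume.restrict Ω)) :
    ∃ (u : Plane → ℝ) (gs : spaceV K Ω (interface Ω₁ Ω₂)),
      IsGalerkinSolution K Ω Ω₁ Ω₂ ν₁ ν₂ f u ∧
      SatisfiesRobin K Ω Ω₁ (interface Ω₁ Ω₂) ν₁ γ₁ f gs u ∧
      ∀ g g', IsSweep K Ω Ω₁ Ω₂ ν₁ ν₂ γ₁ γ₂ θ f g g' ↔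
        g' - gs = R4 θ γ₁ γ₂ S₁ S₂ (g - gs) := by
  have := h.tri.finiteDimensional
  obtain ⟨L₁, hL₁⟩ := h.exists_load_form hf
  obtain ⟨L₂, hL₂⟩ := h.symm.exists_load_form hf
  have hsub₁ := h.dec.interface_subset_closure₁
  have hsub₂ := h.dec.interface_subset_closure₂
  obtain ⟨u, gs, hu, hgs, hsw⟩ := RobinRobin.exists_error_operator hS₁ hS₂ (hF₁.nonneg h hν₁)
    (hF₂.nonneg h.symm hν₂) (hF₁.definite h hν₁) (hF₂.definite h.symm hν₂) hB hF₁.surjective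
    hF₂.surjective (restrictSub_surjective K Ω Ω₂) (ρ₁ := restrictSub K Ω Ω₁)
    (fun w h1 h2 => Subtype.ext (funext fun x => by
      by_cases hx : x ∈ Ω
      · rcases h.dec.cover hx with hx1 | hx2
        · rw [← eqOn_restrictSub w hx1, h1]
          rfl
        · rw [← eqOn_restrictSub w hx2, h2]
          rfl
      · exact w.2.2 x hx))
    (fun w => by
      rw [hF₁.trace_restrictSub hsub₁]
      exact ((hF₂.trace_restrictSub hsub₂).1 rfl))
    (fun z hz => by
      have hz0 : EqOn z.1 0 (interface Ω₁ Ω₂) :=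
        (hF₁.eqOn_trace z).symm.trans (by rw [hz]; exact eqOn_refl _ _)
      obtain ⟨hw, h1, h2⟩ := h.mem_spaceW_of_eqOn_zero rfl z.2 hz0
      exact ⟨⟨z, hw⟩, Subtype.ext h1, Subtype.ext ((restrictTo_eq h2).trans (map_zero _))⟩)
    h₁ h₂ h₃ θ L₁ L₂
  refine ⟨u, gs, ⟨u.2, fun v hv => ?_⟩,
    (hF₁.satisfiesRobin_iff h rfl hL₁ (eqOn_restrictSub u).symm).2 hgs, fun g g' => ?_⟩
  · have h1 := hu ⟨v, hv⟩
    have hv₁ := eqOn_restrictSub (A := Ω₁) ⟨v, hv⟩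
    have hv₂ := eqOn_restrictSub (A := Ω₂) ⟨v, hv⟩
    rw [hF₁.form, hF₂.form, hL₁, hL₂, h.energy_congr_closure ν₁ (eqOn_restrictSub u) hv₁,
      h.symm.energy_congr_closure ν₂ (eqOn_restrictSub u) hv₂,
      load_congr h.dec.domain₁.isOpen f (hv₁.mono subset_closure),
      load_congr h.dec.domain₂.isOpen f (hv₂.mono subset_closure)] at h1
    exact h1
  · rw [h.isSweep_iff hF₁ hF₂ hL₁ hL₂]
    exact hsw g g'

end Sweep

end RobinRobin

/-! ### Choice of the constants and conclusion. -/

open RobinRobin in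
theorem mainTheorem5 (Ω Ω₁ Ω₂ : Set RobinRobin.Plane)
    (hΩ : RobinRobin.IsDecomposition Ω Ω₁ Ω₂) (σ : ℝ) :
    ∃ C₀ > (0 : ℝ), ∃ c₀ > (0 : ℝ), ∃ C > (0 : ℝ),
      ∀ K : Geometry.SimplicialComplex ℝ RobinRobin.Plane,
        RobinRobin.IsTriangulation K Ω → RobinRobin.IsRegularQuasiUniform K σ →
        RobinRobin.DoesNotCut (RobinRobin.interface Ω₁ Ω₂) K →
      ∀ ν₁ ν₂ : ℝ, 0 < ν₁ → 0 < ν₂ →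
        -- the Schur complement operators are well defined
        (∃! S₁, RobinRobin.IsSchur K Ω Ω₁ (RobinRobin.interface Ω₁ Ω₂) ν₁ S₁) ∧
        (∃! S₂, RobinRobin.IsSchur K Ω Ω₂ (RobinRobin.interface Ω₁ Ω₂) ν₂ S₂) ∧
        ∀ S₁ S₂ : Module.End ℝ (RobinRobin.spaceV K Ω (RobinRobin.interface Ω₁ Ω₂)),
          RobinRobin.IsSchur K Ω Ω₁ (RobinRobin.interface Ω₁ Ω₂) ν₁ S₁ →
          RobinRobin.IsSchur K Ω Ω₂ (RobinRobin.interface Ω₁ Ω₂) ν₂ S₂ →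
        ∀ γ₁ γ₂ : ℝ, C₀ * ν₂ * (RobinRobin.meshSize K)⁻¹ ≤ γ₁ → 0 < γ₂ → γ₂ ≤ c₀ * ν₁ →
          -- the operators inverted in the preconditioner and in the system are invertible
          IsUnit (γ₂ • 1 + S₂) ∧ IsUnit (γ₁ • 1 - S₂) ∧ IsUnit (γ₁ • 1 + S₁) ∧
          -- every (complex) eigenvalue of the preconditioned operator lies in the interval
          spectrum ℂ (LinearMap.baseChange ℂ
              (RobinRobin.P4inv γ₁ γ₂ S₂ * RobinRobin.opG γ₁ γ₂ S₁ S₂)) ⊆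
            (fun t : ℝ => (t : ℂ)) '' Set.Icc 1 (1 + C * (ν₁ / ν₂)) ∧
          -- convergence rate for the stated relaxation parameter
          ∀ θ : ℝ, θ = 2 / (2 + C * (ν₁ / ν₂)) →
            spectralRadius ℂ (LinearMap.baseChange ℂ (RobinRobin.R4 θ γ₁ γ₂ S₁ S₂)) < 1 ∧
            spectralRadius ℂ (LinearMap.baseChange ℂ (RobinRobin.R4 θ γ₁ γ₂ S₁ S₂)) ≤
              ENNReal.ofReal (C * (ν₁ / ν₂)) ∧
            -- `R₄` is the error operator of the algorithm
            ∀ f : RobinRobin.Plane → ℝ,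
              MeasureTheory.MemLp f 2 (MeasureTheory.volume.restrict Ω) →
              ∃ (u : RobinRobin.Plane → ℝ)
                (gs : RobinRobin.spaceV K Ω (RobinRobin.interface Ω₁ Ω₂)),
                RobinRobin.IsGalerkinSolution K Ω Ω₁ Ω₂ ν₁ ν₂ f u ∧
                RobinRobin.SatisfiesRobin K Ω Ω₁ (RobinRobin.interface Ω₁ Ω₂) ν₁ γ₁ f gs u ∧
                ∀ g g' : RobinRobin.spaceV K Ω (RobinRobin.interface Ω₁ Ω₂),
                  RobinRobin.IsSweep K Ω Ω₁ Ω₂ ν₁ ν₂ γ₁ γ₂ θ f g g' ↔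
                    g' - gs = RobinRobin.R4 θ γ₁ γ₂ S₁ S₂ (g - gs) := by
  by_cases hσ : 0 < σ
  swap
  -- For σ ≤ 0 there is no regular triangulation, so any constants do.
  · exact ⟨1, one_pos, 1, one_pos, 1, one_pos, fun K hK hreg =>
      (hσ (hK.isUniformMesh hΩ.domain.isConnected.nonempty hreg).1).elim⟩
  have hκ : 0 < 1 / (2 * σ ^ 2) := by positivity
  obtain ⟨Ct, hCt, htrace⟩ := hΩ.exists_pairing_le
  obtain ⟨Ci, hCi, hinv⟩ := hΩ.symm.exists_inverse_inequality hκ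
  obtain ⟨C, hC, hext⟩ := hΩ.exists_extension hκ
  -- The inverse inequality bounds S₂ by ν₂Ci/h, and the factor 2 makes S₂ < γ₁ strict; 1/Ct turns
  -- the trace inequality into γ₂ ≤ S₁; C is the constant of the extension theorem.
  refine ⟨2 * Ci, by positivity, 1 / Ct, by positivity, C, hC,
    fun K hK hreg hcut ν₁ ν₂ hν₁ hν₂ => ?_⟩
  have hM : IsFittedMesh Ω Ω₁ Ω₂ K := ⟨hΩ, hK, hcut⟩
  obtain ⟨-, hU⟩ := hK.isUniformMesh hΩ.domain.isConnected.nonempty hreg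
  have hΓ₂ : interface Ω₁ Ω₂ = interface Ω₂ Ω₁ := (interface_comm Ω₁ Ω₂).symm
  have hfd := hK.finiteDimensional
  have hh := hU.h_pos
  obtain ⟨B, hB⟩ := hM.exists_pairing_form rfl
  obtain ⟨a₁, tr₁, hF₁⟩ := hM.exists_isSubdomainForm rfl ν₁ hB
  obtain ⟨a₂, tr₂, hF₂⟩ := hM.symm.exists_isSubdomainForm hΓ₂ ν₂ hB
  have hBpos : ∀ v, v ≠ 0 → 0 < B v v := fun v hv => by
    rw [hB]
    exact hM.pairing_pos rfl hU v hv
  have hBdef : ∀ v, B v v = 0 → v = 0 := fun v hv => by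
    by_contra h0
    exact (hBpos v h0).ne' hv
  have hBsymm : ∀ u v, B u v = B v u := fun u v => by rw [hB, hB, pairing_comm]
  have hiff₁ := hM.isSchur_iff rfl hF₁.form hB hF₁.trace
  have hiff₂ := hM.symm.isSchur_iff hΓ₂ hF₂.form hB hF₂.trace
  have hsub₁ := hΩ.interface_subset_closure₁
  have hsub₂ := hΩ.interface_subset_closure₂
  simp only [hiff₁, hiff₂]
  refine ⟨existsUnique_abstractSchur a₁ B tr₁ (hF₁.definite hM hν₁) hBdef hF₁.surjective,
    existsUnique_abstractSchur a₂ B tr₂ (hF₂.definite hM.symm hν₂) hBdef hF₂.surjective,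
    fun S₁ S₂ hS₁ hS₂ γ₁ γ₂ hγ₁ hγ₂ hγ₂' => ?_⟩
  have hBw : ∀ (w : spaceW K Ω) (x : spaceV K Ω (interface Ω₁ Ω₂)),
      EqOn w.1 x.1 (interface Ω₁ Ω₂) → B x x = pairing (interface Ω₁ Ω₂) w w := fun w x hx => by
    rw [hB, pairing_congr hΩ.isClosed_interface hx hx]
  have hγ₁' : 0 < γ₁ := lt_of_lt_of_le (by positivity) hγ₁
  have hr : 0 < C * (ν₁ / ν₂) := by positivity
  obtain ⟨hu₁, hu₂, hu₃, hspec, hspecR⟩ := robin_spectrum B hBsymm hBpos S₁ S₂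
    (hS₁.symmetric hBsymm hF₁.symm) (hS₂.symmetric hBsymm hF₂.symm) hγ₁' hγ₂ hr.le
    (fun x => by
      obtain ⟨z, rfl, hz⟩ := hS₁.exists_eq_energy x
      obtain ⟨w, rfl⟩ := restrictSub_surjective K Ω Ω₁ z
      have h1 := htrace K hM w w.2
      rw [hz, hF₁.restrictSub_eq hM, hBw w _ ((hF₁.trace_restrictSub hsub₁).1 rfl)]
      have hp : 0 ≤ pairing (interface Ω₁ Ω₂) w w := integral_nonneg fun x => mul_self_nonneg _
      calc γ₂ * pairing (interface Ω₁ Ω₂) w w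
          ≤ 1 / Ct * ν₁ * (Ct * energy 1 Ω₁ w w) := mul_le_mul hγ₂' h1 hp (by positivity)
        _ = ν₁ * energy 1 Ω₁ w w := by field_simp)
    (fun x => by
      obtain ⟨z, rfl, hz⟩ := hS₂.exists_eq_energy x
      rw [hz]
      exact hF₂.nonneg hM.symm hν₂ z)
    (fun x hx => by
      obtain ⟨z, rfl⟩ := hF₂.surjective x
      obtain ⟨w, rfl⟩ := restrictSub_surjective K Ω Ω₂ z
      obtain ⟨w', hw', hww', he⟩ := (hinv K _ hM.symm hU w w.2).2
      rw [← hΓ₂] at hww' he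
      have hw := (hF₂.trace_restrictSub hsub₂ (w := w)).1 rfl
      have h1 := hBpos _ hx
      rw [← hBw w _ hw] at he
      have h2 := (hF₂.trace_restrictSub hsub₂ (w := ⟨w', hw'⟩)).2 (hww'.trans hw)
      have h3 := hS₂.le_energy hF₂.symm (hF₂.nonneg hM.symm hν₂) (restrictSub K Ω Ω₂ ⟨w', hw'⟩)
      rw [h2, hF₂.restrictSub_eq hM.symm] at h3
      have h4 := mul_le_mul_of_nonneg_left he hν₂.le
      have h5 := mul_le_mul_of_nonneg_right hγ₁ h1.le
      have h6 : 0 < ν₂ * (Ci * (meshSize K)⁻¹ * B (tr₂ (restrictSub K Ω Ω₂ w))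
        (tr₂ (restrictSub K Ω Ω₂ w))) := by positivity
      linarith)
    (fun x => by
      obtain ⟨z, rfl, hz⟩ := hS₂.exists_eq_energy x
      obtain ⟨w, rfl⟩ := restrictSub_surjective K Ω Ω₂ z
      obtain ⟨w', hw', hww', he⟩ := hext K _ hM hU w w.2
      have hw := (hF₂.trace_restrictSub hsub₂ (w := w)).1 rfl
      have h2 := (hF₁.trace_restrictSub hsub₁ (w := ⟨w', hw'⟩)).2 (hww'.trans hw)
      have h3 := hS₁.le_energy hF₁.symm (hF₁.nonneg hM hν₁) (restrictSub K Ω Ω₁ ⟨w', hw'⟩)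
      rw [h2, hF₁.restrictSub_eq hM] at h3
      rw [hz, hF₂.restrictSub_eq hM.symm]
      refine h3.trans ((mul_le_mul_of_nonneg_left he hν₁.le).trans_eq ?_)
      field_simp)
  refine ⟨hu₁, hu₂, hu₃, hspec, fun θ hθ => ?_⟩
  set r := C * (ν₁ / ν₂) with hrdef
  -- With θ = 2/(2 + r) both ends 1 - θ and 1 - θ(1 + r) have modulus r/(2 + r), which is below 1
  -- and at most r.
  have hle : spectralRadius ℂ (LinearMap.baseChange ℂ (R4 θ γ₁ γ₂ S₁ S₂)) ≤
      ENNReal.ofReal (r / (2 + r)) := by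
    refine spectralRadius_le_of_spectrum_subset (hspecR θ (by rw [hθ]; positivity)) ?_ ?_
    · rw [hθ]
      refine le_of_eq ?_
      field_simp
      ring
    · rw [hθ]
      refine le_of_eq ?_
      field_simp
      ring
  refine ⟨hle.trans_lt ?_, hle.trans (ENNReal.ofReal_le_ofReal ?_), fun f hf =>
    hM.exists_error_operator hF₁ hF₂ hν₁ hν₂ hBdef hS₁ hS₂ hu₁ hu₂ hu₃ θ hf⟩
  · rw [← ENNReal.ofReal_one]
    refine (ENNReal.ofReal_lt_ofReal_iff one_pos).2 ?_
    rw [div_lt_one (by positivity)]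
    linarith
  · exact div_le_self hr.le (by linarith)
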